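/- Let $n\ge 0$ and let $\mathcal H=\mathcal H_n$ be the Iwahori–Hecke algebra of $S_n$ over $\mathbb Z[\xi]$, generated by $\tilde T_{s_1},\dots,\tilde T_{s_{n-1}}$ (with $s_i=(i\ \,i+1)$) subject to $\tilde T_{s_i}\tilde T_{s_j}=\tilde T_{s_j}\tilde T_{s_i}$ for $|i-j|\ge 2$, the braid relations $\tilde T_{s_i}\tilde T_{s_{i+1}}\tilde T_{s_i}=\tilde T_{s_{i+1}}\tilde T_{s_i}\tilde T_{s_{i+1}}$, and $\tilde T_{s_i}^2=1+\xi\tilde T_{s_i}$; let $\{\tilde T_w\mid w\in S_n\}$ be its standard basis. Put $\mathcal H^+=\sum_w\mathbb N[\xi]\tilde T_w$; for $a,b\in\mathcal H^+$ write $a\le b$ if $b-a\in\mathcal H^+$, and $a<b$ if moreover $a\ne b$. Likewise for $a,b\in\mathbb N[\xi]$ write $a\le b$ if $b-a\in\mathbb N[\xi]$. For compositions $\lambda,\mu$ of $n$ write $\lambda\le\mu$ ($\lambda$ refines $\mu$) if $\lambda=\mu$ or $\mu$ is obtained from $\lambda$ by adding together adjacent components. For a composition $\lambda$ of $n$ let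 $S_\lambda\le S_n$ be the parabolic subgroup, $w_\lambda$ the product in increasing order of the simple reflections $s_i\in S_\lambda$, $l_\lambda=\ell(w_\lambda)$, and $\lambda-1$ the composition obtained by replacing each component $\lambda_i>1$ by the two components $\lambda_i-1,\,1$. For parabolic subgroups $U\le K$ put $\mathcal N_{K,U}(h)=\sum_d\tilde T_{d^{-1}}h\tilde T_d$, the sum over the elements $d\in K$ of minimal length in their coset $Ud$, and let $$\eta_\lambda=\mathcal N_{S_{\lambda-1},1}(\tilde T_{w_\lambda}),\qquad b_\lambda=\mathcal N_{S_n,S_\lambda}(\eta_\lambda).$$ **Theorem.** If $\lambda,\mu$ are compositions of $n$ with $\lambda<\mu$ in the refinement order, then $\xi^{l_\mu-l_\lambda}b_\mu<b_\lambda$ (both sides lying in $\mathcal H^+$). **Corollary.** There is exactly one family $(\Gamma_\nu)_{\nu\vdash n}$ of central elements of $\mathcal H$ such that $\Gamma_\nu|_{\xi=0}=\sum_{w\in C_\nu}\tilde T_w$ and $\Gamma_\nu-\sum_{w\in C_\nu}\tilde T_w$ contains no $\tilde T_w$ with $w$ a shortest element of a conjugacy class, where $C_\nu$ is the class of cycle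 type $\nu$. For every composition $\alpha$ of $n$ there is a unique expression $b_\alpha=\sum_{\nu\vdash n}r_{\alpha,\nu}\Gamma_\nu$ with $r_{\alpha,\nu}\in\mathbb Z[\xi]$. If $\alpha<\beta$ in the refinement order, then $\xi^{l_\beta-l_\alpha}r_{\beta,\nu}\le r_{\alpha,\nu}$ in $\mathbb N[\xi]$ for all $\nu\vdash n$. -/

import Mathlib

open Polynomial

namespace HeckeNorm

/-! ### The symmetric group -/

/-- The simple reflection interchanging the adjacent letters `i` and `i + 1`. The letters are
`0, …, n - 1`, so this is the transposition usually written `s_{i+1} = (i+1  i+2)`. -/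
def simpleRefl {n : ℕ} (i : Fin (n - 1)) : Equiv.Perm (Fin n) :=
  Equiv.swap ⟨i, by omega⟩ ⟨i + 1, by omega⟩

/-- The permutation spelled by a word in the simple reflections. -/
def wordProd {n : ℕ} (l : List (Fin (n - 1))) : Equiv.Perm (Fin n) :=
  (l.map simpleRefl).prod

theorem exists_word {n : ℕ} (w : Equiv.Perm (Fin n)) :
    ∃ l : List (Fin (n - 1)), wordProd l = w := by
  rcases n with _ | n
  · exact ⟨[], Subsingleton.elim _ _⟩
  · have h : w ∈ Submonoid.closure
        (Set.range fun i : Fin n => Equiv.swap i.castSucc i.succ) := by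
      rw [Equiv.Perm.mclosure_swap_castSucc_succ]
      trivial
    induction h using Submonoid.closure_induction with
    | mem x hx =>
      obtain ⟨i, rfl⟩ := hx
      exact ⟨[i], by simp [wordProd, simpleRefl]; rfl⟩
    | one => exact ⟨[], rfl⟩
    | mul x y _ _ hx hy =>
      obtain ⟨a, rfl⟩ := hx
      obtain ⟨b, rfl⟩ := hy
      exact ⟨a ++ b, by simp [wordProd]⟩

/-- The length `ℓ(w)`: the least number of simple reflections in a word for `w`. -/
noncomputable def len {n : ℕ} (w : Equiv.Perm (Fin n)) : ℕ :=
  sInf {k | ∃ l : List (Fin (n - 1)), wordProd l = w ∧ l.length = k}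

theorem exists_reducedWord {n : ℕ} (w : Equiv.Perm (Fin n)) :
    ∃ l : List (Fin (n - 1)), wordProd l = w ∧ l.length = len w := by
  obtain ⟨l, hl⟩ := exists_word w
  have hne : {k | ∃ l : List (Fin (n - 1)), wordProd l = w ∧ l.length = k}.Nonempty :=
    ⟨_, l, hl, rfl⟩
  exact Nat.sInf_mem hne

/-- A reduced expression of `w`. -/
noncomputable def reducedWord {n : ℕ} (w : Equiv.Perm (Fin n)) : List (Fin (n - 1)) :=
  (exists_reducedWord w).choose

/-- `w` has minimal length in its conjugacy class. -/
def IsShortest {n : ℕ} (w : Equiv.Perm (Fin n)) : Prop :=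
  ∀ v : Equiv.Perm (Fin n), IsConj v w → len w ≤ len v

/-- `w` lies in the conjugacy class `C_ν` of permutations of cycle type `ν` (fixed points count as
cycles of length one). -/
def InClass {n : ℕ} (ν : n.Partition) (w : Equiv.Perm (Fin n)) : Prop :=
  w.partition.parts = ν.parts

/-! ### Compositions -/

/-- `μ ≤ ν` in the refinement order: `ν` is obtained from `μ` by adding together adjacent
components, i.e. by cutting `μ` into consecutive lists and summing each of them. -/
def Refines {n : ℕ} (μ ν : Composition n) : Prop :=
  ∃ L : List (List ℕ), L.flatten = μ.blocks ∧ L.map List.sum = ν.blocks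

/-- `μ < ν` in the refinement order. -/
def StrictRefines {n : ℕ} (μ ν : Composition n) : Prop :=
  Refines μ ν ∧ μ ≠ ν

/-- The composition `ν - 1`: every component `k > 1` is replaced by the two components
`k - 1, 1`. -/
def subOne {n : ℕ} (ν : Composition n) : Composition n where
  blocks := ν.blocks.flatMap fun k => if 1 < k then [k - 1, 1] else [k]
  blocks_pos := by
    intro i hi
    obtain ⟨k, hk, hik⟩ := List.mem_flatMap.1 hi
    have := ν.blocks_pos hk
    split_ifs at hik <;> simp at hik <;> omega
  blocks_sum := by
    have key : ∀ l : List ℕ,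
        (l.flatMap fun k => if 1 < k then [k - 1, 1] else [k]).sum = l.sum := by
      intro l
      induction l with
      | nil => rfl
      | cons a l ih =>
        rw [List.flatMap_cons, List.sum_append, ih, List.sum_cons]
        split_ifs <;> simp
        omega
    rw [key, ν.blocks_sum]

/-- The simple reflection `simpleRefl i` is one of the generators of `S_ν`: the number `i + 1`
satisfies `ν_1 + … + ν_k < i + 1 < ν_1 + … + ν_{k+1}` for some `k`. -/
def IsInner {n : ℕ} (ν : Composition n) (i : Fin (n - 1)) : Prop :=
  ∃ k : ℕ, ν.sizeUpTo k < i + 1 ∧ i + 1 < ν.sizeUpTo (k + 1)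

/-- The parabolic subgroup `S_ν`. -/
def parabolic {n : ℕ} (ν : Composition n) : Subgroup (Equiv.Perm (Fin n)) :=
  Subgroup.closure {s | ∃ i : Fin (n - 1), IsInner ν i ∧ s = simpleRefl i}

open Classical in
/-- The Coxeter element `w_ν`: the product of the generators of `S_ν`, in increasing order. -/
noncomputable def coxeterElt {n : ℕ} (ν : Composition n) : Equiv.Perm (Fin n) :=
  wordProd ((List.finRange (n - 1)).filter fun i => IsInner ν i)

/-- The number `l_ν = ℓ(w_ν)`. -/
noncomputable def minLen {n : ℕ} (ν : Composition n) : ℕ :=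
  len (coxeterElt ν)

/-! ### The Hecke algebra -/

/-- The defining relations of the Hecke algebra over `ℤ[ξ]`, where `ξ` is `Polynomial.X`. -/
inductive HeckeRel (n : ℕ) :
    FreeAlgebra ℤ[X] (Fin (n - 1)) → FreeAlgebra ℤ[X] (Fin (n - 1)) → Prop
  | comm (i j : Fin (n - 1)) (h : (i : ℕ) + 2 ≤ j ∨ (j : ℕ) + 2 ≤ i) :
      HeckeRel n (FreeAlgebra.ι ℤ[X] i * FreeAlgebra.ι ℤ[X] j)
        (FreeAlgebra.ι ℤ[X] j * FreeAlgebra.ι ℤ[X] i)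
  | braid (i j : Fin (n - 1)) (h : (j : ℕ) = i + 1) :
      HeckeRel n (FreeAlgebra.ι ℤ[X] i * FreeAlgebra.ι ℤ[X] j * FreeAlgebra.ι ℤ[X] i)
        (FreeAlgebra.ι ℤ[X] j * FreeAlgebra.ι ℤ[X] i * FreeAlgebra.ι ℤ[X] j)
  | quad (i : Fin (n - 1)) :
      HeckeRel n (FreeAlgebra.ι ℤ[X] i * FreeAlgebra.ι ℤ[X] i)
        (1 + (X : ℤ[X]) • FreeAlgebra.ι ℤ[X] i)

/-- The Iwahori–Hecke algebra of `S_n` over `ℤ[ξ]`. -/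
abbrev Hecke (n : ℕ) : Type := RingQuot (HeckeRel n)

/-- The generator attached to a simple reflection. -/
noncomputable def gen {n : ℕ} (i : Fin (n - 1)) : Hecke n :=
  RingQuot.mkAlgHom ℤ[X] (HeckeRel n) (FreeAlgebra.ι ℤ[X] i)

/-- The element `T_w`: the product of the generators along a reduced expression of `w`. By
Matsumoto's theorem it does not depend on the reduced expression. -/
noncomputable def T {n : ℕ} (w : Equiv.Perm (Fin n)) : Hecke n :=
  ((reducedWord w).map gen).prod

/-- The polynomial `p` lies in `ℕ[ξ]`. -/
def PolyPos (p : ℤ[X]) : Prop := ∀ i, 0 ≤ p.coeff i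

/-- The order `p ≤ q` on `ℕ[ξ]`. -/
def PolyLE (p q : ℤ[X]) : Prop := PolyPos p ∧ PolyPos q ∧ PolyPos (q - p)

/-- The positive cone `H⁺ = ∑_w ℕ[ξ] T_w`. -/
def posCone (n : ℕ) : Set (Hecke n) :=
  {h | ∃ f : Equiv.Perm (Fin n) → ℤ[X], (∀ w, PolyPos (f w)) ∧ h = ∑ w, f w • T w}

/-- The strict order `a < b` on the positive cone. -/
def HeckeLT {n : ℕ} (a b : Hecke n) : Prop :=
  a ∈ posCone n ∧ b ∈ posCone n ∧ b - a ∈ posCone n ∧ b - a ≠ 0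

/-! ### Norms -/

/-- `d` is a distinguished right coset representative of `U` in `K`: it lies in `K` and has minimal
length in the coset `U d`. -/
def IsDistinguished {n : ℕ} (K U : Subgroup (Equiv.Perm (Fin n))) (d : Equiv.Perm (Fin n)) :
    Prop :=
  d ∈ K ∧ ∀ u ∈ U, len d ≤ len (u * d)

open Classical in
/-- The relative norm of `h` from `U` to `K`. -/
noncomputable def relNorm {n : ℕ} (K U : Subgroup (Equiv.Perm (Fin n))) (h : Hecke n) : Hecke n :=
  ∑ d with IsDistinguished K U d, T d⁻¹ * h * T d

/-- `η_ν`, the norm of `T_{w_ν}` from the trivial group to `S_{ν-1}`. -/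
noncomputable def eta {n : ℕ} (ν : Composition n) : Hecke n :=
  relNorm (parabolic (subOne ν)) ⊥ (T (coxeterElt ν))

/-- `b_ν`, the norm of `η_ν` from `S_ν` to `S_n`. -/
noncomputable def normElt {n : ℕ} (ν : Composition n) : Hecke n :=
  relNorm ⊤ (parabolic ν) (eta ν)

/-! ### Class elements -/

/-- `Γ` is the family of class elements: every `Γ_ν` is central, specializes at `ξ = 0` (where
`T_w` becomes `w` in the group ring `ℤ S_n`) to the sum of the conjugacy class `C_ν`, and
`Γ_ν - ∑_{w ∈ C_ν} T_w` contains no `T_w` with `w` a shortest element of a conjugacy class. Here `f`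
is the family of coefficients of `Γ_ν` with respect to the basis of the `T_w`. -/
def IsClassElements {n : ℕ} (Γ : n.Partition → Hecke n) : Prop :=
  ∀ ν : n.Partition, Γ ν ∈ Subalgebra.center ℤ[X] (Hecke n) ∧
    ∃ f : Equiv.Perm (Fin n) → ℤ[X], Γ ν = ∑ w, f w • T w ∧
      (∀ w, InClass ν w → (f w).eval 0 = 1) ∧
      (∀ w, ¬ InClass ν w → (f w).eval 0 = 0) ∧
      (∀ w, IsShortest w → InClass ν w → f w = 1) ∧
      (∀ w, IsShortest w → ¬ InClass ν w → f w = 0)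

end HeckeNorm

/-! A composition is encoded by the set of simple reflections generating its parabolic subgroup
(`inner`). Refinement becomes inclusion `J ⊆ K`, the number `l_λ` becomes the cardinality of `J`,
and `λ - 1` becomes `shrink`. Write `η_J` for the element attached to `J`, and `W_J`, `H_J` for the
parabolic subgroup and subalgebra.

The element `η_J` is the product of the Jucys–Murphy elements of `H_J` (`relNorm_T_coxPerm`), hence
central in `H_J` (`g_mul_murphyProd`). Norms are transitive (`relNorm_relNorm`), preserve positivity
because the structure constants lie in `ℕ[ξ]`, and carry elements central in the small algebra to
elements commuting with the generators of the large one (`g_mul_relNorm`). So it suffices to remove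
a single generator `k` from `K` and to show that the norm of `η_{K \ {k}}` to `W_K` is at least `ξ
η_K` (`relNorm_murphyProd_sdiff`).

The difference is central in `H_K`. For such an element, trace identities give recursions with
coefficients in `ℕ[ξ]` along cyclic shifts. By the Geck–Pfeiffer reduction (`cyclicShift_induction`)
positivity need only be checked at the Coxeter elements `w_{J'}`, `J' ⊆ K`
(`mem_posSemiring_of_commute`). There `η_K` has coefficient `1` at `w_K` and `0` elsewhere
(`coef_coxPerm_murphyProd`), so only `w_K` matters. At `w_K` the norm has coefficient at least `ξ`:
conjugating `T_{w_{K \ {k}}}` by the permutation that interchanges the two blocks created by the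
removal of `k` produces `ξ T_{w_K}` (`exists_distinguished_conj`). Strictness is seen at `ξ = 0`.

For the corollary, a central element is determined by its coefficients at one Coxeter element per
class (`exists_classPolynomials`). The matrix of these coefficients for the `b_μ`, one `μ` for each
class, is diagonal with positive entries at `ξ = 0`, so identities between class polynomials can be
tested on the `b_μ`. This yields the dual central elements `Γ_ν` (`exists_commute_coef_classRep`).
Then `r_{α,ν}` is a coefficient of `b_α`, and the inequality is the theorem read off one coefficient
at a time. -/

namespace HeckeNorm

variable {n : ℕ}

/-! ### Adjacent transpositions -/

/-- The adjacent transposition `s_i`, indexed by a natural number; it is `1` when `i + 1 ≥ n`. -/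
def sw (i : ℕ) : Equiv.Perm (Fin n) :=
  if h : i + 1 < n then Equiv.swap ⟨i, by omega⟩ ⟨i + 1, h⟩ else 1

theorem simpleRefl_eq_sw (i : Fin (n - 1)) : simpleRefl i = sw (n := n) i := by
  rw [sw, dif_pos (by omega)]; rfl

theorem sw_val {i : ℕ} (h : i + 1 < n) (x : Fin n) :
    ((sw i x : Fin n) : ℕ) = if (x : ℕ) = i then i + 1 else if (x : ℕ) = i + 1 then i else x := by
  rw [sw, dif_pos h, Equiv.swap_apply_def]
  simp only [Fin.ext_iff]
  split_ifs <;> rfl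

theorem sw_lo {i : ℕ} (h : i + 1 < n) : sw i (⟨i, by omega⟩ : Fin n) = ⟨i + 1, h⟩ := by
  ext; simp [sw_val h]

theorem sw_hi {i : ℕ} (h : i + 1 < n) : sw i (⟨i + 1, h⟩ : Fin n) = ⟨i, by omega⟩ := by
  ext; simp [sw_val h]

theorem sw_of_ne {i : ℕ} (h : i + 1 < n) {x : Fin n} (h1 : (x : ℕ) ≠ i) (h2 : (x : ℕ) ≠ i + 1) :
    sw i x = x := by
  ext; simp [sw_val h, h1, h2]

@[simp] theorem sw_mul_self (i : ℕ) : sw i * sw i = (1 : Equiv.Perm (Fin n)) := by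
  rw [sw]; split_ifs <;> simp

@[simp] theorem sw_sw (i : ℕ) (x : Fin n) : sw i (sw i x) = x := by
  rw [← Equiv.Perm.mul_apply, sw_mul_self, Equiv.Perm.one_apply]

@[simp] theorem sw_inv (i : ℕ) : (sw i : Equiv.Perm (Fin n))⁻¹ = sw i :=
  inv_eq_of_mul_eq_one_left (sw_mul_self i)

@[simp] theorem mul_sw_mul_sw (w : Equiv.Perm (Fin n)) (i : ℕ) : w * sw i * sw i = w := by
  rw [mul_assoc, sw_mul_self, mul_one]

@[simp] theorem sw_mul_sw_mul (w : Equiv.Perm (Fin n)) (i : ℕ) : sw i * (sw i * w) = w := by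
  rw [← mul_assoc, sw_mul_self, one_mul]

theorem sw_ne_one {i : ℕ} (h : i + 1 < n) : (sw i : Equiv.Perm (Fin n)) ≠ 1 := by
  intro h1
  have := sw_lo h
  rw [h1] at this
  simp [Fin.ext_iff] at this

theorem sw_comm {i j : ℕ} (h : i + 2 ≤ j ∨ j + 2 ≤ i) :
    (sw i : Equiv.Perm (Fin n)) * sw j = sw j * sw i := by
  by_cases hi : i + 1 < n
  · by_cases hj : j + 1 < n
    · ext x
      simp only [Equiv.Perm.mul_apply, sw_val hi, sw_val hj]
      split_ifs <;> omega
    · simp [sw, hj]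
  · simp [sw, hi]

theorem sw_braid {i : ℕ} (h : i + 2 < n) :
    (sw i : Equiv.Perm (Fin n)) * sw (i + 1) * sw i = sw (i + 1) * sw i * sw (i + 1) := by
  ext x
  simp only [Equiv.Perm.mul_apply, sw_val (show i + 1 < n by omega), sw_val (show i + 1 + 1 < n by omega)]
  split_ifs <;> omega

/-! ### Inversions and length -/

/-- The set of inversions of a permutation. -/
def inversions (w : Equiv.Perm (Fin n)) : Finset (Fin n × Fin n) :=
  {p | p.1 < p.2 ∧ w p.2 < w p.1}

theorem mem_inversions {w : Equiv.Perm (Fin n)} {x y : Fin n} :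
    (x, y) ∈ inversions w ↔ x < y ∧ w y < w x := by
  simp [inversions]

/-- `w i < w (i + 1)`. -/
def Asc (w : Equiv.Perm (Fin n)) (i : ℕ) : Prop :=
  ∃ h : i + 1 < n, w ⟨i, by omega⟩ < w ⟨i + 1, h⟩

/-- `w (i + 1) < w i`. -/
def Desc (w : Equiv.Perm (Fin n)) (i : ℕ) : Prop :=
  ∃ h : i + 1 < n, w ⟨i + 1, h⟩ < w ⟨i, by omega⟩

theorem Asc.lt {w : Equiv.Perm (Fin n)} {i : ℕ} (h : Asc w i) : i + 1 < n := h.1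

theorem Desc.lt {w : Equiv.Perm (Fin n)} {i : ℕ} (h : Desc w i) : i + 1 < n := h.1

theorem asc_or_desc (w : Equiv.Perm (Fin n)) {i : ℕ} (h : i + 1 < n) : Asc w i ∨ Desc w i := by
  have : w ⟨i, by omega⟩ ≠ w ⟨i + 1, h⟩ := fun e => by
    have := w.injective e
    simp [Fin.ext_iff] at this
  rcases lt_or_gt_of_ne this with h1 | h1
  · exact Or.inl ⟨h, h1⟩
  · exact Or.inr ⟨h, h1⟩

theorem Asc.not_desc {w : Equiv.Perm (Fin n)} {i : ℕ} (h : Asc w i) : ¬ Desc w i := fun h' =>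
  lt_asymm h.2 h'.2

theorem asc_mul_sw {w : Equiv.Perm (Fin n)} {i : ℕ} : Asc (w * sw i) i ↔ Desc w i := by
  constructor <;> rintro ⟨h, h'⟩ <;> refine ⟨h, ?_⟩ <;>
    simpa [Equiv.Perm.mul_apply, sw_lo h, sw_hi h] using h'

theorem desc_mul_sw {w : Equiv.Perm (Fin n)} {i : ℕ} : Desc (w * sw i) i ↔ Asc w i := by
  rw [← asc_mul_sw, mul_sw_mul_sw]

/-- Applying `sw i` to both entries preserves the order of every pair other than `(i, i + 1)` and
its reverse. So the inversions of `w * sw i` are the images of those of `w` together with the new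
pair `(i, i + 1)`. -/
theorem card_inversions_mul_sw {w : Equiv.Perm (Fin n)} {i : ℕ} (h : Asc w i) :
    (inversions (w * sw i)).card = (inversions w).card + 1 := by
  obtain ⟨hi, hlt⟩ := h
  have hinj : Function.Injective (Prod.map (sw i : Equiv.Perm (Fin n)) (sw i : Equiv.Perm (Fin n))) :=
    (Equiv.injective _).prodMap (Equiv.injective _)
  have key : inversions (w * sw i) = insert (⟨i, by omega⟩, ⟨i + 1, hi⟩)
      ((inversions w).image (Prod.map (sw i) (sw i))) := by
    ext ⟨x, y⟩
    have himg : (x, y) ∈ (inversions w).image (Prod.map (sw i) (sw i)) ↔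
        (sw i x, sw i y) ∈ inversions w := by
      constructor
      · intro h
        obtain ⟨⟨a, b⟩, hab, e⟩ := Finset.mem_image.1 h
        simp only [Prod.map_apply, Prod.mk.injEq] at e
        rw [← e.1, ← e.2]
        simpa using hab
      · intro h
        exact Finset.mem_image.2 ⟨_, h, by simp⟩
    rw [Finset.mem_insert, himg]
    simp only [mem_inversions, Equiv.Perm.mul_apply, Prod.mk.injEq]
    by_cases h1 : (x : ℕ) = i ∧ (y : ℕ) = i + 1
    · have hx : x = ⟨i, by omega⟩ := Fin.ext h1.1
      have hy : y = ⟨i + 1, hi⟩ := Fin.ext h1.2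
      simp only [hx, hy, sw_lo hi, sw_hi hi]
      simp [hlt]
    · by_cases h2 : (x : ℕ) = i + 1 ∧ (y : ℕ) = i
      · have hy : y = ⟨i, by omega⟩ := Fin.ext h2.2
        have hx : x = ⟨i + 1, hi⟩ := Fin.ext h2.1
        simp only [hx, hy, sw_lo hi, sw_hi hi]
        simp [hlt.le]
      · have : (sw i x < sw i y) ↔ x < y := by
          rw [Fin.lt_def, Fin.lt_def, sw_val hi, sw_val hi]
          split_ifs <;> omega
        rw [this]
        constructor
        · exact Or.inr
        · rintro (⟨rfl, rfl⟩ | h)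
          · simp at h1
          · exact h
  rw [key, Finset.card_insert_of_notMem, Finset.card_image_of_injective _ hinj]
  intro h
  obtain ⟨⟨a, b⟩, hab, e⟩ := Finset.mem_image.1 h
  simp only [Prod.map_apply, Prod.mk.injEq] at e
  have ha : a = ⟨i + 1, hi⟩ := by rw [← sw_lo hi, ← e.1, sw_sw]
  have hb : b = ⟨i, by omega⟩ := by rw [← sw_hi hi, ← e.2, sw_sw]
  rw [ha, hb, mem_inversions] at hab
  simp at hab

theorem card_inversions_of_desc {w : Equiv.Perm (Fin n)} {i : ℕ} (h : Desc w i) :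
    (inversions w).card = (inversions (w * sw i)).card + 1 := by
  have := card_inversions_mul_sw (asc_mul_sw.2 h)
  rwa [mul_sw_mul_sw] at this

theorem card_inversions_one : (inversions (1 : Equiv.Perm (Fin n))).card = 0 := by
  rw [Finset.card_eq_zero, inversions, Finset.filter_eq_empty_iff]
  rintro ⟨a, b⟩ - ⟨h1, h2⟩
  exact lt_asymm h1 h2

/-- A permutation without descents is the identity. -/
theorem eq_one_of_asc {w : Equiv.Perm (Fin n)} (h : ∀ i, i + 1 < n → Asc w i) : w = 1 := by
  have hmono : StrictMono w := by
    intro a b hab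
    obtain ⟨a, ha⟩ := a
    obtain ⟨b, hb⟩ := b
    obtain ⟨k, rfl⟩ := Nat.exists_eq_add_of_lt (show a < b from hab)
    clear hab
    induction k with
    | zero => exact (h a hb).2
    | succ k ih => exact (ih (by omega)).trans (h (a + k + 1) hb).2
  ext x
  have := hmono.monotone
  have e : (OrderIso.ofSurjective ⟨⟨w, w.injective⟩, hmono.le_iff_le⟩ w.surjective
    : Fin n ≃o Fin n) = OrderIso.refl _ := Subsingleton.elim _ _
  have := congrArg (fun f : Fin n ≃o Fin n => f x) e
  simpa using congrArg Fin.val this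

theorem exists_desc {w : Equiv.Perm (Fin n)} (h : w ≠ 1) : ∃ i, Desc w i := by
  by_contra! hc
  exact h (eq_one_of_asc fun i hi => (asc_or_desc w hi).resolve_right (hc i))

theorem wordProd_nil : wordProd ([] : List (Fin (n - 1))) = 1 := rfl

theorem wordProd_cons (i : Fin (n - 1)) (l : List (Fin (n - 1))) :
    wordProd (i :: l) = sw i * wordProd l := by
  rw [wordProd, List.map_cons, List.prod_cons, simpleRefl_eq_sw]; rfl

theorem wordProd_append (l l' : List (Fin (n - 1))) :
    wordProd (l ++ l') = wordProd l * wordProd l' := by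
  simp [wordProd]

theorem wordProd_concat (l : List (Fin (n - 1))) (i : Fin (n - 1)) :
    wordProd (l ++ [i]) = wordProd l * sw i := by
  rw [wordProd_append, wordProd_cons, wordProd_nil, mul_one]

theorem card_inversions_mul_sw_le (w : Equiv.Perm (Fin n)) (i : ℕ) :
    (inversions (w * sw i)).card ≤ (inversions w).card + 1 := by
  by_cases hi : i + 1 < n
  · rcases asc_or_desc w hi with h | h
    · exact (card_inversions_mul_sw h).le
    · have := card_inversions_of_desc h; omega
  · simp [sw, hi]

theorem card_inversions_wordProd_le (l : List (Fin (n - 1))) :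
    (inversions (wordProd l)).card ≤ l.length := by
  induction l using List.reverseRecOn with
  | nil => exact card_inversions_one.le
  | append_singleton l i ih =>
    rw [wordProd_concat, List.length_append, List.length_singleton]
    exact (card_inversions_mul_sw_le _ _).trans (by omega)

theorem exists_word_card_inversions (w : Equiv.Perm (Fin n)) :
    ∃ l : List (Fin (n - 1)), wordProd l = w ∧ l.length = (inversions w).card := by
  induction hk : (inversions w).card generalizing w with
  | zero =>
    refine ⟨[], ?_, rfl⟩
    by_contra h
    obtain ⟨i, hi⟩ := exists_desc (Ne.symm h)
    have := card_inversions_of_desc hi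
    omega
  | succ k ih =>
    have hw : w ≠ 1 := by rintro rfl; rw [card_inversions_one] at hk; omega
    obtain ⟨i, hi⟩ := exists_desc hw
    obtain ⟨l, hl, hlk⟩ := ih (w * sw i) (by have := card_inversions_of_desc hi; omega)
    have := hi.lt
    exact ⟨l ++ [⟨i, by omega⟩], by rw [wordProd_concat, hl, mul_sw_mul_sw], by simp [hlk]⟩

theorem len_le_length (l : List (Fin (n - 1))) : len (wordProd l) ≤ l.length :=
  Nat.sInf_le ⟨l, rfl, rfl⟩

/-- Right multiplication by an adjacent transposition raises the number of inversions by at most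
one, and for `w ≠ 1` some descent lowers it by exactly one. -/
theorem len_eq_card_inversions (w : Equiv.Perm (Fin n)) : len w = (inversions w).card := by
  apply le_antisymm
  · obtain ⟨l, rfl, hl⟩ := exists_word_card_inversions w
    exact (len_le_length l).trans hl.le
  · obtain ⟨l, rfl, hl⟩ := exists_reducedWord w
    exact (card_inversions_wordProd_le l).trans hl.le

theorem len_inv (w : Equiv.Perm (Fin n)) : len w⁻¹ = len w := by
  have key : ∀ w : Equiv.Perm (Fin n), len w⁻¹ ≤ len w := by
    intro w
    obtain ⟨l, rfl, hl⟩ := exists_reducedWord w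
    have : (wordProd l)⁻¹ = wordProd l.reverse := by
      clear hl
      induction l with
      | nil => simp [wordProd_nil]
      | cons a l ih =>
        rw [wordProd_cons, mul_inv_rev, ih, sw_inv, List.reverse_cons, wordProd_concat]
    rw [this, ← hl, ← List.length_reverse]
    exact len_le_length _
  exact le_antisymm (key w) (by simpa using key w⁻¹)

theorem len_one : len (1 : Equiv.Perm (Fin n)) = 0 := by
  rw [len_eq_card_inversions, card_inversions_one]

theorem Asc.len_mul_sw {w : Equiv.Perm (Fin n)} {i : ℕ} (h : Asc w i) :
    len (w * sw i) = len w + 1 := by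
  simp only [len_eq_card_inversions, card_inversions_mul_sw h]

theorem Desc.len_mul_sw {w : Equiv.Perm (Fin n)} {i : ℕ} (h : Desc w i) :
    len w = len (w * sw i) + 1 := by
  simp only [len_eq_card_inversions, card_inversions_of_desc h]

theorem Asc.len_sw_mul {w : Equiv.Perm (Fin n)} {i : ℕ} (h : Asc w⁻¹ i) :
    len (sw i * w) = len w + 1 := by
  rw [← len_inv, mul_inv_rev, sw_inv, h.len_mul_sw, len_inv]

theorem Desc.len_sw_mul {w : Equiv.Perm (Fin n)} {i : ℕ} (h : Desc w⁻¹ i) :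
    len w = len (sw i * w) + 1 := by
  rw [← len_inv w, ← len_inv (sw i * w), mul_inv_rev, sw_inv, h.len_mul_sw]

theorem asc_iff_len {w : Equiv.Perm (Fin n)} {i : ℕ} (hi : i + 1 < n) :
    Asc w i ↔ len w < len (w * sw i) := by
  refine ⟨fun h => by rw [h.len_mul_sw]; omega, fun h => ?_⟩
  refine (asc_or_desc w hi).resolve_right fun h' => ?_
  have := h'.len_mul_sw
  omega

theorem asc_inv_iff_len {w : Equiv.Perm (Fin n)} {i : ℕ} (hi : i + 1 < n) :
    Asc w⁻¹ i ↔ len w < len (sw i * w) := by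
  rw [asc_iff_len hi, len_inv, ← len_inv (sw i * w), mul_inv_rev, sw_inv]

theorem asc_inv_sw_mul {w : Equiv.Perm (Fin n)} {i : ℕ} : Asc (sw i * w)⁻¹ i ↔ Desc w⁻¹ i := by
  rw [mul_inv_rev, sw_inv, asc_mul_sw]

theorem desc_inv_sw_mul {w : Equiv.Perm (Fin n)} {i : ℕ} : Desc (sw i * w)⁻¹ i ↔ Asc w⁻¹ i := by
  rw [mul_inv_rev, sw_inv, desc_mul_sw]

/-! ### Matsumoto's theorem -/

/-- The generator `T_{s_i}`, indexed by a natural number; it is `1` when `i + 1 ≥ n`. -/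
noncomputable def g (i : ℕ) : Hecke n :=
  if h : i + 1 < n then gen ⟨i, by omega⟩ else 1

theorem gen_eq_g (i : Fin (n - 1)) : gen i = g (n := n) i := by
  rw [g, dif_pos (by omega)]

theorem g_comm {i j : ℕ} (h : i + 2 ≤ j ∨ j + 2 ≤ i) : (g i : Hecke n) * g j = g j * g i := by
  by_cases hi : i + 1 < n
  · by_cases hj : j + 1 < n
    · rw [g, dif_pos hi, g, dif_pos hj, gen, gen, ← map_mul, ← map_mul]
      exact RingQuot.mkAlgHom_rel _ (HeckeRel.comm _ _ h)
    · simp [g, hj]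
  · simp [g, hi]

theorem g_braid {i : ℕ} (h : i + 2 < n) :
    (g i : Hecke n) * g (i + 1) * g i = g (i + 1) * g i * g (i + 1) := by
  rw [g, dif_pos (by omega), g, dif_pos (by omega), gen, gen]
  simp only [← map_mul]
  exact RingQuot.mkAlgHom_rel _ (HeckeRel.braid _ _ rfl)

theorem g_mul_self {i : ℕ} (h : i + 1 < n) : (g i : Hecke n) * g i = 1 + (X : ℤ[X]) • g i := by
  rw [g, dif_pos h, gen, ← map_mul, RingQuot.mkAlgHom_rel _ (HeckeRel.quad _), map_add, map_one,
    map_smul]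

theorem map_gen_prod_cons (i : Fin (n - 1)) (l : List (Fin (n - 1))) :
    ((i :: l).map gen).prod = g i * (l.map gen).prod := by
  rw [List.map_cons, List.prod_cons, gen_eq_g]

theorem desc_inv_of_reduced {i : Fin (n - 1)} {l : List (Fin (n - 1))}
    (h : (i :: l).length = len (wordProd (i :: l))) :
    Desc (wordProd (i :: l))⁻¹ i ∧ l.length = len (wordProd l) := by
  have h1 : len (wordProd l) ≤ l.length := len_le_length l
  rw [wordProd_cons, List.length_cons] at h
  have h2 : Asc (wordProd l)⁻¹ i := (asc_inv_iff_len (by omega)).2 (by omega)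
  refine ⟨?_, ?_⟩
  · rwa [wordProd_cons, desc_inv_sw_mul]
  · have := h2.len_sw_mul
    omega

/-- Two commuting left descents can be split off. -/
theorem len_of_desc_comm {w : Equiv.Perm (Fin n)} {i j : ℕ} (hi : Desc w⁻¹ i) (hj : Desc w⁻¹ j)
    (h : i + 2 ≤ j) : len w = len (sw j * (sw i * w)) + 2 := by
  have h1 : Desc (sw i * w)⁻¹ j := by
    refine ⟨hj.lt, ?_⟩
    rw [mul_inv_rev, sw_inv, Equiv.Perm.mul_apply, Equiv.Perm.mul_apply,
      sw_of_ne hi.lt (by simp; omega) (by simp; omega),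
      sw_of_ne hi.lt (by simp; omega) (by simp; omega)]
    exact hj.2
  have := hi.len_sw_mul
  have := h1.len_sw_mul
  omega

/-- Two braided left descents can be split off. -/
theorem len_of_desc_braid {w : Equiv.Perm (Fin n)} {i : ℕ} (hi : Desc w⁻¹ i)
    (hj : Desc w⁻¹ (i + 1)) : len w = len (sw i * (sw (i + 1) * (sw i * w))) + 3 := by
  have hn := hj.lt
  have e0 : (sw i (⟨i + 2, by omega⟩ : Fin n)) = ⟨i + 2, by omega⟩ :=
    sw_of_ne hi.lt (by simp) (by simp)
  have e1 : (sw (i + 1) (⟨i, by omega⟩ : Fin n)) = ⟨i, by omega⟩ :=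
    sw_of_ne hj.lt (by simp) (by simp; omega)
  have h1 : Desc (sw i * w)⁻¹ (i + 1) := by
    refine ⟨hj.lt, ?_⟩
    rw [mul_inv_rev, sw_inv, Equiv.Perm.mul_apply, Equiv.Perm.mul_apply, sw_hi hi.lt, e0]
    exact hj.2.trans hi.2
  have h2 : Desc (sw (i + 1) * (sw i * w))⁻¹ i := by
    refine ⟨hi.lt, ?_⟩
    simp only [mul_inv_rev, sw_inv, Equiv.Perm.mul_apply]
    rw [e1, sw_lo hi.lt, sw_lo hj.lt, e0]
    exact hj.2
  have := hi.len_sw_mul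
  have := h1.len_sw_mul
  have := h2.len_sw_mul
  omega

/-- Matsumoto's theorem: the product of the generators along a reduced word depends only on the
permutation spelled by the word. -/
theorem prod_gen_eq_of_reduced {l l' : List (Fin (n - 1))} (h : wordProd l = wordProd l')
    (hl : l.length = len (wordProd l)) (hl' : l'.length = len (wordProd l')) :
    (l.map gen).prod = (l'.map gen).prod := by
  induction hk : l.length using Nat.strong_induction_on generalizing l l' with
  | _ k ih =>
  -- Both first letters are left descents of the common element, which is therefore `s_i s_j x` with
  -- lengths adding. By induction the tails may be replaced by `j :: x` and `i :: x`, and one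
  -- commutation finishes.
  have hcomm : ∀ (i j : Fin (n - 1)) (m m' : List (Fin (n - 1))), (i :: m).length = k →
      (i : ℕ) + 2 ≤ j → wordProd (i :: m) = wordProd (j :: m') →
      (i :: m).length = len (wordProd (i :: m)) → (j :: m').length = len (wordProd (j :: m')) →
      ((i :: m).map gen).prod = ((j :: m').map gen).prod := by
    intro i j m m' hik hij e hm hm'
    obtain ⟨di, hmr⟩ := desc_inv_of_reduced hm
    obtain ⟨dj, hmr'⟩ := desc_inv_of_reduced hm'
    rw [← e] at dj
    have hlen := len_of_desc_comm di dj hij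
    obtain ⟨x, hx, hxl⟩ := exists_reducedWord (sw j * (sw i * wordProd (i :: m)))
    have e1 : wordProd m = wordProd (j :: x) := by
      rw [wordProd_cons, hx, sw_mul_sw_mul, wordProd_cons, sw_mul_sw_mul]
    have e2 : wordProd m' = wordProd (i :: x) := by
      rw [wordProd_cons, hx, ← mul_assoc (sw i) (sw j), sw_comm (Or.inl hij), e, wordProd_cons]
      simp [mul_assoc]
    simp only [List.length_cons] at hik hm hm'
    rw [e] at hlen hm
    rw [map_gen_prod_cons, map_gen_prod_cons,
      ih m.length (by omega) e1 hmr
        (by rw [← e1, ← hmr, List.length_cons, hxl, e]; omega) rfl,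
      ih m'.length (by omega) e2 hmr'
        (by rw [← e2, ← hmr', List.length_cons, hxl, e]; omega) rfl,
      map_gen_prod_cons, map_gen_prod_cons, ← mul_assoc, ← mul_assoc, g_comm (Or.inl hij)]
  -- The same argument with the common element written as `s_i s_j s_i x` and the braid relation in
  -- place of commutation.
  have hbraid : ∀ (i j : Fin (n - 1)) (m m' : List (Fin (n - 1))), (i :: m).length = k →
      (j : ℕ) = i + 1 → wordProd (i :: m) = wordProd (j :: m') →
      (i :: m).length = len (wordProd (i :: m)) → (j :: m').length = len (wordProd (j :: m')) →
      ((i :: m).map gen).prod = ((j :: m').map gen).prod := by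
    intro i j m m' hik hij e hm hm'
    obtain ⟨di, hmr⟩ := desc_inv_of_reduced hm
    obtain ⟨dj, hmr'⟩ := desc_inv_of_reduced hm'
    rw [← e, hij] at dj
    have hlen := len_of_desc_braid di dj
    obtain ⟨x, hx, hxl⟩ := exists_reducedWord (sw i * (sw (i + 1) * (sw i * wordProd (i :: m))))
    have e1 : wordProd m = wordProd (j :: i :: x) := by
      rw [wordProd_cons, wordProd_cons, hx, hij, sw_mul_sw_mul, sw_mul_sw_mul, wordProd_cons,
        sw_mul_sw_mul]
    have e2 : wordProd m' = wordProd (i :: j :: x) := by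
      have hb := sw_braid (n := n) (i := i) (by omega)
      rw [wordProd_cons, wordProd_cons, hx, hij, ← mul_assoc, ← mul_assoc, ← mul_assoc, ← mul_assoc,
        hb, e, wordProd_cons, hij]
      simp [mul_assoc]
    simp only [List.length_cons] at hik hm hm'
    rw [e] at hlen hm
    have hb := g_braid (n := n) (i := i) (by omega)
    rw [map_gen_prod_cons, map_gen_prod_cons,
      ih m.length (by omega) e1 hmr
        (by rw [← e1, ← hmr, List.length_cons, List.length_cons, hxl, e]; omega) rfl,
      ih m'.length (by omega) e2 hmr'
        (by rw [← e2, ← hmr', List.length_cons, List.length_cons, hxl, e]; omega) rfl,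
      map_gen_prod_cons, map_gen_prod_cons, map_gen_prod_cons, map_gen_prod_cons, hij]
    simp only [← mul_assoc]
    rw [hb]
  have hll : l'.length = k := by rw [hl', ← h, ← hl, hk]
  rcases l with _ | ⟨i, m⟩
  · rw [List.length_nil] at hk
    rw [List.eq_nil_of_length_eq_zero (hll.trans hk.symm)]
  rcases l' with _ | ⟨j, m'⟩
  · simp at hk hll; omega
  rcases lt_trichotomy (i : ℕ) j with hij | hij | hij
  · by_cases h1 : (j : ℕ) = i + 1
    · exact hbraid i j m m' hk h1 h hl hl'
    · exact hcomm i j m m' hk (by omega) h hl hl'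
  · obtain rfl := Fin.ext hij
    rw [map_gen_prod_cons, map_gen_prod_cons]
    congr 1
    rw [List.length_cons] at hk
    refine ih m.length (by omega) ?_ (desc_inv_of_reduced hl).2 (desc_inv_of_reduced hl').2 rfl
    rw [wordProd_cons, wordProd_cons] at h
    exact mul_left_cancel h
  · by_cases h1 : (i : ℕ) = j + 1
    · exact (hbraid j i m' m hll h1 h.symm hl' hl).symm
    · exact (hcomm j i m' m hll (by omega) h.symm hl' hl).symm

theorem T_wordProd {l : List (Fin (n - 1))} (hl : l.length = len (wordProd l)) :
    T (wordProd l) = (l.map gen).prod := by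
  have := (exists_reducedWord (wordProd l)).choose_spec
  exact prod_gen_eq_of_reduced this.1 (by rw [← this.2] at *; exact congrArg len this.1.symm ▸ this.2) hl

theorem T_one : T (1 : Equiv.Perm (Fin n)) = 1 := by
  have := T_wordProd (n := n) (l := []) (by simp [wordProd_nil, len_one])
  simpa [wordProd_nil] using this

theorem T_sw_mul {w : Equiv.Perm (Fin n)} {i : ℕ} (h : Asc w⁻¹ i) : T (sw i * w) = g i * T w := by
  obtain ⟨l, rfl, hl⟩ := exists_reducedWord w
  have hi := h.lt
  have e : sw i * wordProd l = wordProd ((⟨i, by omega⟩ : Fin (n - 1)) :: l) := by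
    rw [wordProd_cons]
  rw [T_wordProd hl, e, T_wordProd, map_gen_prod_cons]
  rw [← e, h.len_sw_mul, List.length_cons, hl]

theorem T_mul_sw {w : Equiv.Perm (Fin n)} {i : ℕ} (h : Asc w i) : T (w * sw i) = T w * g i := by
  obtain ⟨l, rfl, hl⟩ := exists_reducedWord w
  have hi := h.lt
  have e : wordProd l * sw i = wordProd (l ++ [(⟨i, by omega⟩ : Fin (n - 1))]) := by
    rw [wordProd_concat]
  rw [T_wordProd hl, e, T_wordProd, List.map_append, List.prod_append, List.map_singleton,
    List.prod_singleton, gen_eq_g]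
  rw [← e, h.len_mul_sw, List.length_append, List.length_singleton, hl]

theorem T_sw_mul_desc {w : Equiv.Perm (Fin n)} {i : ℕ} (h : Desc w⁻¹ i) :
    T w = g i * T (sw i * w) := by
  rw [← T_sw_mul (asc_inv_sw_mul.2 h), sw_mul_sw_mul]

theorem T_mul_sw_desc {w : Equiv.Perm (Fin n)} {i : ℕ} (h : Desc w i) :
    T w = T (w * sw i) * g i := by
  rw [← T_mul_sw (asc_mul_sw.2 h), mul_sw_mul_sw]

theorem g_mul_T_desc {w : Equiv.Perm (Fin n)} {i : ℕ} (h : Desc w⁻¹ i) :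
    g i * T w = T (sw i * w) + (X : ℤ[X]) • T w := by
  rw [T_sw_mul_desc h, ← mul_assoc, g_mul_self h.lt, add_mul, one_mul, smul_mul_assoc]

theorem T_mul_g_desc {w : Equiv.Perm (Fin n)} {i : ℕ} (h : Desc w i) :
    T w * g i = T (w * sw i) + (X : ℤ[X]) • T w := by
  rw [T_mul_sw_desc h, mul_assoc, g_mul_self h.lt, mul_add, mul_one, mul_smul_comm]

theorem T_sw {i : ℕ} (h : i + 1 < n) : T (sw i : Equiv.Perm (Fin n)) = g i := by
  have := T_sw_mul (n := n) (w := 1) (i := i) ⟨h, by simp [Fin.lt_def]⟩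
  simpa [T_one] using this

theorem T_mul {u v : Equiv.Perm (Fin n)} (h : len (u * v) = len u + len v) :
    T (u * v) = T u * T v := by
  obtain ⟨l, rfl, hl⟩ := exists_reducedWord u
  obtain ⟨m, rfl, hm⟩ := exists_reducedWord v
  rw [T_wordProd hl, T_wordProd hm, ← List.prod_append, ← List.map_append, ← wordProd_append,
    T_wordProd]
  rw [wordProd_append, h, List.length_append, hl, hm]

/-! ### The ring structure -/

theorem hecke_neg_add_cancel (a : Hecke n) : -a + a = 0 :=
  @neg_add_cancel (Hecke n) (RingQuot.instRing (HeckeRel n)).toAddCommGroup.toAddGroup a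

theorem hecke_sub_eq_add_neg (a b : Hecke n) : a - b = a + -b :=
  @sub_eq_add_neg (Hecke n)
    (RingQuot.instRing (HeckeRel n)).toAddCommGroup.toAddGroup.toSubNegMonoid a b

/-- The ring structure of the Hecke algebra, on top of the semiring structure found by instance
search. -/
@[reducible] noncomputable def heckeRing (n : ℕ) : Ring (Hecke n) :=
  { (inferInstance : Semiring (Hecke n)) with
    neg := fun a => -a
    sub := fun a b => a - b
    sub_eq_add_neg := hecke_sub_eq_add_neg
    neg_add_cancel := hecke_neg_add_cancel
    zsmul := zsmulRec
    intCast := Int.castDef }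

attribute [local instance] heckeRing

/-! ### The regular representation and the standard basis -/

open Classical in
/-- The operator of left multiplication by `T_{s_i}` on the free module on the permutations. -/
noncomputable def regOp (i : ℕ) : Module.End ℤ[X] (Equiv.Perm (Fin n) →₀ ℤ[X]) :=
  Finsupp.linearCombination ℤ[X] fun w =>
    Finsupp.single (sw i * w) 1 + if Desc w⁻¹ i then (X : ℤ[X]) • Finsupp.single w 1 else 0

open Classical in
theorem regOp_single (i : ℕ) (w : Equiv.Perm (Fin n)) :
    regOp i (Finsupp.single w 1) =
      Finsupp.single (sw i * w) 1 + if Desc w⁻¹ i then (X : ℤ[X]) • Finsupp.single w 1 else 0 := by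
  rw [regOp, Finsupp.linearCombination_single, one_smul]

theorem regOp_asc {i : ℕ} {w : Equiv.Perm (Fin n)} (h : Asc w⁻¹ i) :
    regOp i (Finsupp.single w 1) = Finsupp.single (sw i * w) 1 := by
  rw [regOp_single, if_neg h.not_desc, add_zero]

theorem regOp_desc {i : ℕ} {w : Equiv.Perm (Fin n)} (h : Desc w⁻¹ i) :
    regOp i (Finsupp.single w 1) =
      Finsupp.single (sw i * w) 1 + (X : ℤ[X]) • Finsupp.single w 1 := by
  rw [regOp_single, if_pos h]

theorem regOp_mul_self {i : ℕ} (h : i + 1 < n) :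
    (regOp i : Module.End ℤ[X] (Equiv.Perm (Fin n) →₀ ℤ[X])) * regOp i =
      1 + (X : ℤ[X]) • regOp i := by
  refine Finsupp.lhom_ext' fun w => LinearMap.ext_ring ?_
  simp only [LinearMap.comp_apply, Finsupp.lsingle_apply, Module.End.mul_apply,
    LinearMap.add_apply, LinearMap.smul_apply, Module.End.one_apply]
  rcases asc_or_desc w⁻¹ h with h1 | h1
  · rw [regOp_asc h1, regOp_desc (desc_inv_sw_mul.2 h1), sw_mul_sw_mul]
  · rw [regOp_desc h1, map_add, map_smul, regOp_asc (asc_inv_sw_mul.2 h1), sw_mul_sw_mul,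
      regOp_desc h1]

theorem desc_inv_sw_mul_comm {i j : ℕ} (hi : i + 1 < n) (hj : j + 1 < n)
    (h : i + 2 ≤ j ∨ j + 2 ≤ i) (w : Equiv.Perm (Fin n)) :
    Desc (sw j * w)⁻¹ i ↔ Desc w⁻¹ i := by
  have e1 : (sw j (⟨i, by omega⟩ : Fin n)) = ⟨i, by omega⟩ :=
    sw_of_ne hj (by simp; omega) (by simp; omega)
  have e2 : (sw j (⟨i + 1, hi⟩ : Fin n)) = ⟨i + 1, hi⟩ :=
    sw_of_ne hj (by simp; omega) (by simp; omega)
  simp only [Desc, mul_inv_rev, sw_inv, Equiv.Perm.mul_apply, e1, e2]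

theorem regOp_comm {i j : ℕ} (hi : i + 1 < n) (hj : j + 1 < n) (h : i + 2 ≤ j ∨ j + 2 ≤ i) :
    (regOp i : Module.End ℤ[X] (Equiv.Perm (Fin n) →₀ ℤ[X])) * regOp j = regOp j * regOp i := by
  refine Finsupp.lhom_ext' fun w => LinearMap.ext_ring ?_
  have hc : sw i * (sw j * w) = sw j * (sw i * w) := by
    rw [← mul_assoc, sw_comm h, mul_assoc]
  simp only [LinearMap.comp_apply, Finsupp.lsingle_apply, Module.End.mul_apply]
  by_cases h1 : Desc w⁻¹ i <;> by_cases h2 : Desc w⁻¹ j <;>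
    simp only [regOp_single, map_add, map_smul, smul_add, desc_inv_sw_mul_comm hi hj h,
      desc_inv_sw_mul_comm hj hi h.symm, hc, h1, h2, if_true, if_false, add_zero]
  · abel

/-- Only the relative order of the values of `w⁻¹` at `i`, `i + 1`, `i + 2` matters. Of the eight
sign patterns two violate transitivity; in the other six both sides expand to the same combination.
-/
theorem regOp_braid {i : ℕ} (h : i + 2 < n) :
    (regOp i : Module.End ℤ[X] (Equiv.Perm (Fin n) →₀ ℤ[X])) * regOp (i + 1) * regOp i =
      regOp (i + 1) * regOp i * regOp (i + 1) := by
  refine Finsupp.lhom_ext' fun w => LinearMap.ext_ring ?_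
  have hi : i + 1 < n := by omega
  have hj : i + 1 + 1 < n := by omega
  have e0 : (sw i (⟨i + 1 + 1, hj⟩ : Fin n)) = ⟨i + 1 + 1, hj⟩ :=
    sw_of_ne hi (by simp; omega) (by simp)
  have e1 : (sw (i + 1) (⟨i, by omega⟩ : Fin n)) = ⟨i, by omega⟩ :=
    sw_of_ne hj (by simp) (by simp; omega)
  have hb : sw (i + 1) * (sw i * (sw (i + 1) * w)) = sw i * (sw (i + 1) * (sw i * w)) := by
    have := sw_braid h
    rw [← mul_assoc, ← mul_assoc, ← this, mul_assoc, mul_assoc]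
  obtain ⟨a, ha⟩ : ∃ a, w⁻¹ ⟨i, by omega⟩ = a := ⟨_, rfl⟩
  obtain ⟨b, hb'⟩ : ∃ b, w⁻¹ ⟨i + 1, hi⟩ = b := ⟨_, rfl⟩
  obtain ⟨c, hc⟩ : ∃ c, w⁻¹ ⟨i + 1 + 1, hj⟩ = c := ⟨_, rfl⟩
  have hab : a ≠ b := fun e => by
    have := w⁻¹.injective (ha.trans (e.trans hb'.symm)); simp at this
  have hbc : b ≠ c := fun e => by
    have := w⁻¹.injective (hb'.trans (e.trans hc.symm)); simp at this
  have hac : a ≠ c := fun e => by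
    have := w⁻¹.injective (ha.trans (e.trans hc.symm)); simp at this; omega
  have d1 : ∀ v : Equiv.Perm (Fin n), Desc v i ↔ v ⟨i + 1, hi⟩ < v ⟨i, by omega⟩ := fun v =>
    ⟨fun h => h.2, fun h => ⟨hi, h⟩⟩
  have d2 : ∀ v : Equiv.Perm (Fin n), Desc v (i + 1) ↔ v ⟨i + 1 + 1, hj⟩ < v ⟨i + 1, hi⟩ := fun v =>
    ⟨fun h => h.2, fun h => ⟨hj, h⟩⟩
  simp only [LinearMap.comp_apply, Finsupp.lsingle_apply, Module.End.mul_apply]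
  rcases lt_or_gt_of_ne hab with h1 | h1 <;> rcases lt_or_gt_of_ne hbc with h2 | h2 <;>
    rcases lt_or_gt_of_ne hac with h3 | h3 <;>
    first
    | exact absurd (h1.trans h2) h3.not_gt
    | exact absurd (h2.trans h1) h3.not_gt
    | (simp only [regOp_single, map_add, map_smul, smul_add, d1, d2, mul_inv_rev, sw_inv,
        Equiv.Perm.mul_apply, sw_lo hi, sw_hi hi, sw_lo hj, sw_hi hj, e0, e1, ha, hb', hc, h1, h2,
        h3, h1.not_gt, h2.not_gt, h3.not_gt, if_true, if_false, add_zero, hb, sw_mul_sw_mul]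
       try abel)

/-- The left regular representation of the Hecke algebra. -/
noncomputable def regRep (n : ℕ) :
    Hecke n →ₐ[ℤ[X]] Module.End ℤ[X] (Equiv.Perm (Fin n) →₀ ℤ[X]) :=
  RingQuot.liftAlgHom ℤ[X] ⟨FreeAlgebra.lift ℤ[X] fun i => regOp i, by
    intro x y h
    cases h with
    | comm i j h => simpa using regOp_comm (by omega) (by omega) h
    | braid i j h =>
      simp only [map_mul, FreeAlgebra.lift_ι_apply, h]
      exact regOp_braid (by omega)
    | quad i => simpa using regOp_mul_self (by omega)⟩

theorem regRep_g {i : ℕ} (h : i + 1 < n) : regRep n (g i) = regOp i := by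
  rw [g, dif_pos h, gen, regRep, RingQuot.liftAlgHom_mkAlgHom_apply, FreeAlgebra.lift_ι_apply]

/-- The coordinates with respect to the standard basis. -/
noncomputable def coords (n : ℕ) : Hecke n →ₗ[ℤ[X]] (Equiv.Perm (Fin n) →₀ ℤ[X]) :=
  (LinearMap.applyₗ (Finsupp.single 1 1)).comp (regRep n).toLinearMap

theorem coords_g_mul {i : ℕ} (h : i + 1 < n) (a : Hecke n) :
    coords n (g i * a) = regOp i (coords n a) := by
  simp [coords, regRep_g h]

/-- Along a reduced word each generator acts at an ascent, so the quadratic correction in `regOp`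
never enters. This is what makes the `T w` linearly independent. -/
theorem coords_T (w : Equiv.Perm (Fin n)) : coords n (T w) = Finsupp.single w 1 := by
  induction hk : len w generalizing w with
  | zero =>
    have : w = 1 := by
      by_contra hw
      obtain ⟨i, hi⟩ := exists_desc hw
      have := hi.len_mul_sw
      omega
    subst this
    simp [T_one, coords]
  | succ k ih =>
    have hw : w⁻¹ ≠ 1 := by
      rintro h
      rw [inv_eq_one.1 h, len_one] at hk
      omega
    obtain ⟨i, hi⟩ := exists_desc hw
    rw [T_sw_mul_desc hi, coords_g_mul hi.lt, ih _ (by have := hi.len_sw_mul; omega),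
      regOp_asc (asc_inv_sw_mul.2 hi), sw_mul_sw_mul]

theorem g_mul_T_mem_span (i : ℕ) (w : Equiv.Perm (Fin n)) :
    g i * T w ∈ Submodule.span ℤ[X] {T w, T (sw i * w)} := by
  by_cases hi : i + 1 < n
  · rcases asc_or_desc w⁻¹ hi with h | h
    · rw [← T_sw_mul h]
      exact Submodule.subset_span (by simp)
    · rw [g_mul_T_desc h]
      exact add_mem (Submodule.subset_span (by simp))
        (Submodule.smul_mem _ _ (Submodule.subset_span (by simp)))
  · rw [g, dif_neg hi, one_mul]
    exact Submodule.subset_span (by simp)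

theorem T_mul_g_mem_span (i : ℕ) (w : Equiv.Perm (Fin n)) :
    T w * g i ∈ Submodule.span ℤ[X] {T w, T (w * sw i)} := by
  by_cases hi : i + 1 < n
  · rcases asc_or_desc w hi with h | h
    · rw [← T_mul_sw h]
      exact Submodule.subset_span (by simp)
    · rw [T_mul_g_desc h]
      exact add_mem (Submodule.subset_span (by simp))
        (Submodule.smul_mem _ _ (Submodule.subset_span (by simp)))
  · rw [g, dif_neg hi, mul_one]
    exact Submodule.subset_span (by simp)

/-- The span contains `1` and is stable under left multiplication by the generators, hence by the
whole algebra. -/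
theorem span_T : Submodule.span ℤ[X] (Set.range (T (n := n))) = ⊤ := by
  rw [eq_top_iff]
  rintro h -
  obtain ⟨a, rfl⟩ := RingQuot.mkAlgHom_surjective ℤ[X] (HeckeRel n) h
  suffices H : ∀ x ∈ Submodule.span ℤ[X] (Set.range (T (n := n))),
      RingQuot.mkAlgHom ℤ[X] (HeckeRel n) a * x ∈ Submodule.span ℤ[X] (Set.range (T (n := n))) by
    simpa using H 1 (Submodule.subset_span ⟨1, T_one⟩)
  induction a using FreeAlgebra.induction with
  | grade0 r =>
    intro x hx
    rw [AlgHom.commutes, ← Algebra.smul_def]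
    exact Submodule.smul_mem _ _ hx
  | grade1 i =>
    intro x hx
    change gen i * x ∈ _
    rw [gen_eq_g]
    induction hx using Submodule.span_induction with
    | mem x hx =>
      obtain ⟨w, rfl⟩ := hx
      refine Submodule.span_mono ?_ (g_mul_T_mem_span i w)
      rintro _ (rfl | rfl) <;> exact ⟨_, rfl⟩
    | zero => simp
    | add x y _ _ hx hy => rw [mul_add]; exact add_mem hx hy
    | smul r x _ hx => rw [mul_smul_comm]; exact Submodule.smul_mem _ _ hx
  | mul a b ha hb =>
    intro x hx
    rw [map_mul, mul_assoc]
    exact ha _ (hb _ hx)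
  | add a b ha hb =>
    intro x hx
    rw [map_add, add_mul]
    exact add_mem (ha _ hx) (hb _ hx)

theorem linearIndependent_T : LinearIndependent ℤ[X] (T (n := n)) := by
  refine LinearIndependent.of_comp (coords n) ?_
  have : coords n ∘ T (n := n) = fun w => Finsupp.single w 1 := funext coords_T
  rw [this]
  exact Finsupp.linearIndependent_single_one ℤ[X] _

/-- The standard basis of the Hecke algebra. -/
noncomputable def stdBasis (n : ℕ) : Module.Basis (Equiv.Perm (Fin n)) ℤ[X] (Hecke n) :=
  Module.Basis.mk linearIndependent_T span_T.ge

@[simp] theorem stdBasis_apply (w : Equiv.Perm (Fin n)) : stdBasis n w = T w :=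
  Module.Basis.mk_apply _ _ _

/-- The coefficient of `T_w`. -/
noncomputable def coef (w : Equiv.Perm (Fin n)) : Hecke n →ₗ[ℤ[X]] ℤ[X] := (stdBasis n).coord w

theorem sum_coef (h : Hecke n) : ∑ w, coef w h • T w = h := by
  simpa [coef] using (stdBasis n).sum_repr h

theorem coef_T (v w : Equiv.Perm (Fin n)) : coef v (T w) = if w = v then 1 else 0 := by
  classical
  rw [coef, ← stdBasis_apply, Module.Basis.coord_apply, Module.Basis.repr_self,
    Finsupp.single_apply]

theorem coef_sum (f : Equiv.Perm (Fin n) → ℤ[X]) (v : Equiv.Perm (Fin n)) :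
    coef v (∑ w, f w • T w) = f v := by
  simp [map_sum, coef_T]

theorem ext_coef {a b : Hecke n} (h : ∀ w, coef w a = coef w b) : a = b := by
  rw [← sum_coef a, ← sum_coef b]
  simp [h]

theorem linearMap_ext_T {M : Type*} [AddCommGroup M] [Module ℤ[X] M] {f f' : Hecke n →ₗ[ℤ[X]] M}
    (h : ∀ w, f (T w) = f' (T w)) : f = f' :=
  (stdBasis n).ext fun w => by simpa using h w

/-- Induction on a permutation by multiplication from the right with a simple reflection. -/
theorem perm_induction_right {P : Equiv.Perm (Fin n) → Prop} (one : P 1)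
    (mul : ∀ w i, Asc w i → P w → P (w * sw i)) (w : Equiv.Perm (Fin n)) : P w := by
  induction hk : len w generalizing w with
  | zero =>
    by_cases hw : w = 1
    · exact hw ▸ one
    · obtain ⟨i, hi⟩ := exists_desc hw
      have := hi.len_mul_sw
      omega
  | succ k ih =>
    by_cases hw : w = 1
    · exact hw ▸ one
    · obtain ⟨i, hi⟩ := exists_desc hw
      have := mul _ i (asc_mul_sw.2 hi) (ih (w * sw i) (by have := hi.len_mul_sw; omega))
      rwa [mul_sw_mul_sw] at this

/-! ### The symmetrizing trace -/

/-- The coefficient at `1` is the symmetrizing trace, and the bases `T w` and `T w⁻¹` are dual for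
it. Generators are moved one at a time from `u` to `v`. -/
theorem coef_one_T_mul_T (u v : Equiv.Perm (Fin n)) :
    coef 1 (T u * T v) = if u * v = 1 then 1 else 0 := by
  induction u using perm_induction_right generalizing v with
  | one => simp [T_one, coef_T]
  | mul u i hi ih =>
    rw [T_mul_sw hi, mul_assoc, mul_assoc]
    rcases asc_or_desc v⁻¹ hi.lt with h | h
    · rw [← T_sw_mul h, ih]
    · rw [g_mul_T_desc h, mul_add, mul_smul_comm, map_add, map_smul, ih, ih]
      -- The correction term has trace zero: otherwise `u = v⁻¹`, and `i` would be both an ascent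
      -- and a descent of it.
      have : u * v ≠ 1 := by
        intro e
        rw [← eq_inv_iff_mul_eq_one] at e
        exact hi.not_desc (e ▸ h)
      simp [this]

theorem coef_one_mul_comm (a b : Hecke n) : coef 1 (a * b) = coef 1 (b * a) := by
  have key : ∀ u v : Equiv.Perm (Fin n), coef 1 (T u * T v) = coef 1 (T v * T u) := by
    intro u v
    rw [coef_one_T_mul_T, coef_one_T_mul_T]
    simp only [mul_eq_one_iff_eq_inv, eq_comm (a := u), inv_eq_iff_eq_inv]
  have e : (LinearMap.mul ℤ[X] (Hecke n)).compr₂ (coef 1) =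
      (LinearMap.mul ℤ[X] (Hecke n)).flip.compr₂ (coef 1) :=
    linearMap_ext_T fun u => linearMap_ext_T fun v => by simpa using key u v
  simpa using LinearMap.congr_fun (LinearMap.congr_fun e a) b

/-- Duality of `T w` and `T w⁻¹` turns questions about coefficients of central elements into trace
identities. -/
theorem coef_eq_coef_one (w : Equiv.Perm (Fin n)) (a : Hecke n) :
    coef w a = coef 1 (a * T w⁻¹) := by
  rw [← sum_coef a]
  simp [Finset.sum_mul, map_sum, coef_one_T_mul_T, coef_T, mul_inv_eq_one]

/-! ### Positivity -/

/-- The subsemiring `ℕ[ξ]` of `ℤ[ξ]`. -/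
def polyPos : Subsemiring ℤ[X] where
  carrier := {p | PolyPos p}
  zero_mem' i := by simp
  one_mem' i := by rw [coeff_one]; split_ifs <;> simp
  add_mem' hp hq i := by rw [coeff_add]; exact add_nonneg (hp i) (hq i)
  mul_mem' hp hq i := by
    rw [coeff_mul]
    exact Finset.sum_nonneg fun x _ => mul_nonneg (hp _) (hq _)

theorem X_mem_polyPos : (X : ℤ[X]) ∈ polyPos := fun i => by
  rw [coeff_X]; split_ifs <;> simp

/-- Multiplying out a reduced word of `u` replaces `T v` either by `T (sw i * v)` or by `T (sw i *
v) + ξ T v`, so no sign ever appears. -/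
theorem T_mul_T_coef_mem (u v w : Equiv.Perm (Fin n)) : coef w (T u * T v) ∈ polyPos := by
  induction u using perm_induction_right generalizing v with
  | one =>
    rw [T_one, one_mul, coef_T]
    split_ifs
    exacts [one_mem _, zero_mem _]
  | mul u i hi ih =>
    rw [T_mul_sw hi, mul_assoc]
    rcases asc_or_desc v⁻¹ hi.lt with h | h
    · rw [← T_sw_mul h]
      exact ih _
    · rw [g_mul_T_desc h, mul_add, mul_smul_comm, map_add, map_smul]
      exact add_mem (ih _) (mul_mem X_mem_polyPos (ih _))

/-- The positive cone as a subsemiring. -/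
noncomputable def posSemiring (n : ℕ) : Subsemiring (Hecke n) where
  carrier := {h | ∀ w, coef w h ∈ polyPos}
  zero_mem' w := by rw [map_zero]; exact zero_mem _
  one_mem' w := by
    rw [← T_one, coef_T]
    split_ifs
    exacts [one_mem _, zero_mem _]
  add_mem' ha hb w := by rw [map_add]; exact add_mem (ha w) (hb w)
  mul_mem' {a b} ha hb w := by
    rw [← sum_coef a, ← sum_coef b]
    simp only [Finset.sum_mul, Finset.mul_sum, map_sum, smul_mul_assoc, mul_smul_comm, map_smul]
    exact sum_mem fun u _ => mul_mem (hb _) (sum_mem fun v _ =>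
      mul_mem (ha _) (T_mul_T_coef_mem _ _ _))

theorem mem_posCone_iff {h : Hecke n} : h ∈ posCone n ↔ h ∈ posSemiring n := by
  constructor
  · rintro ⟨f, hf, rfl⟩ w
    rw [coef_sum]
    exact hf w
  · intro hh
    exact ⟨fun w => coef w h, hh, (sum_coef h).symm⟩

theorem smul_mem_posSemiring {p : ℤ[X]} {h : Hecke n} (hp : p ∈ polyPos) (hh : h ∈ posSemiring n) :
    p • h ∈ posSemiring n := fun w => by
  rw [map_smul]
  exact mul_mem hp (hh w)

theorem T_mem_posSemiring (w : Equiv.Perm (Fin n)) : T w ∈ posSemiring n := fun v => by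
  rw [coef_T]
  split_ifs
  exacts [one_mem _, zero_mem _]

theorem g_mem_posSemiring (i : ℕ) : (g i : Hecke n) ∈ posSemiring n := by
  by_cases h : i + 1 < n
  · rw [← T_sw h]
    exact T_mem_posSemiring _
  · rw [g, dif_neg h]
    exact one_mem _

/-! ### Specialization at `ξ = 0` -/

/-- The quadratic correction carries a factor `ξ`, so at `ξ = 0` the `T w` multiply as in the group
ring. -/
theorem eval_coef_g_mul (i : ℕ) (a : Hecke n) (v : Equiv.Perm (Fin n)) :
    (coef v (g i * a)).eval 0 = (coef (sw i * v) a).eval 0 := by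
  by_cases hi : i + 1 < n
  · rw [← sum_coef a]
    simp only [Finset.mul_sum, mul_smul_comm, map_sum, map_smul, eval_finsetSum, smul_eq_mul,
      eval_mul]
    refine Finset.sum_congr rfl fun w _ => ?_
    congr 1
    have e : sw i * w = v ↔ w = sw i * v := by
      rw [← inv_mul_eq_iff_eq_mul, sw_inv]
    rcases asc_or_desc w⁻¹ hi with h | h
    · rw [← T_sw_mul h, coef_T, coef_T]
      simp only [e]
    · rw [g_mul_T_desc h, map_add, map_smul, smul_eq_mul, eval_add, eval_mul, eval_X, zero_mul,
        add_zero, coef_T, coef_T]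
      simp only [e]
  · simp [g, sw, hi]

theorem eval_coef_mul_g (i : ℕ) (a : Hecke n) (v : Equiv.Perm (Fin n)) :
    (coef v (a * g i)).eval 0 = (coef (v * sw i) a).eval 0 := by
  by_cases hi : i + 1 < n
  · rw [← sum_coef a]
    simp only [Finset.sum_mul, smul_mul_assoc, map_sum, map_smul, eval_finsetSum, smul_eq_mul,
      eval_mul]
    refine Finset.sum_congr rfl fun w _ => ?_
    congr 1
    have e : w * sw i = v ↔ w = v * sw i := by
      rw [← eq_mul_inv_iff_mul_eq, sw_inv]
    rcases asc_or_desc w hi with h | h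
    · rw [← T_mul_sw h, coef_T, coef_T]
      simp only [e]
    · rw [T_mul_g_desc h, map_add, map_smul, smul_eq_mul, eval_add, eval_mul, eval_X, zero_mul,
        add_zero, coef_T, coef_T]
      simp only [e]
  · simp [g, sw, hi]

theorem eval_coef_mul_T (u : Equiv.Perm (Fin n)) (a : Hecke n) (v : Equiv.Perm (Fin n)) :
    (coef v (a * T u)).eval 0 = (coef (v * u⁻¹) a).eval 0 := by
  induction u using perm_induction_right generalizing v with
  | one => simp [T_one]
  | mul u i hi ih => rw [T_mul_sw hi, ← mul_assoc, eval_coef_mul_g, ih, mul_inv_rev, sw_inv, mul_assoc]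

theorem eval_coef_T_mul (u : Equiv.Perm (Fin n)) (a : Hecke n) (v : Equiv.Perm (Fin n)) :
    (coef v (T u * a)).eval 0 = (coef (u⁻¹ * v) a).eval 0 := by
  induction u using perm_induction_right generalizing v a with
  | one => simp [T_one]
  | mul u i hi ih => rw [T_mul_sw hi, mul_assoc, ih, eval_coef_g_mul, mul_inv_rev, sw_inv, mul_assoc]

/-! ### Parabolic subgroups -/

/-- The parabolic subgroup generated by the `s_i` with `i ∈ J`. -/
def para (J : Set ℕ) : Subgroup (Equiv.Perm (Fin n)) :=
  Subgroup.closure {s | ∃ i ∈ J, s = sw i}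

theorem sw_mem_para {J : Set ℕ} {i : ℕ} (h : i ∈ J) : (sw i : Equiv.Perm (Fin n)) ∈ para J :=
  Subgroup.subset_closure ⟨i, h, rfl⟩

theorem para_mono {J K : Set ℕ} (h : J ⊆ K) : (para J : Subgroup (Equiv.Perm (Fin n))) ≤ para K :=
  Subgroup.closure_mono fun _ ⟨i, hi, e⟩ => ⟨i, h hi, e⟩

theorem para_empty : (para ∅ : Subgroup (Equiv.Perm (Fin n))) = ⊥ := by
  simp [para]

theorem sw_le_iff {i m : ℕ} (h : m ≠ i) (x : Fin n) : ((sw i x : Fin n) : ℕ) ≤ m ↔ (x : ℕ) ≤ m := by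
  by_cases hi : i + 1 < n
  · rw [sw_val hi]
    split_ifs <;> omega
  · simp [sw, hi]

/-- Together with `mem_para_of_le_iff` this describes `para J` as the stabilizer of the initial
segments `{x ≤ m}` with `m ∉ J`. All later questions of membership in parabolic subgroups are
decided by this test. -/
theorem le_iff_of_mem_para {J : Set ℕ} {w : Equiv.Perm (Fin n)} (hw : w ∈ para J) {m : ℕ}
    (hm : m ∉ J) (x : Fin n) : ((w x : Fin n) : ℕ) ≤ m ↔ (x : ℕ) ≤ m := by
  induction hw using Subgroup.closure_induction generalizing x with
  | mem w hw =>
    obtain ⟨i, hi, rfl⟩ := hw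
    exact sw_le_iff (fun e => hm (by rwa [e])) x
  | one => rfl
  | mul u v _ _ hu hv => rw [Equiv.Perm.mul_apply, hu, hv]
  | inv u _ hu => rw [← hu, ← Equiv.Perm.mul_apply, mul_inv_cancel, Equiv.Perm.one_apply]

theorem mem_of_desc {J : Set ℕ} {w : Equiv.Perm (Fin n)} (hw : w ∈ para J) {i : ℕ}
    (hi : Desc w i) : i ∈ J := by
  by_contra h
  have h1 := (le_iff_of_mem_para hw h ⟨i, by have := hi.lt; omega⟩).2 le_rfl
  have h2 := mt (le_iff_of_mem_para hw h ⟨i + 1, hi.lt⟩).1 (by simp)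
  have := hi.2
  rw [Fin.lt_def] at this
  omega

/-- A permutation preserving `{x ≤ i}` has no descent at `i`. So the last generator of a reduced
word belongs to `J`, and removing it leaves a permutation preserving the same segments. -/
theorem mem_para_of_le_iff {J : Set ℕ} {w : Equiv.Perm (Fin n)}
    (h : ∀ m, m ∉ J → ∀ x : Fin n, ((w x : Fin n) : ℕ) ≤ m ↔ (x : ℕ) ≤ m) : w ∈ para J := by
  induction w using perm_induction_right with
  | one => exact one_mem _
  | mul w i hi ih =>
    have hiJ : i ∈ J := by
      by_contra hJ
      have hd : Desc (w * sw i) i := desc_mul_sw.2 hi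
      have h1 := (h i hJ ⟨i, by have := hd.lt; omega⟩).2 le_rfl
      have h2 := mt (h i hJ ⟨i + 1, hd.lt⟩).1 (by simp)
      have := hd.2
      rw [Fin.lt_def] at this
      omega
    refine mul_mem (ih fun m hm x => ?_) (sw_mem_para hiJ)
    have hne : m ≠ i := fun e => hm (e ▸ hiJ)
    have := h m hm (sw i x)
    rwa [Equiv.Perm.mul_apply, sw_sw, sw_le_iff hne] at this

theorem para_univ : (para Set.univ : Subgroup (Equiv.Perm (Fin n))) = ⊤ :=
  eq_top_iff.2 fun _ _ => mem_para_of_le_iff fun _ hm => absurd (Set.mem_univ _) hm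

theorem para_induction_right {J : Set ℕ} {P : Equiv.Perm (Fin n) → Prop} (one : P 1)
    (mul : ∀ w i, w ∈ para J → i ∈ J → Asc w i → P w → P (w * sw i)) (w : Equiv.Perm (Fin n))
    (hw : w ∈ para J) : P w := by
  induction w using perm_induction_right with
  | one => exact one
  | mul w i hi ih =>
    have hiJ := mem_of_desc hw (desc_mul_sw.2 hi)
    have hwJ : w ∈ para J := by simpa using mul_mem hw (sw_mem_para hiJ)
    exact mul w i hwJ hiJ hi (ih hwJ)

theorem para_induction_left {J : Set ℕ} {P : Equiv.Perm (Fin n) → Prop} (one : P 1)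
    (mul : ∀ w i, w ∈ para J → i ∈ J → Asc w⁻¹ i → P w → P (sw i * w)) (w : Equiv.Perm (Fin n))
    (hw : w ∈ para J) : P w := by
  rw [← inv_inv w]
  refine para_induction_right (P := fun v => P v⁻¹) (by simpa using one) ?_ _ (inv_mem hw)
  intro v i hv hi ha h
  rw [mul_inv_rev, sw_inv]
  exact mul v⁻¹ i (inv_mem hv) hi (by simpa using ha) h

theorem eq_one_of_len_eq_zero {w : Equiv.Perm (Fin n)} (h : len w = 0) : w = 1 := by
  by_contra hw
  obtain ⟨i, hi⟩ := exists_desc hw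
  have := hi.len_mul_sw
  omega

/-! ### Distinguished coset representatives -/

theorem apply_lt_of_not_desc {J : Set ℕ} {v : Equiv.Perm (Fin n)} (h : ∀ j ∈ J, ¬ Desc v j)
    {a b : Fin n} (hab : a < b) (hJ : ∀ k, (a : ℕ) ≤ k → k < b → k ∈ J) : v a < v b := by
  obtain ⟨a, ha⟩ := a
  obtain ⟨b, hb⟩ := b
  obtain ⟨k, rfl⟩ := Nat.exists_eq_add_of_lt (show a < b from hab)
  clear hab
  have step : ∀ c, a ≤ c → c < a + k + 1 → Asc v c := fun c h1 h2 =>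
    (asc_or_desc v (by omega)).resolve_right (h c (hJ c h1 h2))
  clear hJ
  induction k with
  | zero => exact (step a le_rfl (by omega)).2
  | succ k ih =>
    exact (ih (by omega) fun c h1 h2 => step c h1 (by omega)).trans
      (step (a + k + 1) (by omega) (by omega)).2

/-- Since `u⁻¹` permutes each block of `W_J` and `d⁻¹` is increasing on each block, an ascent of
`u⁻¹` inside a block survives in `d⁻¹ u⁻¹`. Additivity of lengths in `u * d` follows. -/
theorem asc_inv_mul {J : Set ℕ} {u d : Equiv.Perm (Fin n)} (hu : u ∈ para J)
    (hd : ∀ j ∈ J, ¬ Desc d⁻¹ j) {j : ℕ} (hj : j ∈ J) (h : Asc u⁻¹ j) : Asc (u * d)⁻¹ j := by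
  refine ⟨h.lt, ?_⟩
  rw [mul_inv_rev, Equiv.Perm.mul_apply, Equiv.Perm.mul_apply]
  refine apply_lt_of_not_desc hd h.2 fun k h1 h2 => ?_
  by_contra hk
  have e1 := le_iff_of_mem_para (inv_mem hu) hk ⟨j, by have := h.lt; omega⟩
  have e2 := le_iff_of_mem_para (inv_mem hu) hk ⟨j + 1, h.lt⟩
  have : k ≠ j := fun e => hk (e ▸ hj)
  simp only at e1 e2
  omega

theorem len_mul_of_not_desc {J : Set ℕ} {u d : Equiv.Perm (Fin n)} (hu : u ∈ para J)
    (hd : ∀ j ∈ J, ¬ Desc d⁻¹ j) : len (u * d) = len u + len d := by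
  refine para_induction_left (P := fun u => len (u * d) = len u + len d) ?_ ?_ u hu
  · rw [one_mul, len_one, zero_add]
  · intro u i hu hi ha ih
    rw [mul_assoc, (asc_inv_mul hu hd hi ha).len_sw_mul, ha.len_sw_mul, ih]
    omega

theorem isDistinguished_iff {K J : Set ℕ} {d : Equiv.Perm (Fin n)} :
    IsDistinguished (para K) (para J) d ↔ d ∈ para K ∧ ∀ j ∈ J, ¬ Desc d⁻¹ j := by
  refine and_congr_right fun _ => ⟨fun h j hj hd => ?_, fun h u hu => ?_⟩
  · have h1 := h (sw j) (sw_mem_para hj)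
    have := hd.len_sw_mul
    omega
  · rw [len_mul_of_not_desc hu h]
    omega

theorem exists_mul_not_desc (J : Set ℕ) (w : Equiv.Perm (Fin n)) :
    ∃ u ∈ para J, ∃ d : Equiv.Perm (Fin n), (∀ j ∈ J, ¬ Desc d⁻¹ j) ∧ w = u * d := by
  induction hk : len w using Nat.strong_induction_on generalizing w with
  | _ k ih =>
    by_cases h : ∃ j ∈ J, Desc w⁻¹ j
    · obtain ⟨j, hj, hd⟩ := h
      obtain ⟨u, hu, d, hd', e⟩ := ih _ (by have := hd.len_sw_mul; omega) (sw j * w) rfl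
      exact ⟨sw j * u, mul_mem (sw_mem_para hj) hu, d, hd', by rw [mul_assoc, ← e, sw_mul_sw_mul]⟩
    · push Not at h
      exact ⟨1, one_mem _, w, h, (one_mul w).symm⟩

theorem mul_not_desc_unique {J : Set ℕ} {u u' d d' : Equiv.Perm (Fin n)} (hu : u ∈ para J)
    (hu' : u' ∈ para J) (hd : ∀ j ∈ J, ¬ Desc d⁻¹ j) (hd' : ∀ j ∈ J, ¬ Desc d'⁻¹ j)
    (e : u * d = u' * d') : u = u' ∧ d = d' := by
  have e1 : (u'⁻¹ * u) * d = d' := by rw [mul_assoc, e, inv_mul_cancel_left]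
  have e2 : (u⁻¹ * u') * d' = d := by rw [mul_assoc, ← e, inv_mul_cancel_left]
  have h1 := len_mul_of_not_desc (mul_mem (inv_mem hu') hu) hd
  have h2 := len_mul_of_not_desc (mul_mem (inv_mem hu) hu') hd'
  rw [e1] at h1
  rw [e2] at h2
  have h3 := eq_one_of_len_eq_zero (w := u⁻¹ * u') (by omega)
  rw [h3, one_mul] at e2
  exact ⟨(inv_mul_eq_one.1 h3), e2.symm⟩

theorem T_mul_of_not_desc {J : Set ℕ} {u d : Equiv.Perm (Fin n)} (hu : u ∈ para J)
    (hd : ∀ j ∈ J, ¬ Desc d⁻¹ j) : T (u * d) = T u * T d :=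
  T_mul (len_mul_of_not_desc hu hd)

theorem T_inv_mul_of_not_desc {J : Set ℕ} {u d : Equiv.Perm (Fin n)} (hu : u ∈ para J)
    (hd : ∀ j ∈ J, ¬ Desc d⁻¹ j) : T (u * d)⁻¹ = T d⁻¹ * T u⁻¹ := by
  have := len_mul_of_not_desc hu hd
  rw [mul_inv_rev, T_mul]
  rw [← mul_inv_rev, len_inv, len_inv, len_inv, this, add_comm]

/-! ### Relative norms -/

theorem relNorm_add (K U : Subgroup (Equiv.Perm (Fin n))) (a b : Hecke n) :
    relNorm K U (a + b) = relNorm K U a + relNorm K U b := by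
  simp [relNorm, mul_add, add_mul, Finset.sum_add_distrib]

theorem relNorm_smul (K U : Subgroup (Equiv.Perm (Fin n))) (p : ℤ[X]) (a : Hecke n) :
    relNorm K U (p • a) = p • relNorm K U a := by
  simp [relNorm, Finset.smul_sum]

theorem relNorm_mem_posSemiring (K U : Subgroup (Equiv.Perm (Fin n))) {a : Hecke n}
    (ha : a ∈ posSemiring n) : relNorm K U a ∈ posSemiring n :=
  sum_mem fun _ _ => mul_mem (mul_mem (T_mem_posSemiring _) ha) (T_mem_posSemiring _)

theorem relNorm_mul_right (K U : Subgroup (Equiv.Perm (Fin n))) {a z : Hecke n}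
    (hz : ∀ d ∈ K, z * T d = T d * z) : relNorm K U (a * z) = relNorm K U a * z := by
  classical
  rw [relNorm, relNorm, Finset.sum_mul]
  refine Finset.sum_congr rfl fun d hd => ?_
  have := hz d (Finset.mem_filter.1 hd).2.1
  simp only [mul_assoc, this]

theorem relNorm_mul_left (K U : Subgroup (Equiv.Perm (Fin n))) {a z : Hecke n}
    (hz : ∀ d ∈ K, z * T d = T d * z) : relNorm K U (z * a) = z * relNorm K U a := by
  classical
  rw [relNorm, relNorm, Finset.mul_sum]
  refine Finset.sum_congr rfl fun d hd => ?_
  have := hz d⁻¹ (inv_mem (Finset.mem_filter.1 hd).2.1)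
  simp only [← mul_assoc, this]

/-- Norms are transitive. -/
theorem relNorm_relNorm {J K L : Set ℕ} (hJK : J ⊆ K) (hKL : K ⊆ L) (a : Hecke n) :
    relNorm (para L) (para K) (relNorm (para K) (para J) a) = relNorm (para L) (para J) a := by
  classical
  simp only [relNorm, isDistinguished_iff, Finset.mul_sum, Finset.sum_mul]
  rw [Finset.sum_sigma']
  -- Left descents of `e * d` in `J` are those of `e`. Hence the products of the two kinds of
  -- representatives are exactly the representatives of `J` in `L`.
  have hcore : ∀ e d : Equiv.Perm (Fin n), e ∈ para K → (∀ j ∈ K, ¬ Desc d⁻¹ j) → ∀ j ∈ J,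
      (Desc (e * d)⁻¹ j ↔ Desc e⁻¹ j) := by
    intro e d he hd j hj
    constructor
    · intro h
      by_contra h'
      exact (asc_inv_mul he hd (hJK hj) ((asc_or_desc _ h.lt).resolve_right h')).not_desc h
    · intro h
      have := asc_inv_mul (mul_mem (sw_mem_para (hJK hj)) he) hd (hJK hj) (asc_inv_sw_mul.2 h)
      rwa [mul_assoc, asc_inv_sw_mul] at this
  refine Finset.sum_bij (fun p _ => p.2 * p.1) ?_ ?_ ?_ ?_
  · rintro ⟨d, e⟩ h
    simp only [Finset.mem_sigma, Finset.mem_filter, Finset.mem_univ, true_and] at h ⊢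
    obtain ⟨⟨hd, hd'⟩, he, he'⟩ := h
    exact ⟨mul_mem (para_mono hKL he) hd, fun j hj => by rw [hcore e d he hd' j hj]; exact he' j hj⟩
  · rintro ⟨d, e⟩ h ⟨d', e'⟩ h' heq
    simp only [Finset.mem_sigma, Finset.mem_filter, Finset.mem_univ, true_and] at h h'
    obtain ⟨h1, h2⟩ := mul_not_desc_unique h.2.1 h'.2.1 h.1.2 h'.1.2 heq
    rw [h1, h2]
  · intro w hw
    simp only [Finset.mem_filter, Finset.mem_univ, true_and] at hw
    obtain ⟨e, he, d, hd, rfl⟩ := exists_mul_not_desc K w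
    refine ⟨⟨d, e⟩, ?_, rfl⟩
    simp only [Finset.mem_sigma, Finset.mem_filter, Finset.mem_univ, true_and]
    refine ⟨⟨?_, hd⟩, he, fun j hj => ?_⟩
    · have := mul_mem (inv_mem (para_mono hKL he)) hw.1
      rwa [inv_mul_cancel_left] at this
    · rw [← hcore e d he hd j hj]; exact hw.2 j hj
  · rintro ⟨d, e⟩ h
    simp only [Finset.mem_sigma, Finset.mem_filter, Finset.mem_univ, true_and] at h
    rw [T_mul_of_not_desc h.2.1 h.1.2, T_inv_mul_of_not_desc h.2.1 h.1.2]
    simp only [mul_assoc]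

/-- The norm from `W_J` to `W_K` of an element commuting with the generators of `W_J` commutes with
the generators of `W_K`. -/
theorem g_mul_relNorm {J K : Set ℕ} {z : Hecke n}
    (hz : ∀ j ∈ J, g j * z = z * g j) {k : ℕ} (hk : k ∈ K) :
    g k * relNorm (para K) (para J) z = relNorm (para K) (para J) z * g k := by
  classical
  by_cases hkn : k + 1 < n
  swap
  · simp [g, hkn]
  rw [← sub_eq_zero, relNorm, Finset.mul_sum, Finset.sum_mul, ← Finset.sum_sub_distrib]
  -- The commutator contributions of `d` and `d * sw k` cancel by the quadratic relation.
  have hpair : ∀ d : Equiv.Perm (Fin n), Asc d k →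
      (g k * (T d⁻¹ * z * T d) - T d⁻¹ * z * T d * g k) +
        (g k * (T (d * sw k)⁻¹ * z * T (d * sw k)) -
          T (d * sw k)⁻¹ * z * T (d * sw k) * g k) = 0 := by
    intro d hd
    have e1 : T (d * sw k)⁻¹ = g k * T d⁻¹ := by
      rw [mul_inv_rev, sw_inv, T_sw_mul (by simpa using hd)]
    have e2 : g k * (g k * (T d⁻¹ * (z * (T d * g k)))) =
        T d⁻¹ * (z * (T d * g k)) + (X : ℤ[X]) • (g k * (T d⁻¹ * (z * (T d * g k)))) := by
      rw [← mul_assoc, g_mul_self hkn, add_mul, one_mul, smul_mul_assoc]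
    rw [T_mul_sw hd, e1]
    simp only [mul_assoc]
    rw [e2, g_mul_self hkn]
    simp only [mul_add, mul_one, mul_smul_comm]
    abel
  -- If `d * sw k` is not distinguished, it acquires a left descent `j ∈ J`, which forces `d` to
  -- carry `k, k + 1` to `j, j + 1`. Then `d * sw k = sw j * d`, and `g k` passes through the
  -- summand as `g j`, which commutes with `z`.
  have hfix : ∀ d ∈ Finset.univ.filter (IsDistinguished (para K) (para J)),
      ¬ IsDistinguished (para K) (para J) (d * sw k) →
      g k * (T d⁻¹ * z * T d) - T d⁻¹ * z * T d * g k = 0 := by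
    intro d hd h
    have hd' := (isDistinguished_iff.1 (Finset.mem_filter.1 hd).2)
    rw [isDistinguished_iff] at h
    push Not at h
    obtain ⟨j, hj, hdj⟩ := h (mul_mem hd'.1 (sw_mem_para hk))
    have hjn := hdj.lt
    have ha : Asc d⁻¹ j := (asc_or_desc _ hjn).resolve_right (hd'.2 j hj)
    have hd2 := hdj.2
    have ha2 := ha.2
    rw [mul_inv_rev, sw_inv, Equiv.Perm.mul_apply, Equiv.Perm.mul_apply, Fin.lt_def,
      sw_val hkn, sw_val hkn] at hd2
    rw [Fin.lt_def] at ha2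
    have h1 : ((d⁻¹ ⟨j, by omega⟩ : Fin n) : ℕ) = k := by
      split_ifs at hd2 <;> omega
    have h2 : ((d⁻¹ ⟨j + 1, hjn⟩ : Fin n) : ℕ) = k + 1 := by
      split_ifs at hd2 <;> omega
    have hlo : d ⟨k, by omega⟩ = ⟨j, by omega⟩ := by
      rw [← Equiv.Perm.eq_inv_iff_eq]
      exact Fin.ext h1.symm
    have hhi : d ⟨k + 1, hkn⟩ = ⟨j + 1, hjn⟩ := by
      rw [← Equiv.Perm.eq_inv_iff_eq]
      exact Fin.ext h2.symm
    have e : d * sw k = sw j * d := by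
      have : d * sw k * d⁻¹ = sw j := by
        rw [sw, dif_pos hkn, sw, dif_pos hjn, ← Equiv.swap_apply_apply, hlo, hhi]
      rw [← this, inv_mul_cancel_right]
    have hak : Asc d k := ⟨hkn, by rw [hlo, hhi]; simp [Fin.lt_def]⟩
    have e1 : T d * g k = g j * T d := by rw [← T_mul_sw hak, e, T_sw_mul ha]
    have e2 : g k * T d⁻¹ = T d⁻¹ * g j := by
      have : sw k * d⁻¹ = d⁻¹ * sw j := by
        have := congrArg (·⁻¹) e
        simpa using this
      rw [← T_sw_mul (by simpa using hak), this, T_mul_sw ha]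
    have : g k * (T d⁻¹ * z * T d) = T d⁻¹ * z * T d * g k := by
      rw [mul_assoc (T d⁻¹ * z), e1, ← mul_assoc, ← mul_assoc, e2, mul_assoc (T d⁻¹), hz j hj]
      simp only [mul_assoc]
    rw [this, sub_self]
  refine Finset.sum_involution (fun d _ => if IsDistinguished (para K) (para J) (d * sw k) then
    d * sw k else d) ?_ ?_ ?_ ?_
  · intro d hd
    split_ifs with h
    · rcases asc_or_desc d hkn with h1 | h1
      · exact hpair d h1
      · have := hpair (d * sw k) (asc_mul_sw.2 h1)
        rw [mul_sw_mul_sw] at this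
        rw [add_comm]
        exact this
    · rw [hfix d hd h, add_zero]
  · intro d hd hne
    split_ifs with h
    · intro e
      exact sw_ne_one hkn (mul_eq_left.1 e)
    · exact absurd (hfix d hd h) hne
  · intro d hd
    split_ifs with h
    · simpa using h
    · exact hd
  · intro d hd
    have hd' := (Finset.mem_filter.1 hd).2
    by_cases h : IsDistinguished (para K) (para J) (d * sw k)
    · simp [h, hd']
    · simp [h]

/-! ### Parabolic subalgebras -/

theorem coef_T_mul_T_of_notMem {J : Set ℕ} {u v w : Equiv.Perm (Fin n)} (hu : u ∈ para J)
    (hv : v ∈ para J) (hw : w ∉ para J) : coef w (T u * T v) = 0 := by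
  refine para_induction_right (P := fun u => ∀ v ∈ para J, coef w (T u * T v) = 0) ?_ ?_ u hu v hv
  · intro v hv
    rw [T_one, one_mul, coef_T, if_neg]
    rintro rfl
    exact hw hv
  · intro u i hu hi ha ih v hv
    rw [T_mul_sw ha, mul_assoc]
    rcases asc_or_desc v⁻¹ ha.lt with h | h
    · rw [← T_sw_mul h]
      exact ih _ (mul_mem (sw_mem_para hi) hv)
    · rw [g_mul_T_desc h, mul_add, mul_smul_comm, map_add, map_smul, ih _ hv,
        ih _ (mul_mem (sw_mem_para hi) hv), smul_zero, add_zero]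

/-- The parabolic subalgebra spanned by the `T_w` with `w ∈ W_J`. -/
noncomputable def paraAlg (J : Set ℕ) : Subalgebra ℤ[X] (Hecke n) where
  carrier := {h | ∀ w, w ∉ para J → coef w h = 0}
  algebraMap_mem' r w hw := by
    rw [Algebra.algebraMap_eq_smul_one, map_smul, ← T_one, coef_T, if_neg, smul_zero]
    rintro rfl
    exact hw (one_mem _)
  add_mem' ha hb w hw := by rw [map_add, ha w hw, hb w hw, add_zero]
  mul_mem' {a b} ha hb w hw := by
    rw [← sum_coef a, ← sum_coef b]
    simp only [Finset.sum_mul, Finset.mul_sum, map_sum, smul_mul_assoc, mul_smul_comm, map_smul]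
    refine Finset.sum_eq_zero fun u _ => ?_
    by_cases hu : u ∈ para J
    · refine smul_eq_zero_of_right _ (Finset.sum_eq_zero fun v _ => ?_)
      by_cases hv : v ∈ para J
      · rw [coef_T_mul_T_of_notMem hv hu hw, smul_zero]
      · rw [ha v hv, zero_smul]
    · rw [hb u hu, zero_smul]

theorem T_mem_paraAlg {J : Set ℕ} {w : Equiv.Perm (Fin n)} (hw : w ∈ para J) :
    T w ∈ paraAlg J := fun v hv => by
  rw [coef_T, if_neg]
  rintro rfl
  exact hv hw

theorem g_mem_paraAlg {J : Set ℕ} {i : ℕ} (hi : i ∈ J) : (g i : Hecke n) ∈ paraAlg J := by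
  by_cases h : i + 1 < n
  · rw [← T_sw h]
    exact T_mem_paraAlg (sw_mem_para hi)
  · rw [g, dif_neg h]
    exact one_mem _

theorem paraAlg_mono {J K : Set ℕ} (h : J ⊆ K) :
    (paraAlg J : Subalgebra ℤ[X] (Hecke n)) ≤ paraAlg K :=
  fun _ ha w hw => ha w fun hJ => hw (para_mono h hJ)

theorem relNorm_mem_paraAlg {J K : Set ℕ} {a : Hecke n} (ha : a ∈ paraAlg K) :
    relNorm (para K) (para J) a ∈ paraAlg K := by
  classical
  refine sum_mem fun d hd => ?_
  have := (Finset.mem_filter.1 hd).2.1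
  exact mul_mem (mul_mem (T_mem_paraAlg (inv_mem this)) ha) (T_mem_paraAlg this)

theorem commute_T_of_commute_g {J : Set ℕ} {z : Hecke n} (hz : ∀ j ∈ J, g j * z = z * g j)
    {w : Equiv.Perm (Fin n)} (hw : w ∈ para J) : T w * z = z * T w := by
  refine para_induction_right (P := fun w => T w * z = z * T w) ?_ ?_ w hw
  · rw [T_one, one_mul, mul_one]
  · intro u i hu hi ha ih
    rw [T_mul_sw ha, mul_assoc, hz i hi, ← mul_assoc, ih, mul_assoc]

theorem commute_of_commute_g {J : Set ℕ} {z h : Hecke n} (hz : ∀ j ∈ J, g j * z = z * g j)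
    (hh : h ∈ paraAlg J) : h * z = z * h := by
  rw [← sum_coef h, Finset.sum_mul, Finset.mul_sum]
  refine Finset.sum_congr rfl fun w _ => ?_
  by_cases hw : w ∈ para J
  · rw [smul_mul_assoc, commute_T_of_commute_g hz hw, mul_smul_comm]
  · rw [hh w hw, zero_smul, zero_mul, mul_zero]

/-! ### Coxeter elements -/

open Classical in
/-- The increasing product of the `s_i` with `i ∈ J` and `i < m`. -/
noncomputable def coxPerm (J : Set ℕ) : ℕ → Equiv.Perm (Fin n)
  | 0 => 1
  | m + 1 => if m ∈ J then coxPerm J m * sw m else coxPerm J m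

theorem coxPerm_succ_of_mem {J : Set ℕ} {m : ℕ} (h : m ∈ J) :
    (coxPerm J (m + 1) : Equiv.Perm (Fin n)) = coxPerm J m * sw m := by
  rw [coxPerm, if_pos h]

theorem coxPerm_succ_of_notMem {J : Set ℕ} {m : ℕ} (h : m ∉ J) :
    (coxPerm J (m + 1) : Equiv.Perm (Fin n)) = coxPerm J m := by
  rw [coxPerm, if_neg h]

theorem coxPerm_mem_para (J : Set ℕ) (m : ℕ) :
    (coxPerm J m : Equiv.Perm (Fin n)) ∈ para (J ∩ {i | i < m}) := by
  induction m with
  | zero => exact one_mem _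
  | succ m ih =>
    have hmono : J ∩ {i | i < m} ⊆ J ∩ {i | i < m + 1} := fun i hi => ⟨hi.1, Nat.lt_succ_of_lt hi.2⟩
    by_cases h : m ∈ J
    · rw [coxPerm_succ_of_mem h]
      exact mul_mem (para_mono hmono ih) (sw_mem_para ⟨h, Nat.lt_succ_self m⟩)
    · rw [coxPerm_succ_of_notMem h]
      exact para_mono hmono ih

theorem asc_of_mem_para {J : Set ℕ} {w : Equiv.Perm (Fin n)} (hw : w ∈ para J) {m : ℕ}
    (hm : m ∉ J) (hmn : m + 1 < n) : Asc w m :=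
  (asc_or_desc w hmn).resolve_right fun h => hm (mem_of_desc hw h)

theorem T_coxPerm_succ {J : Set ℕ} {m : ℕ} (h : m ∈ J) :
    T (coxPerm J (m + 1) : Equiv.Perm (Fin n)) = T (coxPerm J m) * g m := by
  rw [coxPerm_succ_of_mem h]
  by_cases hm : m + 1 < n
  · exact T_mul_sw (asc_of_mem_para (coxPerm_mem_para J m) (fun h => lt_irrefl m h.2) hm)
  · simp [g, sw, hm]

/-! ### Jucys–Murphy elements of parabolic subalgebras -/

open Classical in
/-- The Jucys–Murphy element of `H_J` attached to `m ∈ J`: the sum of the `T_t`, where `t` runs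
through the transpositions `(i, m + 1)` with `i ≤ m` that lie in `W_J`. -/
noncomputable def murphy (J : Set ℕ) : ℕ → Hecke n
  | 0 => g 0
  | m + 1 => if m ∈ J then g (m + 1) * murphy J m * g (m + 1) + g (m + 1) else g (m + 1)

theorem murphy_succ_of_mem {J : Set ℕ} {m : ℕ} (h : m ∈ J) :
    (murphy J (m + 1) : Hecke n) = g (m + 1) * murphy J m * g (m + 1) + g (m + 1) := by
  rw [murphy, if_pos h]

theorem murphy_succ_of_notMem {J : Set ℕ} {m : ℕ} (h : m ∉ J) :
    (murphy J (m + 1) : Hecke n) = g (m + 1) := by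
  rw [murphy, if_neg h]

theorem murphy_mem_paraAlg {J : Set ℕ} {m : ℕ} (h : m ∈ J) :
    (murphy J m : Hecke n) ∈ paraAlg (J ∩ {i | i < m + 1}) := by
  induction m with
  | zero => exact g_mem_paraAlg ⟨h, by simp⟩
  | succ m ih =>
    have hg : (g (m + 1) : Hecke n) ∈ paraAlg (J ∩ {i | i < m + 1 + 1}) :=
      g_mem_paraAlg ⟨h, by simp⟩
    by_cases hm : m ∈ J
    · rw [murphy_succ_of_mem hm]
      have hmono : J ∩ {i | i < m + 1} ⊆ J ∩ {i | i < m + 1 + 1} := fun i hi =>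
        ⟨hi.1, Nat.lt_succ_of_lt hi.2⟩
      exact add_mem (mul_mem (mul_mem hg (paraAlg_mono hmono (ih hm))) hg) hg
    · rwa [murphy_succ_of_notMem hm]

theorem g_mul_of_mem_paraAlg {m : ℕ} {h : Hecke n} {J : Set ℕ} (hJ : ∀ j ∈ J, j + 2 ≤ m)
    (hh : h ∈ paraAlg J) : g m * h = h * g m :=
  (commute_of_commute_g (fun j hj => g_comm (Or.inl (hJ j hj))) hh).symm

/-- Induction through `L_{m+1} = g_{m+1} L_m g_{m+1} + g_{m+1}`. For `j < m` the generator commutes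
with `g_{m+1}` and, by induction, with `L_m`; the real content is the case `j = m`, which rests on
the braid relation. -/
theorem g_mul_murphy {J : Set ℕ} {j m : ℕ} (hm : m + 1 < n) (hj : j ∈ J) (hjm : j < m) :
    g j * (murphy J m : Hecke n) = murphy J m * g j := by
  induction m with
  | zero => omega
  | succ m ih =>
    by_cases hmJ : m ∈ J
    · rw [murphy_succ_of_mem hmJ]
      rcases Nat.lt_or_ge j m with h | h
      · have e := g_comm (n := n) (i := j) (j := m + 1) (Or.inl (by omega))
        have e' := ih (by omega) h
        rw [mul_add, add_mul, e, ← mul_assoc, ← mul_assoc, e, mul_assoc _ (g j), e', mul_assoc,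
          mul_assoc, mul_assoc, e]
        simp only [mul_assoc]
      · obtain rfl : j = m := by omega
        have hb := g_braid (n := n) (i := j) hm
        have hq := g_mul_self (n := n) (i := j) (by omega)
        -- After the braid relation both sides equal `g_j g_{j+1} + g_{j+1} g_j + ξ g_j g_{j+1}
        -- g_j`.
        have hB : g j * (g (j + 1) * g j * g (j + 1) + g (j + 1) : Hecke n) =
            (g (j + 1) * g j * g (j + 1) + g (j + 1)) * g j := by
          rw [← hb, mul_add, add_mul, ← mul_assoc, ← mul_assoc, hq, mul_assoc _ (g j) (g j), hq]
          simp only [add_mul, mul_add, one_mul, mul_one, smul_mul_assoc, mul_smul_comm]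
          abel
        have h0 : (murphy J j : Hecke n) = g j ∨ ∃ j', j = j' + 1 ∧ j' ∈ J := by
          rcases j with _ | j
          · exact Or.inl rfl
          · by_cases hj' : j ∈ J
            · exact Or.inr ⟨j, rfl, hj'⟩
            · exact Or.inl (murphy_succ_of_notMem hj')
        rcases h0 with h0 | ⟨j', rfl, hj'⟩
        · rw [h0]
          exact hB
        · have hc : g (j' + 1 + 1) * (murphy J j' : Hecke n) = murphy J j' * g (j' + 1 + 1) :=
            g_mul_of_mem_paraAlg (J := J ∩ {i | i < j' + 1})
              (fun i hi => by have := hi.2; simp only [Set.mem_ofPred_eq] at this; omega)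
              (murphy_mem_paraAlg hj')
          rw [murphy_succ_of_mem hj']
          generalize (g (j' + 1) : Hecke n) = a at *
          generalize (g (j' + 1 + 1) : Hecke n) = b at *
          generalize (murphy J j' : Hecke n) = L at *
          -- The part `bab + b` is handled by `hB`. The rest, `b a L a b`, commutes with `a` by two
          -- braid moves, because `b` commutes with `L`.
          have e1 : b * (a * L * a + a) * b + b = b * a * L * a * b + (b * a * b + b) := by
            simp only [mul_add, add_mul, mul_assoc, add_assoc]
          have e2 : a * (b * a * L * a * b) = b * a * L * a * b * a := by
            calc a * (b * a * L * a * b) = a * b * a * L * a * b := by simp only [mul_assoc]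
              _ = b * a * (b * L) * a * b := by rw [hb]; simp only [mul_assoc]
              _ = b * a * L * (b * a * b) := by rw [hc]; simp only [mul_assoc]
              _ = b * a * L * a * b * a := by rw [← hb]; simp only [mul_assoc]
          rw [e1, mul_add, add_mul, e2, hB]
    · rw [murphy_succ_of_notMem hmJ]
      refine g_comm (Or.inl ?_)
      have : j ≠ m := fun e => hmJ (e ▸ hj)
      omega

open Classical in
/-- The product of the Jucys–Murphy elements of `H_J` attached to the `k ∈ J` with `k < m`. -/
noncomputable def murphyProd (J : Set ℕ) : ℕ → Hecke n
  | 0 => 1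
  | m + 1 => if m ∈ J then murphyProd J m * murphy J m else murphyProd J m

theorem murphyProd_succ_of_mem {J : Set ℕ} {m : ℕ} (h : m ∈ J) :
    (murphyProd J (m + 1) : Hecke n) = murphyProd J m * murphy J m := by
  rw [murphyProd, if_pos h]

theorem murphyProd_succ_of_notMem {J : Set ℕ} {m : ℕ} (h : m ∉ J) :
    (murphyProd J (m + 1) : Hecke n) = murphyProd J m := by
  rw [murphyProd, if_neg h]

theorem murphyProd_mem_paraAlg (J : Set ℕ) (m : ℕ) :
    (murphyProd J m : Hecke n) ∈ paraAlg (J ∩ {i | i < m}) := by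
  induction m with
  | zero => exact one_mem _
  | succ m ih =>
    have hmono : J ∩ {i | i < m} ⊆ J ∩ {i | i < m + 1} := fun i hi => ⟨hi.1, Nat.lt_succ_of_lt hi.2⟩
    by_cases h : m ∈ J
    · rw [murphyProd_succ_of_mem h]
      exact mul_mem (paraAlg_mono hmono ih) (murphy_mem_paraAlg h)
    · rw [murphyProd_succ_of_notMem h]
      exact paraAlg_mono hmono ih

/-- The product of the Jucys–Murphy elements is central in `H_J`. -/
theorem g_mul_murphyProd {J : Set ℕ} {j m : ℕ} (hJ : ∀ i ∈ J, i + 1 < n) (hj : j ∈ J)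
    (hjm : j < m) : g j * (murphyProd J m : Hecke n) = murphyProd J m * g j := by
  induction m with
  | zero => omega
  | succ m ih =>
    by_cases hmJ : m ∈ J
    · rcases Nat.lt_or_ge j m with h | h
      · rw [murphyProd_succ_of_mem hmJ, ← mul_assoc, ih h, mul_assoc,
          g_mul_murphy (hJ m hmJ) hj h, mul_assoc]
      · obtain rfl : j = m := by omega
        clear ih
        rw [murphyProd_succ_of_mem hmJ]
        rcases j with _ | m
        · simp [murphyProd, murphy]
        have hcomm : g (m + 1) * (murphyProd J m : Hecke n) = murphyProd J m * g (m + 1) :=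
          g_mul_of_mem_paraAlg (J := J ∩ {i | i < m})
            (fun i hi => by have := hi.2; simp only [Set.mem_ofPred_eq] at this; omega)
            (murphyProd_mem_paraAlg J m)
        by_cases hm' : m ∈ J
        · have hLL : (murphy J m : Hecke n) * murphy J (m + 1) = murphy J (m + 1) * murphy J m := by
            refine commute_of_commute_g (J := J ∩ {i | i < m + 1}) (fun i hi => ?_)
              (murphy_mem_paraAlg hm')
            exact g_mul_murphy (hJ _ hmJ) hi.1 hi.2
          have hq := g_mul_self (n := n) (i := m + 1) (hJ _ hmJ)
          have hL := murphy_succ_of_mem (n := n) hm'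
          rw [murphyProd_succ_of_mem hm', ← mul_assoc, ← mul_assoc, hcomm]
          simp only [mul_assoc]
          congr 1
          generalize (g (m + 1) : Hecke n) = s at *
          generalize (murphy J m : Hecke n) = L at *
          generalize (murphy J (m + 1) : Hecke n) = L' at *
          -- The earlier factors already commute with `s`. Exchanging `s` with `L'` costs `1 + ξ L'`
          -- from either side, and these costs agree in `s L L'` and `L L' s` because `L` and `L'`
          -- commute.
          have e1 : s * L' = L * s + 1 + (X : ℤ[X]) • L' := by
            rw [hL, mul_add, hq, ← mul_assoc, ← mul_assoc, hq]
            simp only [add_mul, one_mul, smul_mul_assoc, smul_add]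
            abel
          have e2 : L' * s = s * L + 1 + (X : ℤ[X]) • L' := by
            rw [hL, add_mul, hq, mul_assoc, hq]
            simp only [mul_add, mul_one, mul_smul_comm, smul_add]
            abel
          rw [hLL, ← mul_assoc, e1, e2]
          simp only [mul_add, add_mul, mul_one, one_mul, mul_smul_comm, smul_mul_assoc, mul_assoc,
            hLL]
        · rw [murphyProd_succ_of_notMem hm', murphy_succ_of_notMem hm', ← mul_assoc, hcomm]
    · rw [murphyProd_succ_of_notMem hmJ]
      refine ih ?_
      have : j ≠ m := fun e => hmJ (e ▸ hj)
      omega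

/-! ### The norm of `T_{w_J}` as a product of Jucys–Murphy elements -/

/-- The distinguished representatives of `W_U` in `W_{U ∪ {m}}`, where `U ⊆ [0, m)`. -/
theorem isDistinguished_insert_iff {U : Set ℕ} {m : ℕ} (hU : ∀ i ∈ U, i < m) (hm : m + 1 < n)
    {d : Equiv.Perm (Fin n)} :
    IsDistinguished (para (insert m U)) (para U) d ↔
      d = 1 ∨ ∃ c, IsDistinguished (para U) (para {i | i ∈ U ∧ i + 1 < m}) c ∧ d = sw m * c := by
  have hmU : m ∉ U := fun h => lt_irrefl m (hU m h)
  simp only [isDistinguished_iff]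
  constructor
  · rintro ⟨hd, hd'⟩
    by_cases h1 : d = 1
    · exact Or.inl h1
    refine Or.inr ⟨sw m * d, ?_, (sw_mul_sw_mul d m).symm⟩
    obtain ⟨k, hk⟩ := exists_desc (inv_ne_one.2 h1)
    have hkm : k = m := by
      rcases mem_of_desc (inv_mem hd) hk with h | h
      · exact h
      · exact absurd hk (hd' k h)
    subst hkm
    have hle1 : ∀ x, ((d x : Fin n) : ℕ) ≤ k + 1 ↔ (x : ℕ) ≤ k + 1 := fun x =>
      le_iff_of_mem_para hd (by
        rintro (h | h)
        · omega
        · have := hU _ h; omega) x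
    -- The top letter `k + 1` must go to `k`, so that `sw k * d` fixes it and lies in `W_U`. Any
    -- other value would force `d⁻¹` to send `k` beyond `k + 1`: by monotonicity of `d⁻¹` on the
    -- block if the value is smaller than `k`, by the descent at `k` if `k + 1` is fixed.
    have hz : ((d ⟨k + 1, hm⟩ : Fin n) : ℕ) = k := by
      have hz1 := (hle1 ⟨k + 1, hm⟩).2 le_rfl
      have hk2 := hk.2
      have hbound : ((d⁻¹ ⟨k, by omega⟩ : Fin n) : ℕ) ≤ k + 1 := by
        rw [← hle1, ← Equiv.Perm.mul_apply, mul_inv_cancel, Equiv.Perm.one_apply]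
        simp
      rw [Fin.lt_def] at hk2
      by_contra hne
      rcases Nat.lt_or_ge (d ⟨k + 1, hm⟩ : Fin n) k with h | h
      · have := apply_lt_of_not_desc hd' (a := d ⟨k + 1, hm⟩) (b := ⟨k, by omega⟩) h
          (fun c h1 h2 => by
            by_contra hc
            have hcK : c ∉ insert k U := by
              rintro (h | h)
              · simp only at h2; omega
              · exact hc h
            have := (le_iff_of_mem_para hd hcK ⟨k + 1, hm⟩).1 h1
            simp only at this h2
            omega)
        rw [← Equiv.Perm.mul_apply, inv_mul_cancel, Equiv.Perm.one_apply, Fin.lt_def] at this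
        simp only at this
        omega
      · have hz2 : d ⟨k + 1, hm⟩ = ⟨k + 1, hm⟩ := Fin.ext (by simp only; omega)
        rw [Equiv.Perm.inv_eq_iff_eq.2 hz2.symm] at hk2
        simp only at hk2
        omega
    refine ⟨mem_para_of_le_iff fun c hc x => ?_, fun j hj => ?_⟩
    · rw [Equiv.Perm.mul_apply]
      by_cases hck : c = k
      · subst hck
        have h2 := hle1 x
        rw [sw_val hm]
        by_cases hx : (x : ℕ) = c + 1
        · have hx' : x = ⟨c + 1, hm⟩ := Fin.ext hx
          rw [hx', hz]
          simp
        · have hne : ((d x : Fin n) : ℕ) ≠ c := by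
            intro e
            rw [← hz] at e
            exact hx (congrArg Fin.val (d.injective (Fin.ext e)))
          split_ifs <;> omega
      · rw [sw_le_iff hck]
        exact le_iff_of_mem_para hd (by rintro (h | h); exacts [hck h, hc h]) x
    · rw [desc_inv_sw_mul_comm (by have := hj.2; omega) hm (Or.inl (by have := hj.2; omega))]
      exact hd' j hj.1
  · rintro (rfl | ⟨c, ⟨hc, hc'⟩, rfl⟩)
    · refine ⟨one_mem _, fun j hj h => ?_⟩
      rw [inv_one] at h
      have := h.2
      simp [Fin.lt_def] at this
    · refine ⟨mul_mem (sw_mem_para (Set.mem_insert _ _))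
        (para_mono (Set.subset_insert _ _) hc), fun j hj hd => ?_⟩
      have hjm := hU j hj
      by_cases h1 : j + 1 < m
      · rw [desc_inv_sw_mul_comm hd.lt hm (Or.inl (by omega))] at hd
        exact hc' j ⟨hj, h1⟩ hd
      · obtain rfl : m = j + 1 := by omega
        have hle := hd.2
        rw [mul_inv_rev, sw_inv, Equiv.Perm.mul_apply, Equiv.Perm.mul_apply, sw_lo hm,
          sw_of_ne hm (by simp) (by simp; omega), Fin.lt_def] at hle
        have a1 := le_iff_of_mem_para (inv_mem hc) hmU ⟨j, by omega⟩
        have a2 := le_iff_of_mem_para (inv_mem hc) hmU ⟨j + 1 + 1, hm⟩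
        simp only at a1 a2
        omega

theorem isDistinguished_self {J : Set ℕ} {d : Equiv.Perm (Fin n)} :
    IsDistinguished (para J) (para J) d ↔ d = 1 := by
  rw [isDistinguished_iff]
  constructor
  · rintro ⟨h1, h2⟩
    by_contra h
    obtain ⟨k, hk⟩ := exists_desc (inv_ne_one.2 h)
    exact h2 k (mem_of_desc (inv_mem h1) hk) hk
  · rintro rfl
    refine ⟨one_mem _, fun j _ h => ?_⟩
    rw [inv_one] at h
    have := h.2
    simp [Fin.lt_def] at this

theorem relNorm_self (J : Set ℕ) (h : Hecke n) : relNorm (para J) (para J) h = h := by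
  classical
  simp only [relNorm, isDistinguished_self]
  rw [Finset.filter_eq' Finset.univ 1, if_pos (Finset.mem_univ _), Finset.sum_singleton]
  simp [T_one]

/-- The norm from `W_U` to `W_{U ∪ {m}}` of an element commuting with `T_{s_i}` for `i < m`
splits off one factor. -/
theorem relNorm_insert {U : Set ℕ} {m : ℕ} (hU : ∀ i ∈ U, i < m) (hm : m + 1 < n) (h : Hecke n) :
    relNorm (para (insert m U)) (para U) h =
      h + relNorm (para U) (para {i | i ∈ U ∧ i + 1 < m}) (g m * h * g m) := by
  classical
  have hmU : m ∉ U := fun h => lt_irrefl m (hU m h)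
  have hasc : ∀ c : Equiv.Perm (Fin n), c ∈ para U → Asc c⁻¹ m := fun c hc =>
    asc_of_mem_para (inv_mem hc) hmU hm
  have hset : (Finset.univ.filter (IsDistinguished (para (insert m U)) (para U)) :
      Finset (Equiv.Perm (Fin n))) = insert 1 ((Finset.univ.filter
        (IsDistinguished (para U) (para {i | i ∈ U ∧ i + 1 < m}))).image (sw m * ·)) := by
    ext d
    simp only [Finset.mem_filter, Finset.mem_univ, true_and, Finset.mem_insert, Finset.mem_image,
      isDistinguished_insert_iff hU hm, eq_comm]
  rw [relNorm, hset, Finset.sum_insert, Finset.sum_image]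
  · rw [inv_one, T_one, one_mul, mul_one, relNorm]
    congr 1
    refine Finset.sum_congr rfl fun c hc => ?_
    have hc' := hasc c (Finset.mem_filter.1 hc).2.1
    rw [T_sw_mul hc', mul_inv_rev, sw_inv, T_mul_sw hc']
    simp only [mul_assoc]
  · exact fun a _ b _ e => mul_left_cancel e
  · intro h1
    obtain ⟨c, hc, e⟩ := Finset.mem_image.1 h1
    have := (hasc c (Finset.mem_filter.1 hc).2.1).len_sw_mul
    rw [e, len_one] at this
    omega

/-- The `i < m` such that both `i` and `i + 1 ≤ m` lie in `J`; for large `m` this describes the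
composition `λ - 1`. -/
def shrink (J : Set ℕ) (m : ℕ) : Set ℕ := {i | i ∈ J ∧ i + 1 ∈ J ∧ i + 1 < m}

theorem shrink_succ_of_mem {J : Set ℕ} {m : ℕ} (h : m ∈ J) (h' : m + 1 ∈ J) :
    shrink J (m + 2) = insert m (shrink J (m + 1)) := by
  ext i
  simp only [shrink, Set.mem_ofPred_eq, Set.mem_insert_iff]
  constructor
  · rintro ⟨h1, h2, h3⟩
    by_cases e : i = m
    · exact Or.inl e
    · exact Or.inr ⟨h1, h2, by omega⟩
  · rintro (rfl | ⟨h1, h2, h3⟩)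
    · exact ⟨h, h', by omega⟩
    · exact ⟨h1, h2, by omega⟩

theorem shrink_succ_of_notMem {J : Set ℕ} {m : ℕ} (h : m ∉ J ∨ m + 1 ∉ J) :
    shrink J (m + 2) = shrink J (m + 1) := by
  ext i
  simp only [shrink, Set.mem_ofPred_eq]
  constructor
  · rintro ⟨h1, h2, h3⟩
    refine ⟨h1, h2, ?_⟩
    have : i ≠ m := by rintro rfl; tauto
    omega
  · rintro ⟨h1, h2, h3⟩
    exact ⟨h1, h2, by omega⟩

theorem shrink_le_one (J : Set ℕ) {m : ℕ} (h : m ≤ 1) : shrink J m = ∅ := by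
  ext i
  simp only [shrink, Set.mem_ofPred_eq, Set.mem_empty_iff_false, iff_false]
  omega

/-- By `relNorm_insert` the norm of `g_{m+1}` is `g_{m+1}` plus a smaller norm of `g_m g_{m+1} g_m =
g_{m+1} g_m g_{m+1}`. The outer factors commute with the smaller group and come out, which leaves
the recursion defining `murphy`. -/
theorem relNorm_g_eq_murphy {J : Set ℕ} {m : ℕ} (hm : m + 1 < n) (hmJ : m ∈ J) :
    relNorm (para (shrink J (m + 1))) (para (shrink J m)) (g m) = (murphy J m : Hecke n) := by
  induction m with
  | zero => rw [shrink_le_one J (by omega), shrink_le_one J (by omega), relNorm_self]; rfl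
  | succ m ih =>
    by_cases h : m ∈ J
    · have hlt : ∀ i ∈ shrink J (m + 1), i < m := fun i hi => by
        have := hi.2.2
        omega
      have hsh : {i | i ∈ shrink J (m + 1) ∧ i + 1 < m} = shrink J m := by
        ext i
        simp only [shrink, Set.mem_ofPred_eq]
        constructor
        · rintro ⟨⟨h1, h2, _⟩, h3⟩; exact ⟨h1, h2, h3⟩
        · rintro ⟨h1, h2, h3⟩; exact ⟨⟨h1, h2, by omega⟩, h3⟩
      have hc : ∀ d ∈ (para (shrink J (m + 1)) : Subgroup (Equiv.Perm (Fin n))),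
          g (m + 1) * T d = T d * g (m + 1) := fun d hd =>
        (commute_T_of_commute_g (fun j hj => g_comm (Or.inl (by have := hlt j hj; omega))) hd).symm
      rw [shrink_succ_of_mem h hmJ, relNorm_insert hlt (by omega), hsh, g_braid hm,
        relNorm_mul_right _ _ hc, relNorm_mul_left _ _ hc, ih (by omega) h,
        murphy_succ_of_mem h, add_comm]
    · rw [shrink_succ_of_notMem (Or.inl h), relNorm_self, murphy_succ_of_notMem h]

/-- The norm of `T_{w_J}` from the trivial group is the product of the Jucys–Murphy elements. -/
theorem relNorm_T_coxPerm {J : Set ℕ} (hJ : ∀ i ∈ J, i + 1 < n) (m : ℕ) :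
    relNorm (para (shrink J m)) (para ∅) (T (coxPerm J m)) = (murphyProd J m : Hecke n) := by
  induction m with
  | zero =>
    rw [shrink_le_one J (by omega), relNorm_self]
    exact T_one
  | succ m ih =>
    by_cases h : m ∈ J
    · have hsub : shrink J m ⊆ shrink J (m + 1) := fun i hi => ⟨hi.1, hi.2.1, Nat.lt_succ_of_lt hi.2.2⟩
      -- The norm is taken through `shrink J m`. In the first stage `g m` commutes with the group
      -- and comes out on the right; in the second the product already obtained commutes with the
      -- group and comes out on the left, leaving the norm of `g m`.
      rw [T_coxPerm_succ h, ← relNorm_relNorm (Set.empty_subset _) hsub,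
        relNorm_mul_right, ih, relNorm_mul_left, relNorm_g_eq_murphy (hJ m h) h,
        murphyProd_succ_of_mem h]
      · intro d hd
        refine (commute_T_of_commute_g (fun j hj => ?_) hd).symm
        exact g_mul_murphyProd hJ hj.1 (by have := hj.2.2; omega)
      · intro d hd
        refine (commute_T_of_commute_g (fun j hj => ?_) hd).symm
        exact g_comm (Or.inl (by have := hj.2.2; omega))
    · rw [murphyProd_succ_of_notMem h, coxPerm_succ_of_notMem h, ← ih]
      rcases m with _ | m
      · rw [shrink_le_one J (by omega), shrink_le_one J (by omega)]
      · rw [shrink_succ_of_notMem (Or.inr h)]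

/-! ### Coefficients of products of Jucys–Murphy elements -/

theorem coef_mul_g_of_mem_paraAlg {J : Set ℕ} {m : ℕ} (hm : m ∉ J) (hmn : m + 1 < n) {h : Hecke n}
    (hh : h ∈ paraAlg J) (v : Equiv.Perm (Fin n)) : coef v (h * g m) = coef (v * sw m) h := by
  classical
  have key : ∀ w, coef w h • coef v (T w * g m) = if w = v * sw m then coef w h else 0 := by
    intro w
    by_cases hw : w ∈ para J
    · rw [← T_mul_sw (asc_of_mem_para hw hm hmn), coef_T]
      have : w * sw m = v ↔ w = v * sw m := by rw [← eq_mul_inv_iff_mul_eq, sw_inv]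
      simp [this]
    · simp [hh w hw]
  conv_lhs => rw [← sum_coef h, Finset.sum_mul, map_sum]
  simp only [smul_mul_assoc, map_smul, key]
  simp

/-- The span of the `T_w` for which the letter `m + 1` is the image of a letter below `m`. -/
noncomputable def lowSpan (n m : ℕ) : Submodule ℤ[X] (Hecke n) :=
  Submodule.span ℤ[X] {h | ∃ w : Equiv.Perm (Fin n), (∃ x : Fin n, (x : ℕ) < m ∧
    ((w x : Fin n) : ℕ) = m + 1) ∧ h = T w}

theorem T_mem_lowSpan {m : ℕ} {w : Equiv.Perm (Fin n)} {x : Fin n} (hx : (x : ℕ) < m)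
    (hw : ((w x : Fin n) : ℕ) = m + 1) : T w ∈ lowSpan n m :=
  Submodule.subset_span ⟨w, ⟨x, hx, hw⟩, rfl⟩

theorem coef_of_mem_lowSpan {m : ℕ} {h : Hecke n} (hh : h ∈ lowSpan n m) {w : Equiv.Perm (Fin n)}
    {x : Fin n} (hx : m ≤ (x : ℕ)) (hw : ((w x : Fin n) : ℕ) = m + 1) : coef w h = 0 := by
  induction hh using Submodule.span_induction with
  | mem h hh =>
    obtain ⟨v, ⟨y, hy, hv⟩, rfl⟩ := hh
    rw [coef_T, if_neg]
    rintro rfl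
    have : x = y := v.injective (Fin.ext (hw.trans hv.symm))
    rw [this] at hx
    omega
  | zero => rw [map_zero]
  | add a b _ _ ha hb => rw [map_add, ha, hb, add_zero]
  | smul r a _ ha => rw [map_smul, ha, smul_zero]

theorem g_mul_mem_lowSpan {m j : ℕ} (hj : j < m) {h : Hecke n} (hh : h ∈ lowSpan n m) :
    g j * h ∈ lowSpan n m := by
  induction hh using Submodule.span_induction with
  | mem h hh =>
    obtain ⟨w, ⟨x, hx, hw⟩, rfl⟩ := hh
    refine Submodule.span_le.2 ?_ (g_mul_T_mem_span j w)
    rintro _ (rfl | rfl)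
    · exact T_mem_lowSpan hx hw
    · refine T_mem_lowSpan hx ?_
      rw [Equiv.Perm.mul_apply]
      by_cases hjn : j + 1 < n
      · rw [sw_val hjn]
        split_ifs <;> omega
      · simpa [sw, hjn] using hw
  | zero => rw [mul_zero]; exact zero_mem _
  | add a b _ _ ha hb => rw [mul_add]; exact add_mem ha hb
  | smul r a _ ha => rw [mul_smul_comm]; exact Submodule.smul_mem _ _ ha

theorem mul_mem_lowSpan {m : ℕ} {J : Set ℕ} (hJ : ∀ j ∈ J, j < m) {a h : Hecke n}
    (ha : a ∈ paraAlg J) (hh : h ∈ lowSpan n m) : a * h ∈ lowSpan n m := by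
  have key : ∀ w ∈ (para J : Subgroup (Equiv.Perm (Fin n))), ∀ h ∈ lowSpan n m,
      T w * h ∈ lowSpan n m := fun w hw => by
    refine para_induction_left (P := fun w => ∀ h ∈ lowSpan n m, T w * h ∈ lowSpan n m) ?_ ?_ w hw
    · intro h hh
      rwa [T_one, one_mul]
    · intro w i _ hi ha ih h hh
      rw [T_sw_mul ha, mul_assoc]
      exact g_mul_mem_lowSpan (hJ i hi) (ih h hh)
  rw [← sum_coef a, Finset.sum_mul]
  refine sum_mem fun w _ => ?_
  by_cases hw : w ∈ para J
  · rw [smul_mul_assoc]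
    exact Submodule.smul_mem _ _ (key w hw h hh)
  · rw [ha w hw, zero_smul, zero_mul]
    exact zero_mem _

/-- Every permutation occurring in `L_m` sends some letter `x ≤ m` to `m + 1`. After left
multiplication by `s_{m+1}` it sends `x` to `m + 2`, and right multiplication by `s_{m+1}` does not
touch `x`. So in `L_{m+1}` only the leading `g_{m+1}` lies outside the span. -/
theorem murphy_sub_g_mem_lowSpan {J : Set ℕ} {m : ℕ} (hm : m + 1 < n) :
    ∃ h ∈ lowSpan n m, murphy J m = g m + h := by
  induction m with
  | zero => exact ⟨0, zero_mem _, (add_zero _).symm⟩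
  | succ m ih =>
    by_cases hmJ : m ∈ J
    swap
    · exact ⟨0, zero_mem _, by rw [murphy_succ_of_notMem hmJ, add_zero]⟩
    refine ⟨g (m + 1) * murphy J m * g (m + 1), ?_, by rw [murphy_succ_of_mem hmJ, add_comm]⟩
    obtain ⟨h, hh, e⟩ := ih (by omega)
    rw [← sum_coef (murphy J m), Finset.mul_sum, Finset.sum_mul]
    refine sum_mem fun w _ => ?_
    rw [mul_smul_comm, smul_mul_assoc]
    by_cases hw : w ∈ para (J ∩ {i | i < m + 1})
    swap
    · rw [murphy_mem_paraAlg hmJ w hw, zero_smul]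
      exact zero_mem _
    have hnot : m + 1 ∉ J ∩ {i | i < m + 1} := fun h => lt_irrefl (m + 1) h.2
    obtain ⟨x, hx⟩ := w.surjective ⟨m + 1, by omega⟩
    have hx' : ((w x : Fin n) : ℕ) = m + 1 := by rw [hx]
    have hxm : (x : ℕ) ≤ m + 1 := by rw [← le_iff_of_mem_para hw hnot, hx']
    by_cases hxm' : (x : ℕ) = m + 1
    · have : coef w (murphy J m) = 0 := by
        rw [e, map_add, coef_of_mem_lowSpan hh (by omega) hx', ← T_sw (by omega), coef_T, if_neg,
          add_zero]
        rintro rfl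
        rw [sw_val (by omega)] at hx'
        split_ifs at hx' <;> omega
      rw [this, zero_smul]
      exact zero_mem _
    · refine Submodule.smul_mem _ _ ?_
      rw [← T_sw_mul (asc_of_mem_para (inv_mem hw) hnot hm)]
      have hv : (sw (m + 1) * w : Equiv.Perm (Fin n)) x = ⟨m + 1 + 1, hm⟩ := by
        rw [Equiv.Perm.mul_apply, hx, sw_lo hm]
      refine Submodule.span_le.2 ?_ (T_mul_g_mem_span (m + 1) (sw (m + 1) * w))
      rintro _ (rfl | rfl)
      · exact T_mem_lowSpan (x := x) (by omega) (by rw [hv])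
      · refine T_mem_lowSpan (x := x) (by omega) ?_
        rw [Equiv.Perm.mul_apply, sw_of_ne hm (by omega) (by omega), hv]

/-- The coefficient of `T_{w_{J'}}`, for `J' ⊆ J`, in the product of the Jucys–Murphy elements
of `H_J`. -/
theorem coef_coxPerm_murphyProd {J J' : Set ℕ} (hJ : ∀ i ∈ J, i + 1 < n) (hJ' : J' ⊆ J) (m : ℕ) :
    ((∀ i ∈ J, i < m → i ∈ J') → coef (coxPerm J' m) (murphyProd J m : Hecke n) = 1) ∧
      (¬ (∀ i ∈ J, i < m → i ∈ J') → coef (coxPerm J' m) (murphyProd J m : Hecke n) = 0) := by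
  induction m with
  | zero =>
    refine ⟨fun _ => ?_, fun h => absurd (fun i _ hi => absurd hi (Nat.not_lt_zero i)) h⟩
    rw [coxPerm, murphyProd, ← T_one, coef_T, if_pos rfl]
  | succ m ih =>
    by_cases hm : m ∈ J
    · have hmn := hJ m hm
      obtain ⟨h, hh, e⟩ := murphy_sub_g_mem_lowSpan (J := J) hmn
      have hnot : ∀ J : Set ℕ, m ∉ J ∩ {i | i < m} := fun J h => lt_irrefl m h.2
      have hEh := mul_mem_lowSpan (fun j hj => hj.2) (murphyProd_mem_paraAlg J m) hh
      have hcox := coxPerm_mem_para (n := n) J' m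
      have hfix : ((coxPerm J' m : Equiv.Perm (Fin n)) ⟨m + 1, hmn⟩ : ℕ) = m + 1 := by
        have h1 := le_iff_of_mem_para hcox (hnot J') ⟨m + 1, hmn⟩
        have h2 := le_iff_of_mem_para hcox (m := m + 1) (fun h => by
          have := h.2; simp only [Set.mem_ofPred_eq] at this; omega) ⟨m + 1, hmn⟩
        simp only at h1 h2
        omega
      rw [murphyProd_succ_of_mem hm, e, mul_add]
      simp only [map_add, coef_mul_g_of_mem_paraAlg (hnot J) hmn (murphyProd_mem_paraAlg J m)]
      -- In the Coxeter element of `J'` cut off after `m`, the letter `m + 1` is the image of `m` or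
      -- of itself. So the `lowSpan` part of `L_m` contributes nothing and only its leading term `g
      -- m` counts.
      by_cases hm' : m ∈ J'
      · rw [coxPerm_succ_of_mem hm', mul_sw_mul_sw,
          coef_of_mem_lowSpan (x := ⟨m, by omega⟩) hEh le_rfl
            (by rw [Equiv.Perm.mul_apply, sw_lo hmn, hfix]), add_zero]
        have : (∀ i ∈ J, i < m + 1 → i ∈ J') ↔ (∀ i ∈ J, i < m → i ∈ J') := by
          refine ⟨fun h i hi him => h i hi (by omega), fun h i hi him => ?_⟩
          by_cases e : i = m
          · exact e ▸ hm'
          · exact h i hi (by omega)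
        rwa [this]
      · refine ⟨fun h => absurd (h m hm (Nat.lt_succ_self m)) hm', fun _ => ?_⟩
        rw [coxPerm_succ_of_notMem hm',
          coef_of_mem_lowSpan (x := ⟨m + 1, hmn⟩) hEh (Nat.le_succ m) hfix, add_zero]
        refine murphyProd_mem_paraAlg J m _ fun hmem => ?_
        have h1 := le_iff_of_mem_para hmem (hnot J) ⟨m + 1, hmn⟩
        rw [Equiv.Perm.mul_apply, sw_hi hmn] at h1
        have h2 := (le_iff_of_mem_para hcox (hnot J') ⟨m, by omega⟩).2 le_rfl
        simp only at h1
        omega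
    · have hm' : m ∉ J' := fun h => hm (hJ' h)
      rw [murphyProd_succ_of_notMem hm, coxPerm_succ_of_notMem hm']
      have : (∀ i ∈ J, i < m + 1 → i ∈ J') ↔ (∀ i ∈ J, i < m → i ∈ J') := by
        refine ⟨fun h i hi him => h i hi (by omega), fun h i hi him => ?_⟩
        have : i ≠ m := fun e => hm (e ▸ hi)
        exact h i hi (by omega)
      rwa [this]

/-! ### Reduction to Coxeter elements by cyclic shifts -/

theorem coxPerm_eq_one {J : Set ℕ} {m : ℕ} (h : ∀ j ∈ J, m ≤ j) :
    (coxPerm J m : Equiv.Perm (Fin n)) = 1 := by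
  induction m with
  | zero => rfl
  | succ m ih =>
    rw [coxPerm_succ_of_notMem fun hm => absurd (h m hm) (by omega), ih fun j hj => by
      have := h j hj; omega]

theorem coxPerm_insert {J : Set ℕ} {k N : ℕ} (h : ∀ j ∈ J, k < j) (hk : k < N) :
    (coxPerm (insert k J) N : Equiv.Perm (Fin n)) = sw k * coxPerm J N := by
  induction N with
  | zero => omega
  | succ N ih =>
    by_cases hkN : k = N
    · subst hkN
      have hk : k ∉ J := fun hk => lt_irrefl k (h k hk)
      rw [coxPerm_succ_of_mem (Set.mem_insert k J), coxPerm_succ_of_notMem hk,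
        coxPerm_eq_one (m := k), coxPerm_eq_one, one_mul, mul_one]
      · exact fun j hj => (h j hj).le
      · rintro j (rfl | hj)
        exacts [le_rfl, (h j hj).le]
    · by_cases hN : N ∈ J
      · rw [coxPerm_succ_of_mem (Set.mem_insert_of_mem k hN), coxPerm_succ_of_mem hN,
          ih (by omega), mul_assoc]
      · rw [coxPerm_succ_of_notMem hN, coxPerm_succ_of_notMem (by
          rintro (e | e); exacts [hkN e.symm, hN e]), ih (by omega)]

theorem sw_mul_comm_of_mem_para {J : Set ℕ} {i : ℕ} (hJ : ∀ j ∈ J, i + 2 ≤ j)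
    {w : Equiv.Perm (Fin n)} (hw : w ∈ para J) : sw i * w = w * sw i := by
  refine para_induction_right (P := fun w => sw i * w = w * sw i) ?_ ?_ w hw
  · rw [one_mul, mul_one]
  · intro w j _ hj _ ih
    rw [← mul_assoc, ih, mul_assoc, mul_assoc, sw_comm (Or.inl (hJ j hj))]

theorem apply_eq_of_mem_para {J : Set ℕ} {m : ℕ} (hJ : ∀ j ∈ J, m < j)
    {w : Equiv.Perm (Fin n)} (hw : w ∈ para J) {x : Fin n} (hx : (x : ℕ) ≤ m) : w x = x := by
  have hnot : ∀ k ≤ m, k ∉ J := fun k hk h => absurd (hJ k h) (by omega)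
  have h1 := le_iff_of_mem_para hw (hnot x hx) x
  apply Fin.ext
  rcases hx0 : (x : ℕ) with _ | y
  · rw [hx0] at h1
    omega
  · have h2 := le_iff_of_mem_para hw (hnot y (by omega)) x
    omega

theorem mem_para_of_apply_eq {K : Set ℕ} {m : ℕ} (hm : m + 1 < n) {x : Equiv.Perm (Fin n)}
    (hx : x ∈ para (K ∩ {i | i < m + 1})) (hfix : x ⟨m + 1, hm⟩ = ⟨m + 1, hm⟩) :
    x ∈ para (K ∩ {i | i < m}) := by
  refine mem_para_of_le_iff fun k hk z => ?_
  by_cases hkm : k = m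
  · subst hkm
    have h1 := le_iff_of_mem_para hx (m := k + 1) (fun h => lt_irrefl (k + 1) h.2) z
    have h2 : ((x z : Fin n) : ℕ) = k + 1 ↔ (z : ℕ) = k + 1 := by
      constructor
      · intro h
        have : x z = x ⟨k + 1, hm⟩ := by rw [hfix]; exact Fin.ext h
        exact congrArg Fin.val (x.injective this)
      · intro h
        have : z = ⟨k + 1, hm⟩ := Fin.ext h
        rw [this, hfix]
    omega
  · refine le_iff_of_mem_para hx (fun h => hk ⟨h.1, ?_⟩) z
    have := h.2
    simp only [Set.mem_ofPred_eq] at this ⊢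
    omega

/-- The theorem of Geck and Pfeiffer in type `A`: every element of `W_K` is reduced to Coxeter
elements `w_J`, `J ⊆ K`, by cyclic shifts that do not increase the length. -/
theorem cyclicShift_induction {K : Set ℕ} {Q : Equiv.Perm (Fin n) → Prop}
    (cox : ∀ J ⊆ K, (∀ j ∈ J, j + 1 < n) → Q (coxPerm J n))
    (down : ∀ u i, u ∈ para K → i ∈ K → Asc u⁻¹ i → Asc (sw i * u) i → Q u → Q (sw i * u) →
      Q (sw i * u * sw i))
    (cyc : ∀ v i, v ∈ para K → i ∈ K → Asc v i → Asc v⁻¹ i → Q (sw i * v) → Q (v * sw i))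
    {w : Equiv.Perm (Fin n)} (hw : w ∈ para K) : Q w := by
  induction hN : len w using Nat.strong_induction_on generalizing w with
  | _ N IH =>
  -- Within a fixed length, elements are kept in the form `x * w_J`, where `x` involves only
  -- generators below `m` and `J` only generators from `m` on. Lowering `m` to `0` leaves a Coxeter
  -- element.
  suffices H : ∀ m < n, ∀ J : Set ℕ, J ⊆ K → (∀ j ∈ J, m ≤ j ∧ j + 1 < n) →
      ∀ x : Equiv.Perm (Fin n), x ∈ para (K ∩ {i | i < m}) → len (x * coxPerm J n) = N →
      Q (x * coxPerm J n) by
    rcases n with _ | n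
    · have e : w = coxPerm ∅ 0 := Subsingleton.elim _ _
      rw [e]
      exact cox ∅ (Set.empty_subset _) (by simp)
    · have h1 : (coxPerm ∅ (n + 1) : Equiv.Perm (Fin (n + 1))) = 1 := coxPerm_eq_one (by simp)
      have := H n (Nat.lt_succ_self n) ∅ (Set.empty_subset _) (by simp) w
        (mem_para_of_le_iff fun k hk z => ?_) (by rwa [h1, mul_one])
      · rwa [h1, mul_one] at this
      · by_cases hkK : k ∈ K
        · have : ¬ k < n := fun h => hk ⟨hkK, h⟩
          have := (w z).2
          have := z.2
          omega
        · exact le_iff_of_mem_para hw hkK z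
  intro m
  induction m with
  | zero =>
    intro _ J hJK hJ x hx _
    have : x = 1 := by
      have e : K ∩ {i | i < 0} = ∅ := by ext; simp
      rw [e, para_empty, Subgroup.mem_bot] at hx
      exact hx
    rw [this, one_mul]
    exact cox J hJK fun j hj => (hJ j hj).2
  | succ m ihm =>
    intro hm J hJK hJ x hx hlen
    have hmm : m + 1 ∉ K ∩ {i | i < m + 1} := fun h => lt_irrefl (m + 1) h.2
    -- The inner induction is on the distance `k` of the letter `i` sent to `m + 1` from `m + 1`. At
    -- distance `0` the generator `m` is not needed in `x`; at distance `1` it moves into the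
    -- Coxeter part. At a larger distance conjugation by `s_i` either keeps the length and reduces
    -- the distance, or lowers the length by two.
    obtain ⟨k, hk⟩ : ∃ k, k + ((x⁻¹ ⟨m + 1, hm⟩ : Fin n) : ℕ) = m + 1 := by
      have := (le_iff_of_mem_para (inv_mem hx) hmm ⟨m + 1, hm⟩).2 le_rfl
      exact ⟨m + 1 - (x⁻¹ ⟨m + 1, hm⟩ : Fin n), by omega⟩
    induction k generalizing x with
    | zero =>
      rw [zero_add] at hk
      have hfix : x ⟨m + 1, hm⟩ = ⟨m + 1, hm⟩ := by
        rw [← Equiv.Perm.eq_inv_iff_eq]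
        exact Fin.ext hk.symm
      exact ihm (by omega) J hJK (fun j hj => ⟨by have := (hJ j hj).1; omega, (hJ j hj).2⟩) x
        (mem_para_of_apply_eq hm hx hfix) hlen
    | succ k ihk =>
      obtain ⟨i, hi⟩ : ∃ i, i = ((x⁻¹ ⟨m + 1, hm⟩ : Fin n) : ℕ) := ⟨_, rfl⟩
      rw [← hi] at hk
      have hxi : x ⟨i, by omega⟩ = ⟨m + 1, hm⟩ := by
        rw [← Equiv.Perm.eq_inv_iff_eq]
        exact Fin.ext hi
      have hiK : i ∈ K ∩ {i | i < m + 1} := by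
        by_contra h
        have := (le_iff_of_mem_para hx h ⟨i, by omega⟩).2 le_rfl
        rw [hxi] at this
        simp only at this
        omega
      rcases Nat.eq_zero_or_pos k with rfl | hk0
      · obtain rfl : m = i := by omega
        have hins : x * coxPerm J n = x * sw m * coxPerm (insert m J) n := by
          rw [coxPerm_insert (fun j hj => (hJ j hj).1) (by omega), mul_assoc, sw_mul_sw_mul]
        rw [hins] at hlen ⊢
        refine ihm (by omega) (insert m J) (Set.insert_subset hiK.1 hJK) ?_ _ ?_ hlen
        · rintro j (rfl | hj)
          · exact ⟨le_rfl, hm⟩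
          · exact ⟨by have := (hJ j hj).1; omega, (hJ j hj).2⟩
        · refine mem_para_of_apply_eq hm (mul_mem hx (sw_mem_para hiK)) ?_
          rw [Equiv.Perm.mul_apply, sw_hi hm, hxi]
      · have hcJ : (coxPerm J n : Equiv.Perm (Fin n)) ∈ para J :=
          para_mono Set.inter_subset_left (coxPerm_mem_para J n)
        have hcomm : sw i * (coxPerm J n : Equiv.Perm (Fin n)) = coxPerm J n * sw i :=
          sw_mul_comm_of_mem_para (fun j hj => by have := (hJ j hj).1; omega) hcJ
        have hcfix : ∀ z : Fin n, (z : ℕ) ≤ m → (coxPerm J n : Equiv.Perm (Fin n)) z = z :=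
          fun z hz => apply_eq_of_mem_para (fun j hj => (hJ j hj).1) hcJ hz
        have hcK : (coxPerm J n : Equiv.Perm (Fin n)) ∈ para K := para_mono hJK hcJ
        have hxK : x ∈ para K := para_mono Set.inter_subset_left hx
        have hd : Desc (x * coxPerm J n) i := by
          refine ⟨by omega, ?_⟩
          rw [Equiv.Perm.mul_apply, Equiv.Perm.mul_apply, hcfix _ (by simp only; omega),
            hcfix _ (by simp only; omega), hxi, Fin.lt_def]
          have h1 := (le_iff_of_mem_para hx hmm ⟨i + 1, by omega⟩).2 (by simp only; omega)
          have h2 : x ⟨i + 1, by omega⟩ ≠ ⟨m + 1, hm⟩ := by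
            rw [← hxi]
            intro e
            have := x.injective e
            simp at this
          have h3 : ((x ⟨i + 1, by omega⟩ : Fin n) : ℕ) ≠ m + 1 := fun e => h2 (Fin.ext e)
          simp only
          omega
        obtain ⟨v, hv⟩ : ∃ v, v = x * coxPerm J n * sw i := ⟨_, rfl⟩
        have hvw : v * sw i = x * coxPerm J n := by rw [hv, mul_sw_mul_sw]
        have hvi : Asc v i := by rw [hv]; exact asc_mul_sw.2 hd
        have hvK : v ∈ para K := by
          rw [hv]
          exact mul_mem (mul_mem hxK hcK) (sw_mem_para hiK.1)
        have hvlen : N = len v + 1 := by rw [← hlen, ← hvw, hvi.len_mul_sw]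
        rw [← hvw]
        rcases asc_or_desc v⁻¹ hvi.lt with ha | ha
        · refine cyc v i hvK hiK.1 hvi ha ?_
          have e : sw i * v = sw i * x * sw i * coxPerm J n := by
            rw [hv, mul_assoc, mul_assoc, ← hcomm]
            simp only [mul_assoc]
          have hl : len (sw i * v) = N := by rw [ha.len_sw_mul, hvlen]
          rw [e] at hl ⊢
          refine ihk _ (mul_mem (mul_mem (sw_mem_para hiK) hx) (sw_mem_para hiK)) hl ?_
          rw [mul_inv_rev, mul_inv_rev, sw_inv, Equiv.Perm.mul_apply, Equiv.Perm.mul_apply,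
            sw_of_ne (x := (⟨m + 1, hm⟩ : Fin n)) hvi.lt (by simp only; omega)
              (by simp only; omega), Equiv.Perm.inv_eq_iff_eq.2 hxi.symm, sw_lo hvi.lt]
          simp only
          omega
        · have hul := ha.len_sw_mul
          have huK : sw i * v ∈ para K := mul_mem (sw_mem_para hiK.1) hvK
          have := down (sw i * v) i huK hiK.1 (asc_inv_sw_mul.2 ha)
            (by rwa [sw_mul_sw_mul]) (IH _ (by omega) huK rfl)
            (by rw [sw_mul_sw_mul]; exact IH _ (by omega) hvK rfl)
          rwa [sw_mul_sw_mul] at this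

/-! ### Interchanging adjacent blocks -/

/-- The permutation moving the block of the `b` letters from `p` on up by `a` places, and the
block of the following `a` letters down by `b` places. -/
def blockSwap (p a b : ℕ) (h : p + a + b ≤ n) : Equiv.Perm (Fin n) where
  toFun y := ⟨if (y : ℕ) < p then (y : ℕ) else if (y : ℕ) < p + b then y + a else
    if (y : ℕ) < p + a + b then y - b else y, by split_ifs <;> omega⟩
  invFun y := ⟨if (y : ℕ) < p then (y : ℕ) else if (y : ℕ) < p + a then y + b else
    if (y : ℕ) < p + a + b then y - a else y, by split_ifs <;> omega⟩
  left_inv y := by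
    ext
    dsimp only
    grind
  right_inv y := by
    ext
    dsimp only
    grind

theorem blockSwap_val {p a b : ℕ} (h : p + a + b ≤ n) (y : Fin n) :
    ((blockSwap p a b h y : Fin n) : ℕ) = if (y : ℕ) < p then (y : ℕ) else if (y : ℕ) < p + b then
      y + a else if (y : ℕ) < p + a + b then y - b else y := rfl

/-- A simple reflection `s_j` is carried to `s_{j'}` by the interchange of blocks. -/
def BlockShift (p a b j j' : ℕ) : Prop :=
  (p ≤ j ∧ j + 1 < p + a ∧ j' = j + b) ∨ (p + a ≤ j ∧ j + 1 < p + a + b ∧ j' + a = j) ∨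
    ((j + 1 < p ∨ p + a + b ≤ j) ∧ j' = j)

theorem sw_mul_blockSwap {p a b : ℕ} (h : p + a + b ≤ n) {j j' : ℕ} (hj : j + 1 < n)
    (hjj : BlockShift p a b j j') :
    sw j * blockSwap p a b h = blockSwap p a b h * sw j' ∧ Asc (blockSwap p a b h) j' := by
  have hj' : j' + 1 < n := by rcases hjj with h | h | h <;> omega
  constructor
  · ext y
    rw [Equiv.Perm.mul_apply, Equiv.Perm.mul_apply, sw_val hj, blockSwap_val, blockSwap_val,
      sw_val hj']
    rcases hjj with h | h | h <;> grind
  · refine ⟨hj', ?_⟩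
    rw [Fin.lt_def, blockSwap_val, blockSwap_val]
    simp only
    rcases hjj with h | h | h <;> split_ifs <;> omega

theorem asc_inv_blockSwap {p a b : ℕ} (h : p + a + b ≤ n) {j j' : ℕ} (hj : j + 1 < n)
    (hjj : BlockShift p a b j j') : Asc (blockSwap p a b h)⁻¹ j := by
  obtain ⟨e, ha⟩ := sw_mul_blockSwap h hj hjj
  rw [asc_inv_iff_len hj, e, ha.len_mul_sw]
  omega

theorem g_mul_T_blockSwap {p a b : ℕ} (h : p + a + b ≤ n) {j j' : ℕ} (hj : j + 1 < n)
    (hjj : BlockShift p a b j j') :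
    g j * T (blockSwap p a b h) = T (blockSwap p a b h) * g j' := by
  obtain ⟨e, ha⟩ := sw_mul_blockSwap h hj hjj
  rw [← T_sw_mul (asc_inv_blockSwap h hj hjj), e, T_mul_sw ha]

theorem g_mul_T_blockSwap_inv {p a b : ℕ} (h : p + a + b ≤ n) {j j' : ℕ} (hj : j + 1 < n)
    (hjj : BlockShift p a b j j') :
    g j' * T (blockSwap p a b h)⁻¹ = T (blockSwap p a b h)⁻¹ * g j := by
  obtain ⟨e, ha⟩ := sw_mul_blockSwap h hj hjj
  have e' : sw j' * (blockSwap p a b h)⁻¹ = (blockSwap p a b h)⁻¹ * sw j := by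
    simpa using (congrArg (·⁻¹) e).symm
  rw [← T_sw_mul (by simpa using ha), e', T_mul_sw (asc_inv_blockSwap h hj hjj)]

open Classical in
/-- The increasing product of the generators `T_{s_i}` with `i ∈ J` and `l ≤ i < l + k`. -/
noncomputable def coxProd (J : Set ℕ) (l : ℕ) : ℕ → Hecke n
  | 0 => 1
  | k + 1 => if l + k ∈ J then coxProd J l k * g (l + k) else coxProd J l k

theorem coxProd_succ_of_mem {J : Set ℕ} {l k : ℕ} (h : l + k ∈ J) :
    (coxProd J l (k + 1) : Hecke n) = coxProd J l k * g (l + k) := by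
  rw [coxProd, if_pos h]

theorem coxProd_succ_of_notMem {J : Set ℕ} {l k : ℕ} (h : l + k ∉ J) :
    (coxProd J l (k + 1) : Hecke n) = coxProd J l k := by
  rw [coxProd, if_neg h]

theorem T_coxPerm (J : Set ℕ) (m : ℕ) :
    T (coxPerm J m : Equiv.Perm (Fin n)) = coxProd J 0 m := by
  induction m with
  | zero => exact T_one
  | succ m ih =>
    by_cases h : m ∈ J
    · rw [T_coxPerm_succ h, coxProd_succ_of_mem (by rwa [zero_add]), ih, zero_add]
    · rw [coxPerm_succ_of_notMem h, coxProd_succ_of_notMem (by rwa [zero_add]), ih]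

theorem coxProd_add (J : Set ℕ) (l k k' : ℕ) :
    (coxProd J l (k + k') : Hecke n) = coxProd J l k * coxProd J (l + k) k' := by
  induction k' with
  | zero => rw [add_zero, coxProd, mul_one]
  | succ k' ih =>
    by_cases h : l + k + k' ∈ J
    · rw [← add_assoc, coxProd_succ_of_mem (by rwa [← add_assoc]), coxProd_succ_of_mem h, ih,
        mul_assoc, add_assoc]
    · rw [← add_assoc, coxProd_succ_of_notMem (by rwa [← add_assoc]), coxProd_succ_of_notMem h, ih]

theorem coxProd_congr {J J' : Set ℕ} {l k : ℕ} (h : ∀ i < k, l + i ∈ J ↔ l + i ∈ J') :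
    (coxProd J l k : Hecke n) = coxProd J' l k := by
  induction k with
  | zero => rfl
  | succ k ih =>
    have ih' := ih fun i hi => h i (by omega)
    by_cases hk : l + k ∈ J
    · rw [coxProd_succ_of_mem hk, coxProd_succ_of_mem ((h k (by omega)).1 hk), ih']
    · rw [coxProd_succ_of_notMem hk, coxProd_succ_of_notMem (mt (h k (by omega)).2 hk), ih']

/-- Moving an increasing product past an element that intertwines its factors. -/
theorem coxProd_mul_of_shift {J J' : Set ℕ} {l l' k : ℕ} {z : Hecke n}
    (h : ∀ i < k, l + i ∈ J ↔ l' + i ∈ J')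
    (hz : ∀ i < k, l + i ∈ J → g (l + i) * z = z * g (l' + i)) :
    coxProd J l k * z = z * coxProd J' l' k := by
  induction k with
  | zero => rw [coxProd, coxProd, one_mul, mul_one]
  | succ k ih =>
    have ih' := ih (fun i hi => h i (by omega)) fun i hi => hz i (by omega)
    by_cases hk : l + k ∈ J
    · rw [coxProd_succ_of_mem hk, coxProd_succ_of_mem ((h k (by omega)).1 hk), mul_assoc,
        hz k (by omega) hk, ← mul_assoc, ih', mul_assoc]
    · rw [coxProd_succ_of_notMem hk, coxProd_succ_of_notMem (mt (h k (by omega)).2 hk), ih']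

theorem coxProd_mem_posSemiring (J : Set ℕ) (l k : ℕ) :
    (coxProd J l k : Hecke n) ∈ posSemiring n := by
  induction k with
  | zero => exact one_mem _
  | succ k ih =>
    by_cases hk : l + k ∈ J
    · rw [coxProd_succ_of_mem hk]
      exact mul_mem ih (g_mem_posSemiring _)
    · rwa [coxProd_succ_of_notMem hk]

/-- Products over separated blocks commute. -/
theorem coxProd_mul_comm {J J' : Set ℕ} {l l' k k' : ℕ}
    (h : ∀ i < k, l + i ∈ J → ∀ i' < k', l' + i' ∈ J' → l + i + 2 ≤ l' + i') :
    (coxProd J l k : Hecke n) * coxProd J' l' k' = coxProd J' l' k' * coxProd J l k :=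
  coxProd_mul_of_shift (fun _ _ => Iff.rfl) fun i hi hiJ =>
    (coxProd_mul_of_shift (fun _ _ => Iff.rfl) fun i' hi' hiJ' =>
      (g_comm (Or.inl (h i hi hiJ i' hi' hiJ'))).symm).symm

/-- The hypotheses under which the blocks of `J` starting at `p` of sizes `a` and `b` are
interchanged, with result `J'`. -/
structure BlocksSwapped (J J' : Set ℕ) (n p a b : ℕ) : Prop where
  le : p + a + b ≤ n
  lt : ∀ i ∈ J, i + 1 < n
  low : ∀ i, i + 1 ≤ p → (i ∈ J ↔ i ∈ J')
  high : ∀ i, p + a + b ≤ i + 1 → (i ∈ J ↔ i ∈ J')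
  left : ∀ i < a, p + i ∈ J ↔ p + b + i ∈ J'
  right : ∀ i < b, p + a + i ∈ J ↔ p + i ∈ J'
  notMem_low : ∀ i ∈ J, i + 1 ≠ p
  notMem_mid : ∀ i ∈ J, i + 1 ≠ p + a
  notMem_high : ∀ i ∈ J, i + 1 ≠ p + a + b

theorem BlocksSwapped.coxProd_split {J J' : Set ℕ} {p a b : ℕ} (h : BlocksSwapped J J' n p a b) :
    ∃ r, n = p + a + b + r ∧ (coxProd J 0 n : Hecke n) =
      coxProd J 0 p * coxProd J p a * coxProd J (p + a) b * coxProd J (p + a + b) r := by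
  obtain ⟨r, hr⟩ := Nat.exists_eq_add_of_le h.le
  refine ⟨r, hr, ?_⟩
  have key : ∀ N, N = p + a + b + r → (coxProd J 0 N : Hecke n) =
      coxProd J 0 p * coxProd J p a * coxProd J (p + a) b * coxProd J (p + a + b) r := by
    rintro _ rfl
    rw [coxProd_add, coxProd_add, coxProd_add]
    simp only [zero_add]
  exact key n hr

theorem BlocksSwapped.left_mul {J J' : Set ℕ} {p a b : ℕ} (h : BlocksSwapped J J' n p a b) :
    coxProd J p a * T (blockSwap p a b h.le) = T (blockSwap p a b h.le) * coxProd J' (p + b) a := by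
  refine coxProd_mul_of_shift h.left fun i hi hiJ => g_mul_T_blockSwap h.le (h.lt _ hiJ) ?_
  have := h.notMem_mid _ hiJ
  exact Or.inl ⟨by omega, by omega, by omega⟩

theorem BlocksSwapped.right_mul {J J' : Set ℕ} {p a b : ℕ} (h : BlocksSwapped J J' n p a b) :
    coxProd J (p + a) b * T (blockSwap p a b h.le) = T (blockSwap p a b h.le) * coxProd J' p b := by
  refine coxProd_mul_of_shift h.right fun i hi hiJ => g_mul_T_blockSwap h.le (h.lt _ hiJ) ?_
  have := h.notMem_high _ hiJ
  exact Or.inr (Or.inl ⟨by omega, by omega, by omega⟩)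

theorem BlocksSwapped.right_mul_inv {J J' : Set ℕ} {p a b : ℕ} (h : BlocksSwapped J J' n p a b) :
    coxProd J' p b * T (blockSwap p a b h.le)⁻¹ =
      T (blockSwap p a b h.le)⁻¹ * coxProd J (p + a) b := by
  refine coxProd_mul_of_shift (fun i hi => (h.right i hi).symm) fun i hi hiJ => ?_
  have hiJ' := (h.right i hi).2 hiJ
  refine g_mul_T_blockSwap_inv h.le (h.lt _ hiJ') ?_
  have := h.notMem_high _ hiJ'
  exact Or.inr (Or.inl ⟨by omega, by omega, by omega⟩)

theorem BlocksSwapped.low_mul {J J' : Set ℕ} {p a b : ℕ} (h : BlocksSwapped J J' n p a b) :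
    coxProd J 0 p * T (blockSwap p a b h.le) = T (blockSwap p a b h.le) * coxProd J' 0 p := by
  refine coxProd_mul_of_shift (fun i hi => h.low _ (by omega)) fun i hi hiJ =>
    g_mul_T_blockSwap h.le (h.lt _ hiJ) ?_
  have := h.notMem_low _ hiJ
  exact Or.inr (Or.inr ⟨by omega, rfl⟩)

theorem BlocksSwapped.low_mul_inv {J J' : Set ℕ} {p a b : ℕ} (h : BlocksSwapped J J' n p a b) :
    coxProd J' 0 p * T (blockSwap p a b h.le)⁻¹ = T (blockSwap p a b h.le)⁻¹ * coxProd J 0 p := by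
  refine coxProd_mul_of_shift (fun i hi => (h.low _ (by omega)).symm) fun i hi hiJ => ?_
  have hiJ' := (h.low _ (by omega)).2 hiJ
  refine g_mul_T_blockSwap_inv h.le (h.lt _ hiJ') ?_
  have := h.notMem_low _ hiJ'
  exact Or.inr (Or.inr ⟨by omega, rfl⟩)

theorem BlocksSwapped.high_mul {J J' : Set ℕ} {p a b r : ℕ} (h : BlocksSwapped J J' n p a b) :
    coxProd J (p + a + b) r * T (blockSwap p a b h.le) =
      T (blockSwap p a b h.le) * coxProd J' (p + a + b) r := by
  refine coxProd_mul_of_shift (fun i hi => h.high _ (by omega)) fun i hi hiJ =>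
    g_mul_T_blockSwap h.le (h.lt _ hiJ) ?_
  exact Or.inr (Or.inr ⟨by omega, rfl⟩)

theorem BlocksSwapped.comm {J J' : Set ℕ} {p a b : ℕ} (h : BlocksSwapped J J' n p a b) :
    (coxProd J' p b : Hecke n) * coxProd J' (p + b) a =
      coxProd J' (p + b) a * coxProd J' p b := by
  refine coxProd_mul_comm fun i hi hiJ i' hi' hiJ' => ?_
  have := h.notMem_high _ ((h.right i hi).2 hiJ)
  omega

theorem BlocksSwapped.comm_left {J J' : Set ℕ} {p a b : ℕ} (h : BlocksSwapped J J' n p a b) :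
    (coxProd J p a : Hecke n) * coxProd J (p + a) b =
      coxProd J (p + a) b * coxProd J p a := by
  refine coxProd_mul_comm fun i hi hiJ i' hi' hiJ' => ?_
  have := h.notMem_mid _ hiJ
  omega

/-- Coxeter elements that differ by an interchange of adjacent blocks are intertwined by an
invertible standard basis element. -/
theorem BlocksSwapped.T_coxPerm_mul {J J' : Set ℕ} {p a b : ℕ} (h : BlocksSwapped J J' n p a b) :
    T (coxPerm J n) * T (blockSwap p a b h.le) = T (blockSwap p a b h.le) * T (coxPerm J' n) := by
  obtain ⟨r, hr, e⟩ := h.coxProd_split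
  have e' : ∀ N, N = p + b + a + r → (coxProd J' 0 N : Hecke n) =
      coxProd J' 0 p * coxProd J' p b * coxProd J' (p + b) a * coxProd J' (p + a + b) r := by
    rintro _ rfl
    rw [coxProd_add, coxProd_add, coxProd_add]
    simp only [zero_add]
    rw [show p + b + a = p + a + b by omega]
  rw [T_coxPerm, T_coxPerm, e, e' n (by omega), mul_assoc, h.high_mul, ← mul_assoc,
    mul_assoc _ _ (T (blockSwap p a b h.le)), h.right_mul, ← mul_assoc,
    mul_assoc _ _ (T (blockSwap p a b h.le)), h.left_mul, ← mul_assoc, h.low_mul,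
    mul_assoc _ _ (coxProd J' p b), ← h.comm]
  simp only [mul_assoc]

/-- In the group, the two Coxeter elements are conjugate. -/
theorem BlocksSwapped.isConj {J J' : Set ℕ} {p a b : ℕ} (h : BlocksSwapped J J' n p a b) :
    IsConj (coxPerm J n : Equiv.Perm (Fin n)) (coxPerm J' n) := by
  -- At `ξ = 0` the intertwining relation is an identity in the group ring; comparing the
  -- coefficient at one group element gives the conjugation.
  have e := congrArg (fun x : Hecke n => (coef (coxPerm J n * blockSwap p a b h.le) x).eval 0)
    h.T_coxPerm_mul
  simp only [eval_coef_mul_T, mul_inv_cancel_right] at e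
  rw [coef_T, coef_T, if_pos rfl] at e
  split_ifs at e with h1
  · rw [isConj_comm, isConj_iff]
    exact ⟨blockSwap p a b h.le, mul_inv_eq_iff_eq_mul.2 (eq_mul_inv_iff_mul_eq.1 h1)⟩
  · simp at e

/-- The trace formula gives coefficient exactly `1` at the identity, and all other coefficients are
positive. -/
theorem T_inv_mul_T_sub_one_mem (w : Equiv.Perm (Fin n)) :
    ∃ h ∈ posSemiring n, T w⁻¹ * T w = 1 + h := by
  refine ⟨T w⁻¹ * T w - 1, fun v => ?_, by abel⟩
  by_cases hv : v = 1
  · subst hv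
    rw [map_sub, coef_one_T_mul_T, inv_mul_cancel, if_pos rfl, ← T_one, coef_T, if_pos rfl, sub_self]
    exact zero_mem _
  · rw [map_sub, ← T_one, coef_T, if_neg (Ne.symm hv), sub_zero]
    exact T_mul_T_coef_mem _ _ _

/-- Splitting off the descent gives `g_i (1 + h) g_i` with `h` positive, and `g_i² = 1 + ξ g_i`.
This is where the factor `ξ` of the theorem originates. -/
theorem T_inv_mul_T_of_desc {w : Equiv.Perm (Fin n)} {i : ℕ} (hd : Desc w i) :
    ∃ h ∈ posSemiring n, T w⁻¹ * T w = (X : ℤ[X]) • g i + h := by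
  obtain ⟨h, hh, e⟩ := T_inv_mul_T_sub_one_mem (w * sw i)
  have e1 : T w⁻¹ = g i * T (w * sw i)⁻¹ := by
    have : w⁻¹ = sw i * (w * sw i)⁻¹ := by rw [mul_inv_rev, sw_inv, sw_mul_sw_mul]
    conv_lhs => rw [this]
    rw [T_sw_mul]
    rw [inv_inv]
    exact asc_mul_sw.2 hd
  refine ⟨1 + g i * h * g i, add_mem (one_mem _) (mul_mem (mul_mem (g_mem_posSemiring i) hh)
    (g_mem_posSemiring i)), ?_⟩
  rw [e1, T_mul_sw_desc hd, ← mul_assoc, mul_assoc (g i), e, mul_add, add_mul, mul_one,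
    g_mul_self hd.lt]
  abel

/-- If `J` is obtained from `K` by removing `k`, then the norm of `T_{w_J}` from `W_J` to `W_K`
contains `ξ T_{w_K}`. -/
theorem exists_distinguished_conj {K : Set ℕ} (hK : ∀ i ∈ K, i + 1 < n) {k : ℕ} (hk : k ∈ K) :
    ∃ c : Equiv.Perm (Fin n), IsDistinguished (para K) (para (K \ {k})) c ∧
      ∃ h ∈ posSemiring n,
        T c⁻¹ * T (coxPerm (K \ {k}) n) * T c = (X : ℤ[X]) • T (coxPerm K n) + h := by
  classical
  -- the run of `K` around `k` consists of the `i` with `p ≤ i < e`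
  obtain ⟨p, hpk, hpK, hp⟩ : ∃ p ≤ k, (∀ i, p ≤ i → i ≤ k → i ∈ K) ∧ ∀ i ∈ K, i + 1 ≠ p := by
    have hex : ∃ p, p ≤ k ∧ ∀ i, p ≤ i → i ≤ k → i ∈ K :=
      ⟨k, le_rfl, fun i h1 h2 => by rwa [le_antisymm h2 h1]⟩
    refine ⟨Nat.find hex, (Nat.find_spec hex).1, (Nat.find_spec hex).2, fun i hi e => ?_⟩
    refine Nat.find_min hex (m := i) (by omega) ⟨by have := (Nat.find_spec hex).1; omega, ?_⟩
    intro i' h1 h2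
    rcases Nat.eq_or_lt_of_le h1 with rfl | h3
    · exact hi
    · exact (Nat.find_spec hex).2 i' (by omega) h2
  obtain ⟨e, hke, heK, he⟩ : ∃ e, k < e ∧ (∀ i, k ≤ i → i < e → i ∈ K) ∧ e ∉ K := by
    have hex : ∃ e, k < e ∧ e ∉ K :=
      ⟨n + k, by have := hK k hk; omega, fun h => by have := hK _ h; omega⟩
    refine ⟨Nat.find hex, (Nat.find_spec hex).1, fun i h1 h2 => ?_, (Nat.find_spec hex).2⟩
    by_contra hi
    have hne : i ≠ k := fun e => hi (e ▸ hk)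
    exact Nat.find_min hex h2 ⟨by omega, hi⟩
  -- Removing `k` cuts the block of letters `p, …, e` into blocks of sizes `a` and `b + 1`. After
  -- their interchange the missing generator is `p + b`.
  obtain ⟨a, ha⟩ : ∃ a, p + a = k + 1 := ⟨k + 1 - p, by omega⟩
  obtain ⟨b, hb⟩ : ∃ b, p + a + (b + 1) = e + 1 := ⟨e - k - 1, by omega⟩
  have hrun : ∀ i, p ≤ i → i < e → i ∈ K := fun i h1 h2 => by
    rcases le_total i k with h | h
    exacts [hpK i h1 h, heK i h h2]
  have hen : e < n := by
    have := hK (e - 1) (hrun _ (by omega) (by omega))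
    omega
  have hS : BlocksSwapped (K \ {k}) (K \ {p + b}) n p a (b + 1) := by
    refine ⟨by omega, fun i hi => hK i hi.1, fun i hi => ?_, fun i hi => ?_, fun i hi => ?_,
      fun i hi => ?_, fun i hi => hp i hi.1, fun i hi => ?_, fun i hi hie => ?_⟩
    · simp only [Set.mem_sdiff, Set.mem_singleton_iff]
      exact and_congr_right fun _ => by omega
    · simp only [Set.mem_sdiff, Set.mem_singleton_iff]
      exact and_congr_right fun _ => by omega
    · simp only [Set.mem_sdiff, Set.mem_singleton_iff]
      by_cases h : p + i = k
      · have h2 : p + (b + 1) + i = e := by omega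
        simp [h, h2, he]
      · simp only [hrun (p + i) (by omega) (by omega),
          hrun (p + (b + 1) + i) (by omega) (by omega), true_and]
        omega
    · simp only [Set.mem_sdiff, Set.mem_singleton_iff]
      by_cases h : i = b
      · have h2 : p + a + i = e := by omega
        simp only [h2, he, false_and, false_iff, not_and, not_not]
        intro _
        omega
      · simp only [hrun (p + a + i) (by omega) (by omega),
          hrun (p + i) (by omega) (by omega), true_and]
        omega
    · have := hi.2
      simp only [Set.mem_singleton_iff] at this
      omega
    · apply he
      rw [show e = i by omega]
      exact hi.1
  -- The new block boundary is a descent of the interchange, so `T d⁻¹ * T d` contains `ξ` times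
  -- precisely the missing generator.
  have hdesc : Desc (blockSwap p a (b + 1) hS.le) (p + b) := by
    refine ⟨by omega, ?_⟩
    rw [Fin.lt_def, blockSwap_val, blockSwap_val]
    simp only
    split_ifs <;> omega
  refine ⟨blockSwap p a (b + 1) hS.le, isDistinguished_iff.2 ⟨?_, ?_⟩, ?_⟩
  · refine mem_para_of_le_iff fun m hm y => ?_
    have hm' : m < p ∨ e ≤ m := by
      by_contra h
      exact hm (hrun m (by omega) (by omega))
    rw [blockSwap_val]
    split_ifs <;> omega
  · intro j hj
    have hjn := hK j hj.1
    have hjk : j ≠ k := hj.2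
    have hje : j ≠ e := fun h => he (h ▸ hj.1)
    have hjp := hp j hj.1
    refine (asc_inv_blockSwap (j' := if p ≤ j ∧ j < k then j + (b + 1) else
      if k < j ∧ j < e then j - a else j) hS.le hjn ?_).not_desc
    unfold BlockShift
    split_ifs <;> omega
  · obtain ⟨h, hh, eh⟩ := T_inv_mul_T_of_desc hdesc
    obtain ⟨r, hr, eJ⟩ := hS.coxProd_split
    refine ⟨coxProd (K \ {p + b}) 0 p * coxProd (K \ {p + b}) p (b + 1) * h *
      coxProd (K \ {p + b}) (p + (b + 1)) a * coxProd (K \ {p + b}) (p + a + (b + 1)) r,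
      ?_, ?_⟩
    · exact mul_mem (mul_mem (mul_mem (mul_mem (coxProd_mem_posSemiring _ _ _)
        (coxProd_mem_posSemiring _ _ _)) hh) (coxProd_mem_posSemiring _ _ _))
        (coxProd_mem_posSemiring _ _ _)
    have hKc : ∀ N, N = p + (b + 1) + a + r → (coxProd K 0 N : Hecke n) = coxProd (K \ {p + b}) 0 p *
        coxProd (K \ {p + b}) p (b + 1) * g (p + b) *
        coxProd (K \ {p + b}) (p + (b + 1)) a * coxProd (K \ {p + b}) (p + a + (b + 1)) r := by
      have hpb : p + b ∈ K := hrun _ (by omega) (by omega)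
      rintro _ rfl
      rw [coxProd_add, coxProd_add, coxProd_add, zero_add, zero_add, zero_add,
        coxProd_succ_of_mem hpb, coxProd_succ_of_notMem (J := K \ {p + b}) (by simp),
        show p + (b + 1) + a = p + a + (b + 1) by omega,
        coxProd_congr (J := K) (J' := K \ {p + b}) (l := 0) (k := p),
        coxProd_congr (J := K) (J' := K \ {p + b}) (l := p) (k := b),
        coxProd_congr (J := K) (J' := K \ {p + b}) (l := p + (b + 1)) (k := a),
        coxProd_congr (J := K) (J' := K \ {p + b}) (l := p + a + (b + 1)) (k := r)]
      · simp only [mul_assoc]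
      all_goals
        intro i hi
        simp only [Set.mem_sdiff, Set.mem_singleton_iff, iff_self_and]
        intro _
        omega
    rw [T_coxPerm, T_coxPerm, hKc n (by omega), eJ]
    -- With `d` the interchange, the right block moves leftward past `T d⁻¹` and the left block
    -- rightward past `T d`. Then `T d⁻¹ * T d` stands between the shifted blocks, and its term `ξ g
    -- (p + b)` completes them to the Coxeter word of `K`.
    calc _ = T (blockSwap p a (b + 1) hS.le)⁻¹ * coxProd (K \ {k}) 0 p *
          (coxProd (K \ {k}) p a * coxProd (K \ {k}) (p + a) (b + 1)) *
          (coxProd (K \ {k}) (p + a + (b + 1)) r * T (blockSwap p a (b + 1) hS.le)) := by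
            simp only [mul_assoc]
      _ = coxProd (K \ {p + b}) 0 p *
          (T (blockSwap p a (b + 1) hS.le)⁻¹ * coxProd (K \ {k}) (p + a) (b + 1)) *
          (coxProd (K \ {k}) p a * T (blockSwap p a (b + 1) hS.le)) *
          coxProd (K \ {p + b}) (p + a + (b + 1)) r := by
            rw [← hS.low_mul_inv, hS.comm_left, hS.high_mul]
            simp only [mul_assoc]
      _ = coxProd (K \ {p + b}) 0 p * coxProd (K \ {p + b}) p (b + 1) *
          (T (blockSwap p a (b + 1) hS.le)⁻¹ * T (blockSwap p a (b + 1) hS.le)) *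
          coxProd (K \ {p + b}) (p + (b + 1)) a *
          coxProd (K \ {p + b}) (p + a + (b + 1)) r := by
            rw [← hS.right_mul_inv, hS.left_mul]
            simp only [mul_assoc]
      _ = _ := by
            rw [eh]
            simp only [mul_add, add_mul, mul_smul_comm, smul_mul_assoc]

/-! ### Coefficients of central elements -/

/-- The two coefficients are traces of `z` against `g_i T_{v⁻¹}` and `T_{v⁻¹} g_i`, which agree by
cyclicity since `z` commutes with `g_i`. -/
theorem coef_mul_sw_of_commute {z : Hecke n} {v : Equiv.Perm (Fin n)} {i : ℕ}
    (hz : g i * z = z * g i) (h1 : Asc v i) (h2 : Asc v⁻¹ i) :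
    coef (v * sw i) z = coef (sw i * v) z := by
  rw [coef_eq_coef_one, coef_eq_coef_one (sw i * v), mul_inv_rev, mul_inv_rev, sw_inv,
    T_sw_mul (by simpa using h1), T_mul_sw h2, ← mul_assoc, ← mul_assoc, ← hz, mul_assoc,
    coef_one_mul_comm]

/-- The left side is the trace of `z` against `g_i T_{u⁻¹} g_i`. Cyclicity brings the two generators
together as `g_i² = 1 + ξ g_i`. The resulting coefficients lie in `ℕ[ξ]`, which is why positivity
propagates from shorter to longer elements. -/
theorem coef_sw_mul_sw_of_commute {z : Hecke n} {u : Equiv.Perm (Fin n)} {i : ℕ}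
    (hz : g i * z = z * g i) (h1 : Asc u⁻¹ i) (h2 : Asc (sw i * u) i) :
    coef (sw i * u * sw i) z = coef u z + X * coef (sw i * u) z := by
  have e1 : (sw i * u * sw i)⁻¹ = sw i * (u⁻¹ * sw i) := by simp
  have e2 : (sw i * u)⁻¹ = u⁻¹ * sw i := by simp
  have e3 : T (sw i * (u⁻¹ * sw i)) = g i * (T u⁻¹ * g i) := by
    rw [T_sw_mul, T_mul_sw h1]
    rw [← e2, inv_inv]
    exact h2
  have e4 : coef 1 (z * (T u⁻¹ * g i)) = coef 1 (z * (g i * T u⁻¹)) := by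
    rw [← mul_assoc, coef_one_mul_comm, ← mul_assoc, hz, mul_assoc]
  have e5 : coef 1 (z * (g i * (T u⁻¹ * g i))) = coef 1 (z * (g i * g i * T u⁻¹)) := by
    rw [← mul_assoc (g i), ← mul_assoc, coef_one_mul_comm, ← mul_assoc, hz]
    simp only [mul_assoc]
  rw [coef_eq_coef_one, coef_eq_coef_one u, coef_eq_coef_one (sw i * u), e1, e2, e3, e5,
    T_mul_sw h1, e4, g_mul_self h1.lt, add_mul, one_mul, smul_mul_assoc, mul_add, mul_smul_comm,
    map_add, map_smul, smul_eq_mul]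

/-- A central element of `H_K` is positive as soon as its coefficients at the Coxeter elements of
the parabolic subgroups of `W_K` are. -/
theorem mem_posSemiring_of_commute {K : Set ℕ} {z : Hecke n} (hz : ∀ k ∈ K, g k * z = z * g k)
    (hzK : z ∈ paraAlg K)
    (hcox : ∀ J ⊆ K, (∀ j ∈ J, j + 1 < n) → coef (coxPerm J n) z ∈ polyPos) :
    z ∈ posSemiring n := by
  intro w
  by_cases hw : w ∈ para K
  · refine cyclicShift_induction (K := K) (Q := fun w => coef w z ∈ polyPos) hcox ?_ ?_ hw
    · intro u i _ hi h1 h2 hu hu'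
      rw [coef_sw_mul_sw_of_commute (hz i hi) h1 h2]
      exact add_mem hu (mul_mem X_mem_polyPos hu')
    · intro v i _ hi h1 h2 hv
      rwa [coef_mul_sw_of_commute (hz i hi) h1 h2]
  · rw [hzK w hw]
    exact zero_mem _

/-! ### The comparison of norms -/

theorem isDistinguished_one (K U : Subgroup (Equiv.Perm (Fin n))) : IsDistinguished K U 1 :=
  ⟨one_mem _, fun u _ => by rw [len_one]; exact Nat.zero_le _⟩

/-- Every summand of the norm of a positive element is positive, so each single one is a lower
bound. -/
theorem relNorm_eq_term_add {K U : Subgroup (Equiv.Perm (Fin n))} {d : Equiv.Perm (Fin n)}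
    (hd : IsDistinguished K U d) {a : Hecke n} (ha : a ∈ posSemiring n) :
    ∃ h ∈ posSemiring n, relNorm K U a = T d⁻¹ * a * T d + h := by
  classical
  refine ⟨∑ e ∈ (Finset.univ.filter (IsDistinguished K U)).erase d, T e⁻¹ * a * T e,
    sum_mem fun _ _ => mul_mem (mul_mem (T_mem_posSemiring _) ha) (T_mem_posSemiring _), ?_⟩
  rw [Finset.add_sum_erase _ (fun e => T e⁻¹ * a * T e) (by simpa using hd), relNorm]

theorem relNorm_eq_add {K U : Subgroup (Equiv.Perm (Fin n))} {a : Hecke n}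
    (ha : a ∈ posSemiring n) : ∃ h ∈ posSemiring n, relNorm K U a = a + h := by
  simpa [T_one] using relNorm_eq_term_add (isDistinguished_one K U) ha

theorem murphyProd_eq_add {J : Set ℕ} (hJ : ∀ i ∈ J, i + 1 < n) :
    ∃ h ∈ posSemiring n, (murphyProd J n : Hecke n) = T (coxPerm J n) + h := by
  rw [← relNorm_T_coxPerm hJ]
  exact relNorm_eq_add (T_mem_posSemiring _)

theorem murphyProd_mem_posSemiring {J : Set ℕ} (hJ : ∀ i ∈ J, i + 1 < n) :
    (murphyProd J n : Hecke n) ∈ posSemiring n := by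
  obtain ⟨h, hh, e⟩ := murphyProd_eq_add hJ
  rw [e]
  exact add_mem (T_mem_posSemiring _) hh

theorem murphyProd_mem_paraAlg' (J : Set ℕ) : (murphyProd J n : Hecke n) ∈ paraAlg J :=
  paraAlg_mono Set.inter_subset_left (murphyProd_mem_paraAlg J n)

theorem g_mul_murphyProd' {J : Set ℕ} (hJ : ∀ i ∈ J, i + 1 < n) :
    ∀ j ∈ J, g j * (murphyProd J n : Hecke n) = murphyProd J n * g j := fun j hj =>
  g_mul_murphyProd hJ hj (by have := hJ j hj; omega)

/-- The heart of the comparison. The difference lies in `H_K` and commutes with its generators, so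
only Coxeter elements `w_{J'}` with `J' ⊆ K` need checking. For `J' ≠ K` the subtracted term has
coefficient zero and the norm is positive anyway. -/
theorem relNorm_murphyProd_sdiff {K : Set ℕ} (hK : ∀ i ∈ K, i + 1 < n) {k : ℕ} (hk : k ∈ K) :
    ∃ h ∈ posSemiring n, relNorm (para K) (para (K \ {k})) (murphyProd (K \ {k}) n) =
      (X : ℤ[X]) • (murphyProd K n : Hecke n) + h := by
  have hJ : ∀ i ∈ K \ {k}, i + 1 < n := fun i hi => hK i hi.1
  refine ⟨relNorm (para K) (para (K \ {k})) (murphyProd (K \ {k}) n) -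
    (X : ℤ[X]) • murphyProd K n, mem_posSemiring_of_commute (K := K) ?_ ?_ ?_, by abel⟩
  · intro j hj
    rw [mul_sub, sub_mul, g_mul_relNorm (g_mul_murphyProd' hJ) hj, mul_smul_comm,
      g_mul_murphyProd' hK j hj, smul_mul_assoc]
  · exact sub_mem (relNorm_mem_paraAlg (paraAlg_mono Set.sdiff_subset (murphyProd_mem_paraAlg' _)))
      (Subalgebra.smul_mem _ (murphyProd_mem_paraAlg' K) _)
  · intro J' hJ' _
    obtain ⟨h1, h2⟩ := coef_coxPerm_murphyProd (n := n) hK hJ' n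
    rw [map_sub, map_smul]
    by_cases hJK : ∀ i ∈ K, i < n → i ∈ J'
    · obtain rfl : J' = K := Set.Subset.antisymm hJ' fun i hi =>
        hJK i hi (by have := hK i hi; omega)
      rw [h1 hJK]
      -- At `w_K` the subtracted coefficient is exactly `ξ`. The norm supplies it: the summand of
      -- `c`, applied to the term `T_{w_{K \ {k}}}` of the Murphy product, contains `ξ T_{w_K}`.
      obtain ⟨c, hc, a, ha, ea⟩ := exists_distinguished_conj hK hk
      obtain ⟨b, hb, eb⟩ := relNorm_eq_term_add hc (murphyProd_mem_posSemiring hJ)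
      obtain ⟨e, he, ee⟩ := murphyProd_eq_add hJ
      have hpos := (add_mem (add_mem ha (mul_mem (mul_mem (T_mem_posSemiring c⁻¹) he)
        (T_mem_posSemiring c))) hb) (coxPerm J' n)
      have e3 : relNorm (para J') (para (J' \ {k})) (murphyProd (J' \ {k}) n) =
          (X : ℤ[X]) • T (coxPerm J' n) + (a + T c⁻¹ * e * T c + b) := by
        rw [eb, ee, mul_add, add_mul, ea]
        abel
      rw [e3, map_add, map_smul, coef_T, if_pos rfl, add_sub_cancel_left]
      exact hpos
    · rw [h2 hJK, smul_zero, sub_zero]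
      exact relNorm_mem_posSemiring _ _ (murphyProd_mem_posSemiring hJ) _

/-- The norm from `W_J` to the whole group of the product of the Jucys–Murphy elements. -/
noncomputable def normMurphy (n : ℕ) (J : Set ℕ) : Hecke n :=
  relNorm (para Set.univ) (para J) (murphyProd J n)

theorem normMurphy_mem_posSemiring {J : Set ℕ} (hJ : ∀ i ∈ J, i + 1 < n) :
    normMurphy n J ∈ posSemiring n :=
  relNorm_mem_posSemiring _ _ (murphyProd_mem_posSemiring hJ)

theorem g_mul_normMurphy {J : Set ℕ} (hJ : ∀ i ∈ J, i + 1 < n) (k : ℕ) :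
    g k * normMurphy n J = normMurphy n J * g k :=
  g_mul_relNorm (g_mul_murphyProd' hJ) (Set.mem_univ k)

/-- The one-step comparison inside `W_K` is normed up to the whole group, using transitivity and the
positivity and linearity of norms. -/
theorem normMurphy_sdiff {K : Set ℕ} (hK : ∀ i ∈ K, i + 1 < n) {k : ℕ} (hk : k ∈ K) :
    ∃ h ∈ posSemiring n, normMurphy n (K \ {k}) = (X : ℤ[X]) • normMurphy n K + h := by
  obtain ⟨h, hh, e⟩ := relNorm_murphyProd_sdiff hK hk
  refine ⟨_, relNorm_mem_posSemiring (para Set.univ) (para K) hh, ?_⟩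
  rw [normMurphy, ← relNorm_relNorm Set.sdiff_subset (Set.subset_univ K), e, relNorm_add,
    relNorm_smul, normMurphy]

theorem normMurphy_of_subset {J K : Set ℕ} (hK : ∀ i ∈ K, i + 1 < n) (hJK : J ⊆ K) :
    ∃ h ∈ posSemiring n,
      normMurphy n J = (X : ℤ[X]) ^ (K \ J).ncard • normMurphy n K + h := by
  have hfin : K.Finite := (Set.finite_lt_nat n).subset fun i hi => by
    have := hK i hi
    simp only [Set.mem_ofPred_eq]
    omega
  induction hN : (K \ J).ncard generalizing K with
  | zero =>
    have : K \ J = ∅ := (Set.ncard_eq_zero (hfin.subset Set.sdiff_subset)).1 hN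
    obtain rfl : J = K := Set.Subset.antisymm hJK (Set.sdiff_eq_empty.1 this)
    exact ⟨0, zero_mem _, by simp⟩
  | succ N ih =>
    obtain ⟨k, hk⟩ : (K \ J).Nonempty := by
      rw [← Set.ncard_pos (hfin.subset Set.sdiff_subset)]
      omega
    have hJK' : J ⊆ K \ {k} := fun j hj => ⟨hJK hj, fun e => hk.2 (by
      rw [Set.mem_singleton_iff] at e; rwa [← e])⟩
    have hcard : ((K \ {k}) \ J).ncard = N := by
      have : (K \ {k}) \ J = (K \ J) \ {k} := by
        ext i; simp only [Set.mem_sdiff, Set.mem_singleton_iff]; tauto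
      rw [this, Set.ncard_sdiff_singleton_of_mem hk, hN, Nat.add_sub_cancel]
    obtain ⟨h, hh, e⟩ := ih (fun i hi => hK i hi.1) hJK' (hfin.subset Set.sdiff_subset) hcard
    obtain ⟨h', hh', e'⟩ := normMurphy_sdiff hK hk.1
    refine ⟨(X : ℤ[X]) ^ N • h' + h, add_mem (smul_mem_posSemiring
      (pow_mem X_mem_polyPos N) hh') hh, ?_⟩
    rw [e, e', smul_add, smul_smul, pow_succ, add_assoc]

/-! ### Norms at `ξ = 0` -/

theorem eval_nonneg_of_mem_polyPos {p : ℤ[X]} (hp : p ∈ polyPos) : 0 ≤ p.eval 0 := by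
  rw [← coeff_zero_eq_eval_zero]
  exact hp 0

/-- The identity representatives in both norms contribute `T_{w_J}` itself, and nothing negative can
cancel it. -/
theorem eval_coef_normMurphy_pos {J : Set ℕ} (hJ : ∀ i ∈ J, i + 1 < n) :
    0 < (coef (coxPerm J n) (normMurphy n J)).eval 0 := by
  obtain ⟨a, ha, ea⟩ := murphyProd_eq_add hJ
  obtain ⟨b, hb, eb⟩ := relNorm_eq_add (K := para Set.univ) (U := para J)
    (murphyProd_mem_posSemiring hJ)
  rw [normMurphy, eb, ea, map_add, map_add, coef_T, if_pos rfl, eval_add, eval_add, eval_one]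
  have := eval_nonneg_of_mem_polyPos (ha (coxPerm J n))
  have := eval_nonneg_of_mem_polyPos (hb (coxPerm J n))
  omega

/-- At `ξ = 0` a norm is a sum of conjugates in the group ring, so the support stays within the same
conjugacy classes. -/
theorem eval_coef_relNorm_eq_zero {K U : Subgroup (Equiv.Perm (Fin n))} {a : Hecke n}
    {v : Equiv.Perm (Fin n)} (ha : ∀ w, IsConj w v → (coef w a).eval 0 = 0) :
    (coef v (relNorm K U a)).eval 0 = 0 := by
  classical
  rw [relNorm, map_sum, eval_finsetSum]
  refine Finset.sum_eq_zero fun d _ => ?_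
  rw [eval_coef_mul_T, eval_coef_T_mul, inv_inv]
  exact ha _ (isConj_iff.2 ⟨d⁻¹, by group⟩)

theorem eval_coef_normMurphy_eq_zero {J : Set ℕ} (hJ : ∀ i ∈ J, i + 1 < n)
    {v : Equiv.Perm (Fin n)} (hv : ¬ IsConj v (coxPerm J n)) :
    (coef v (normMurphy n J)).eval 0 = 0 := by
  refine eval_coef_relNorm_eq_zero fun w hw => ?_
  rw [← relNorm_T_coxPerm hJ]
  refine eval_coef_relNorm_eq_zero fun u hu => ?_
  rw [coef_T, if_neg, eval_zero]
  rintro rfl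
  exact hv (hu.trans hw).symm

/-! ### Compositions and sets of simple reflections -/

/-- The partial sums of a list. -/
def cuts (l : List ℕ) : Set ℕ := {s | ∃ k, (l.take k).sum = s}

theorem zero_mem_cuts (l : List ℕ) : 0 ∈ cuts l := ⟨0, by simp⟩

theorem sum_mem_cuts (l : List ℕ) : l.sum ∈ cuts l := ⟨l.length, by simp⟩

theorem le_sum_of_mem_cuts {l : List ℕ} {s : ℕ} (h : s ∈ cuts l) : s ≤ l.sum := by
  obtain ⟨k, rfl⟩ := h
  conv_rhs => rw [← List.take_append_drop k l, List.sum_append]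
  omega

theorem mem_cuts_append {l l' : List ℕ} {s : ℕ} :
    s ∈ cuts (l ++ l') ↔ s ∈ cuts l ∨ ∃ t ∈ cuts l', s = l.sum + t := by
  constructor
  · rintro ⟨k, rfl⟩
    rw [List.take_append, List.sum_append]
    rcases le_total k l.length with h | h
    · left
      exact ⟨k, by rw [Nat.sub_eq_zero_of_le h]; simp⟩
    · right
      exact ⟨_, ⟨k - l.length, rfl⟩, by rw [List.take_of_length_le h]⟩
  · rintro (⟨k, rfl⟩ | ⟨_, ⟨k, rfl⟩, rfl⟩)
    · refine ⟨min k l.length, ?_⟩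
      rw [List.take_append_of_le_length (min_le_right _ _), ← List.take_take, List.take_length]
    · exact ⟨l.length + k, by rw [List.take_length_add_append, List.sum_append]⟩

theorem cuts_nil {s : ℕ} : s ∈ cuts [] ↔ s = 0 := by
  simp [cuts, eq_comm]

theorem mem_cuts_singleton {a s : ℕ} : s ∈ cuts [a] ↔ s = 0 ∨ s = a := by
  constructor
  · rintro ⟨k, rfl⟩
    rcases k with _ | k
    · simp
    · simp
  · rintro (rfl | rfl)
    · exact zero_mem_cuts _
    · simpa using sum_mem_cuts [s]

theorem mem_cuts_cons {a : ℕ} {l : List ℕ} {s : ℕ} :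
    s ∈ cuts (a :: l) ↔ s = 0 ∨ ∃ t ∈ cuts l, s = a + t := by
  rw [← List.singleton_append, mem_cuts_append, mem_cuts_singleton, List.sum_singleton]
  constructor
  · rintro ((h | h) | h)
    · exact Or.inl h
    · exact Or.inr ⟨0, zero_mem_cuts l, h⟩
    · exact Or.inr h
  · rintro (h | h)
    · exact Or.inl (Or.inl h)
    · exact Or.inr h

/-- The simple reflections in the parabolic subgroup of a composition. -/
def inner (l : List ℕ) : Set ℕ := {i | i + 1 < l.sum ∧ i + 1 ∉ cuts l}

theorem lt_of_mem_inner (ν : Composition n) : ∀ i ∈ inner ν.blocks, i + 1 < n := fun i hi => by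
  have := hi.1
  rwa [ν.blocks_sum] at this

theorem isInner_iff (ν : Composition n) (i : Fin (n - 1)) :
    IsInner ν i ↔ (i : ℕ) ∈ inner ν.blocks := by
  constructor
  · rintro ⟨k, h1, h2⟩
    refine ⟨by rw [ν.blocks_sum]; omega, ?_⟩
    rintro ⟨m, hm⟩
    change ν.sizeUpTo m = _ at hm
    rcases Nat.lt_or_ge k m with h | h
    · have := ν.monotone_sizeUpTo (show k + 1 ≤ m from h)
      omega
    · have := ν.monotone_sizeUpTo h
      omega
  · rintro ⟨-, h⟩
    let j : Fin n := ⟨i + 1, by omega⟩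
    refine ⟨ν.index j, lt_of_le_of_ne (ν.sizeUpTo_index_le j) fun e => h ⟨_, e⟩,
      ν.lt_sizeUpTo_index_succ j⟩

theorem parabolic_eq_para (ν : Composition n) : parabolic ν = para (inner ν.blocks) := by
  unfold parabolic para
  congr 1
  ext s
  constructor
  · rintro ⟨i, hi, rfl⟩
    exact ⟨i, (isInner_iff ν i).1 hi, simpleRefl_eq_sw i⟩
  · rintro ⟨i, hi, rfl⟩
    have := lt_of_mem_inner ν i hi
    exact ⟨⟨i, by omega⟩, (isInner_iff ν _).2 hi, (simpleRefl_eq_sw (n := n) ⟨i, by omega⟩).symm⟩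

/-- Replacing `k > 1` by `k - 1, 1` adds the point just before the end of that component; for a
component `1` this point is already a cut. -/
theorem mem_cuts_subOne {l : List ℕ} (hl : ∀ x ∈ l, 0 < x) {s : ℕ} :
    s ∈ cuts (l.flatMap fun k => if 1 < k then [k - 1, 1] else [k]) ↔
      s ∈ cuts l ∨ s + 1 ∈ cuts l := by
  induction l generalizing s with
  | nil => simp [cuts_nil]
  | cons a l ih =>
    have ha : 0 < a := hl a (by simp)
    have ih' := fun s => @ih (fun x hx => hl x (by simp [hx])) s
    have hR : (s ∈ cuts (a :: l) ∨ s + 1 ∈ cuts (a :: l)) ↔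
        s = 0 ∨ s + 1 = a ∨ ∃ t, (t ∈ cuts l ∨ t + 1 ∈ cuts l) ∧ s = a + t := by
      rw [mem_cuts_cons, mem_cuts_cons]
      constructor
      · rintro ((h | ⟨t, ht, h⟩) | (h | ⟨t, ht, h⟩))
        · exact Or.inl h
        · exact Or.inr (Or.inr ⟨t, Or.inl ht, h⟩)
        · omega
        · rcases t with _ | t
          · exact Or.inr (Or.inl h)
          · exact Or.inr (Or.inr ⟨t, Or.inr ht, by omega⟩)
      · rintro (h | h | ⟨t, ht | ht, h⟩)
        · exact Or.inl (Or.inl h)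
        · exact Or.inr (Or.inr ⟨0, zero_mem_cuts l, h⟩)
        · exact Or.inl (Or.inr ⟨t, ht, h⟩)
        · exact Or.inr (Or.inr ⟨t + 1, ht, by omega⟩)
    rw [List.flatMap_cons, hR]
    split_ifs with h1
    · simp only [List.cons_append, List.nil_append, mem_cuts_cons, ih']
      constructor
      · rintro (h | ⟨t, ht | ⟨u, hu, rfl⟩, h⟩)
        · exact Or.inl h
        · exact Or.inr (Or.inl (by omega))
        · exact Or.inr (Or.inr ⟨u, hu, by omega⟩)
      · rintro (h | h | ⟨u, hu, h⟩)
        · exact Or.inl h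
        · exact Or.inr ⟨0, Or.inl rfl, by omega⟩
        · exact Or.inr ⟨1 + u, Or.inr ⟨u, hu, rfl⟩, by omega⟩
    · obtain rfl : a = 1 := by omega
      simp only [List.cons_append, List.nil_append, mem_cuts_cons, ih']
      constructor
      · rintro (h | h)
        exacts [Or.inl h, Or.inr (Or.inr h)]
      · rintro (h | h | h)
        exacts [Or.inl h, Or.inl (by omega), Or.inr h]

/-- Passing to `λ - 1` drops the last generator of each block: `s_i` survives exactly when `s_{i+1}`
also belongs to `S_λ`. -/
theorem inner_subOne (ν : Composition n) :
    inner (subOne ν).blocks = shrink (inner ν.blocks) n := by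
  ext i
  simp only [inner, shrink, Set.mem_ofPred_eq, Composition.blocks_sum]
  have h := mem_cuts_subOne (fun x hx => ν.blocks_pos hx) (s := i + 1)
  have hn := sum_mem_cuts ν.blocks
  rw [ν.blocks_sum] at hn
  change i + 1 < n ∧ i + 1 ∉ cuts (ν.blocks.flatMap fun k => if 1 < k then [k - 1, 1] else [k]) ↔ _
  rw [h]
  constructor
  · rintro ⟨h1, h2⟩
    push Not at h2
    have : i + 1 + 1 ≠ n := fun e => h2.2 (e ▸ hn)
    exact ⟨⟨h1, h2.1⟩, ⟨by omega, h2.2⟩, h1⟩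
  · rintro ⟨⟨h1, h2⟩, ⟨h3, h4⟩, _⟩
    exact ⟨h1, by tauto⟩

open Classical in
theorem coxPerm_eq_prod (J : Set ℕ) (m : ℕ) :
    (coxPerm J m : Equiv.Perm (Fin n)) = (((List.range m).filter (· ∈ J)).map sw).prod := by
  induction m with
  | zero => rfl
  | succ m ih =>
    rw [List.range_succ, List.filter_append, List.map_append, List.prod_append, ← ih]
    by_cases h : m ∈ J
    · rw [coxPerm_succ_of_mem h]
      simp [h]
    · rw [coxPerm_succ_of_notMem h]
      simp [h]

theorem coxeterElt_eq (ν : Composition n) : coxeterElt ν = coxPerm (inner ν.blocks) n := by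
  classical
  have h1 : (coxPerm (inner ν.blocks) n : Equiv.Perm (Fin n)) =
      coxPerm (inner ν.blocks) (n - 1) := by
    rcases n with _ | n
    · rfl
    · exact coxPerm_succ_of_notMem fun h => by
        have := lt_of_mem_inner ν n h; omega
  have h2 : (List.range (n - 1)) = (List.finRange (n - 1)).map Fin.val :=
    List.map_coe_finRange_eq_range.symm
  rw [h1, coxPerm_eq_prod, h2, List.filter_map, List.map_map, coxeterElt, wordProd]
  congr 1
  have h3 : (simpleRefl : Fin (n - 1) → Equiv.Perm (Fin n)) = sw ∘ Fin.val :=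
    funext simpleRefl_eq_sw
  rw [h3]
  congr 1
  refine List.filter_congr fun i _ => ?_
  simp [isInner_iff]

theorem normElt_eq (ν : Composition n) : normElt ν = normMurphy n (inner ν.blocks) := by
  rw [normElt, eta, parabolic_eq_para, parabolic_eq_para, inner_subOne, coxeterElt_eq, normMurphy,
    para_univ, ← relNorm_T_coxPerm (lt_of_mem_inner ν), para_empty]

theorem len_coxPerm {J : Set ℕ} (hJ : ∀ i ∈ J, i + 1 < n) (m : ℕ) :
    len (coxPerm J m : Equiv.Perm (Fin n)) = (J ∩ {i | i < m}).ncard := by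
  have hfin : ∀ m, (J ∩ {i | i < m}).Finite := fun m =>
    (Set.finite_lt_nat m).subset Set.inter_subset_right
  induction m with
  | zero =>
    have : J ∩ {i | i < 0} = ∅ := by ext; simp
    rw [this, Set.ncard_empty]
    exact len_one
  | succ m ih =>
    have hnot : m ∉ J ∩ {i | i < m} := fun h => lt_irrefl m h.2
    by_cases h : m ∈ J
    · have e : J ∩ {i | i < m + 1} = insert m (J ∩ {i | i < m}) := by
        ext i
        simp only [Set.mem_inter_iff, Set.mem_ofPred_eq, Set.mem_insert_iff]
        constructor
        · rintro ⟨h1, h2⟩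
          by_cases e : i = m
          · exact Or.inl e
          · exact Or.inr ⟨h1, by omega⟩
        · rintro (rfl | ⟨h1, h2⟩)
          · exact ⟨h, Nat.lt_succ_self _⟩
          · exact ⟨h1, by omega⟩
      rw [coxPerm_succ_of_mem h, e, Set.ncard_insert_of_notMem hnot (hfin m), ← ih]
      exact (asc_of_mem_para (coxPerm_mem_para J m) hnot (hJ m h)).len_mul_sw
    · have e : J ∩ {i | i < m + 1} = J ∩ {i | i < m} := by
        ext i
        simp only [Set.mem_inter_iff, Set.mem_ofPred_eq]
        refine and_congr_right fun hi => ?_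
        have : i ≠ m := fun e => h (e ▸ hi)
        omega
      rw [coxPerm_succ_of_notMem h, e, ih]

theorem finite_inner (ν : Composition n) : (inner ν.blocks).Finite :=
  (Set.finite_lt_nat n).subset fun i hi => by
    have := lt_of_mem_inner ν i hi
    simp only [Set.mem_ofPred_eq]
    omega

theorem minLen_eq (ν : Composition n) : minLen ν = (inner ν.blocks).ncard := by
  rw [minLen, coxeterElt_eq, len_coxPerm (lt_of_mem_inner ν)]
  congr 1
  refine Set.inter_eq_left.2 fun i hi => ?_
  have := lt_of_mem_inner ν i hi
  simp only [Set.mem_ofPred_eq]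
  omega

theorem cuts_map_sum_subset (L : List (List ℕ)) : cuts (L.map List.sum) ⊆ cuts L.flatten := by
  induction L with
  | nil => exact le_rfl
  | cons a L ih =>
    intro s hs
    rw [List.map_cons, mem_cuts_cons] at hs
    rw [List.flatten_cons, mem_cuts_append]
    rcases hs with rfl | ⟨t, ht, rfl⟩
    · exact Or.inl (zero_mem_cuts a)
    · exact Or.inr ⟨t, ih ht, rfl⟩

theorem Refines.inner_subset {μ ν : Composition n} (h : Refines μ ν) :
    inner μ.blocks ⊆ inner ν.blocks := by
  obtain ⟨L, h1, h2⟩ := h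
  rintro i ⟨hi, hc⟩
  refine ⟨by rw [ν.blocks_sum, ← μ.blocks_sum]; exact hi, fun h => hc ?_⟩
  rw [← h1]
  rw [← h2] at h
  exact cuts_map_sum_subset L h

theorem cuts_injective {l l' : List ℕ} (hl : ∀ x ∈ l, 0 < x) (hl' : ∀ x ∈ l', 0 < x)
    (h : ∀ s, s ∈ cuts l ↔ s ∈ cuts l') : l = l' := by
  induction l generalizing l' with
  | nil =>
    rcases l' with _ | ⟨a, l'⟩
    · rfl
    · have := (h a).2 (mem_cuts_cons.2 (Or.inr ⟨0, zero_mem_cuts _, rfl⟩))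
      rw [cuts_nil] at this
      have := hl' a (by simp)
      omega
  | cons a l ih =>
    rcases l' with _ | ⟨b, l'⟩
    · have := (h a).1 (mem_cuts_cons.2 (Or.inr ⟨0, zero_mem_cuts _, rfl⟩))
      rw [cuts_nil] at this
      have := hl a (by simp)
      omega
    · have ha := hl a (by simp)
      have hb := hl' b (by simp)
      have h1 := mem_cuts_cons.1 ((h a).1 (mem_cuts_cons.2 (Or.inr ⟨0, zero_mem_cuts _, rfl⟩)))
      have h2 := mem_cuts_cons.1 ((h b).2 (mem_cuts_cons.2 (Or.inr ⟨0, zero_mem_cuts _, rfl⟩)))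
      obtain rfl : a = b := by
        rcases h1 with h1 | ⟨t, _, h1⟩ <;> rcases h2 with h2 | ⟨u, _, h2⟩ <;> omega
      congr 1
      refine ih (fun x hx => hl x (by simp [hx])) (fun x hx => hl' x (by simp [hx])) fun s => ?_
      have hs := h (a + s)
      rw [mem_cuts_cons, mem_cuts_cons] at hs
      have e : ∀ m : List ℕ, (a + s = 0 ∨ ∃ t ∈ cuts m, a + s = a + t) ↔ s ∈ cuts m := by
        intro m
        constructor
        · rintro (h | ⟨t, ht, h⟩)
          · omega
          · obtain rfl : s = t := by omega
            exact ht
        · exact fun h => Or.inr ⟨s, h, rfl⟩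
      rwa [e, e] at hs

theorem inner_injective {μ ν : Composition n} (h : inner μ.blocks = inner ν.blocks) : μ = ν := by
  refine Composition.ext (cuts_injective (fun x hx => μ.blocks_pos hx)
    (fun x hx => ν.blocks_pos hx) fun s => ?_)
  have hμ := sum_mem_cuts μ.blocks
  have hν := sum_mem_cuts ν.blocks
  rw [Composition.blocks_sum] at hμ hν
  rcases s with _ | s
  · exact ⟨fun _ => zero_mem_cuts _, fun _ => zero_mem_cuts _⟩
  · rcases lt_trichotomy (s + 1) n with hs | hs | hs
    · have := Set.ext_iff.1 h s
      simp only [inner, Set.mem_ofPred_eq, Composition.blocks_sum, hs, true_and] at this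
      exact not_iff_not.1 this
    · rw [hs]
      exact ⟨fun _ => hν, fun _ => hμ⟩
    · constructor <;> intro h <;> have := le_sum_of_mem_cuts h <;>
        rw [Composition.blocks_sum] at this <;> omega

/-- An injective map from the `2^(n-1)` compositions to the subsets of an `(n-1)`-element set is
onto. -/
theorem exists_inner_eq {J : Set ℕ} (hJ : ∀ i ∈ J, i + 1 < n) :
    ∃ ν : Composition n, inner ν.blocks = J := by
  classical
  let f : Composition n → Set (Fin (n - 1)) := fun ν => {i | (i : ℕ) ∈ inner ν.blocks}
  have hf : Function.Injective f := by
    intro μ ν h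
    apply inner_injective
    ext i
    by_cases hi : i + 1 < n
    · have := Set.ext_iff.1 h ⟨i, by omega⟩
      simpa [f] using this
    · exact ⟨fun h => absurd (lt_of_mem_inner μ i h) hi, fun h => absurd (lt_of_mem_inner ν i h) hi⟩
  have hb : Function.Bijective f := by
    rw [Fintype.bijective_iff_injective_and_card]
    refine ⟨hf, ?_⟩
    rw [composition_card, Fintype.card_set, Fintype.card_fin]
  obtain ⟨ν, hν⟩ := hb.2 {i | (i : ℕ) ∈ J}
  refine ⟨ν, ?_⟩
  ext i
  by_cases hi : i + 1 < n
  · have := Set.ext_iff.1 hν ⟨i, by omega⟩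
    simpa [f] using this
  · exact ⟨fun h => absurd (lt_of_mem_inner ν i h) hi, fun h => absurd (hJ i h) hi⟩

/-! ### Rearranging the blocks of a composition -/

theorem mem_cuts_append_cons_cons {l l' : List ℕ} {a b s : ℕ} :
    s ∈ cuts (l ++ a :: b :: l') ↔
      s ∈ cuts l ∨ s = l.sum + a ∨ ∃ u ∈ cuts l', s = l.sum + a + b + u := by
  simp only [mem_cuts_append, mem_cuts_cons]
  constructor
  · rintro (h | ⟨t, rfl | ⟨u, rfl | ⟨v, hv, rfl⟩, rfl⟩, rfl⟩)
    · exact Or.inl h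
    · exact Or.inl (sum_mem_cuts l)
    · exact Or.inr (Or.inl rfl)
    · exact Or.inr (Or.inr ⟨v, hv, by omega⟩)
  · rintro (h | rfl | ⟨u, hu, rfl⟩)
    · exact Or.inl h
    · exact Or.inr ⟨a, Or.inr ⟨0, Or.inl rfl, rfl⟩, rfl⟩
    · exact Or.inr ⟨a + (b + u), Or.inr ⟨b + u, Or.inr ⟨u, hu, rfl⟩, rfl⟩, by omega⟩

theorem blocksSwapped_inner {l l' : List ℕ} {a b : ℕ} (ha : 0 < a) (hb : 0 < b)
    (hn : (l ++ a :: b :: l').sum = n) :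
    BlocksSwapped (inner (l ++ a :: b :: l')) (inner (l ++ b :: a :: l')) n l.sum a b := by
  have hn' : (l ++ b :: a :: l').sum = n := by
    rw [← hn]
    simp only [List.sum_append, List.sum_cons]
    omega
  have hsum := hn
  simp only [List.sum_append, List.sum_cons] at hsum
  have hl : ∀ s ∈ cuts l, s ≤ l.sum := fun s hs => le_sum_of_mem_cuts hs
  have hl0 := sum_mem_cuts l
  have hl0' := zero_mem_cuts l'
  have memJ : ∀ i, i ∈ inner (l ++ a :: b :: l') ↔ i + 1 < n ∧ i + 1 ∉ cuts l ∧
      i + 1 ≠ l.sum + a ∧ ∀ u ∈ cuts l', i + 1 ≠ l.sum + a + b + u := by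
    intro i
    simp only [inner, Set.mem_ofPred_eq, hn, mem_cuts_append_cons_cons, not_or, not_exists, not_and,
      ne_eq]
  have memJ' : ∀ i, i ∈ inner (l ++ b :: a :: l') ↔ i + 1 < n ∧ i + 1 ∉ cuts l ∧
      i + 1 ≠ l.sum + b ∧ ∀ u ∈ cuts l', i + 1 ≠ l.sum + b + a + u := by
    intro i
    simp only [inner, Set.mem_ofPred_eq, hn', mem_cuts_append_cons_cons, not_or, not_exists, not_and,
      ne_eq]
  refine ⟨by omega, fun i hi => ((memJ i).1 hi).1, fun i hi => ?_, fun i hi => ?_, fun i hi => ?_,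
    fun i hi => ?_, fun i hi e => ?_, fun i hi e => ?_, fun i hi e => ?_⟩
  · rw [memJ, memJ']
    constructor
    · rintro ⟨h1, h2, -, -⟩
      exact ⟨h1, h2, by omega, fun u _ => by omega⟩
    · rintro ⟨h1, h2, -, -⟩
      exact ⟨h1, h2, by omega, fun u _ => by omega⟩
  · rw [memJ, memJ']
    have hc : l.sum + b + a = l.sum + a + b := by omega
    constructor
    · rintro ⟨h1, h2, -, h3⟩
      exact ⟨h1, h2, by omega, fun u hu => by rw [hc]; exact h3 u hu⟩
    · rintro ⟨h1, h2, -, h3⟩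
      exact ⟨h1, h2, by omega, fun u hu => by rw [← hc]; exact h3 u hu⟩
  · rw [memJ, memJ']
    constructor
    · rintro ⟨h1, h2, h3, -⟩
      exact ⟨by omega, fun h => by have := hl _ h; omega, by omega, fun u _ => by omega⟩
    · rintro ⟨h1, h2, h3, h4⟩
      have := h4 0 hl0'
      exact ⟨by omega, fun h => by have := hl _ h; omega, by omega, fun u _ => by omega⟩
  · rw [memJ, memJ']
    constructor
    · rintro ⟨h1, h2, h3, h4⟩
      have := h4 0 hl0'
      exact ⟨by omega, fun h => by have := hl _ h; omega, by omega, fun u _ => by omega⟩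
    · rintro ⟨h1, h2, h3, -⟩
      exact ⟨by omega, fun h => by have := hl _ h; omega, by omega, fun u _ => by omega⟩
  · exact ((memJ i).1 hi).2.1 (by rwa [e])
  · exact ((memJ i).1 hi).2.2.1 e
  · exact ((memJ i).1 hi).2.2.2 0 hl0' e

/-- A transitive relation that holds whenever two adjacent blocks are interchanged holds between
any two compositions with the same underlying partition. -/
theorem rel_inner_of_perm {R : Set ℕ → Set ℕ → Prop} (hrefl : ∀ J, R J J)
    (htrans : ∀ J J' J'', R J J' → R J' J'' → R J J'')
    (hswap : ∀ J J' p a b, BlocksSwapped J J' n p a b → R J J')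
    {l l' : List ℕ} (h : l.Perm l') (hpos : ∀ x ∈ l, 0 < x) (l₀ : List ℕ)
    (hn : (l₀ ++ l).sum = n) : R (inner (l₀ ++ l)) (inner (l₀ ++ l')) := by
  induction h generalizing l₀ with
  | nil => exact hrefl _
  | cons a _ ih =>
    have := ih (fun x hx => hpos x (by simp [hx])) (l₀ ++ [a]) (by simpa using hn)
    simpa using this
  | swap a b l =>
    exact hswap _ _ _ _ _ (blocksSwapped_inner (hpos b (by simp)) (hpos a (by simp)) hn)
  | trans h1 h2 ih1 ih2 =>
    refine htrans _ _ _ (ih1 hpos l₀ hn) (ih2 (fun x hx => hpos x (h1.mem_iff.2 hx)) l₀ ?_)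
    rw [← hn, List.sum_append, List.sum_append, h1.sum_eq]

/-! ### The anti-automorphism fixing the generators -/

/-- The anti-automorphism of the Hecke algebra fixing the generators. -/
noncomputable def antiAut (n : ℕ) : Hecke n →ₐ[ℤ[X]] (Hecke n)ᵐᵒᵖ :=
  RingQuot.liftAlgHom ℤ[X] ⟨FreeAlgebra.lift ℤ[X] fun i => MulOpposite.op (gen i), by
    intro x y h
    induction h with
    | comm i j h =>
      simp only [map_mul, FreeAlgebra.lift_ι_apply, ← MulOpposite.op_mul, gen_eq_g]
      rw [g_comm h]
    | braid i j h =>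
      simp only [map_mul, FreeAlgebra.lift_ι_apply, ← MulOpposite.op_mul, gen_eq_g, h]
      rw [← mul_assoc, ← mul_assoc, g_braid (by omega)]
    | quad i =>
      simp only [map_mul, map_add, map_one, map_smul, FreeAlgebra.lift_ι_apply,
        ← MulOpposite.op_mul, gen_eq_g]
      rw [g_mul_self (by omega), MulOpposite.op_add, MulOpposite.op_one, MulOpposite.op_smul]⟩

theorem antiAut_g (i : ℕ) : antiAut n (g i) = MulOpposite.op (g i) := by
  by_cases hi : i + 1 < n
  · rw [g, dif_pos hi]
    refine (RingQuot.liftAlgHom_mkAlgHom_apply _ _ _ _).trans ?_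
    rw [FreeAlgebra.lift_ι_apply]
  · rw [g, dif_neg hi, map_one, MulOpposite.op_one]

theorem antiAut_T (w : Equiv.Perm (Fin n)) : antiAut n (T w) = MulOpposite.op (T w⁻¹) := by
  refine perm_induction_right (P := fun w => antiAut n (T w) = MulOpposite.op (T w⁻¹)) ?_ ?_ w
  · rw [T_one, inv_one, T_one, map_one, MulOpposite.op_one]
  · intro u i h ih
    rw [T_mul_sw h, map_mul, ih, antiAut_g, ← MulOpposite.op_mul, mul_inv_rev, sw_inv,
      T_sw_mul (by simpa using h)]

/-- The anti-automorphism sends `T w` to `T w⁻¹`. The inverses are needed because `coef w` is the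
trace against `T w⁻¹`. -/
theorem T_inv_mul_T_inv_of_mul {a b c d : Equiv.Perm (Fin n)} (h : T a * T b = T c * T d) :
    T b⁻¹ * T a⁻¹ = T d⁻¹ * T c⁻¹ := by
  have := congrArg (antiAut n) h
  simpa only [map_mul, antiAut_T, ← MulOpposite.op_mul, MulOpposite.op_inj] using this

theorem isUnit_g (i : ℕ) : IsUnit (g i : Hecke n) := by
  by_cases hi : i + 1 < n
  · refine isUnit_iff_exists.2 ⟨g i - (X : ℤ[X]) • 1, ?_, ?_⟩
    · rw [mul_sub, g_mul_self hi, mul_smul_comm, mul_one, add_sub_cancel_right]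
    · rw [sub_mul, g_mul_self hi, smul_mul_assoc, one_mul, add_sub_cancel_right]
  · rw [g, dif_neg hi]
    exact isUnit_one

theorem isUnit_T (w : Equiv.Perm (Fin n)) : IsUnit (T w) := by
  refine perm_induction_right (P := fun w => IsUnit (T w)) ?_ ?_ w
  · rw [T_one]
    exact isUnit_one
  · intro u i h ih
    rw [T_mul_sw h]
    exact ih.mul (isUnit_g i)

/-! ### Central elements -/

theorem T_mul_comm_of_commute {z : Hecke n} (hz : ∀ k, g k * z = z * g k)
    (w : Equiv.Perm (Fin n)) : T w * z = z * T w :=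
  commute_T_of_commute_g (J := Set.univ) (fun j _ => hz j) (by rw [para_univ]; trivial)

theorem mem_center_iff {z : Hecke n} :
    z ∈ Subalgebra.center ℤ[X] (Hecke n) ↔ ∀ k, g k * z = z * g k := by
  rw [Subalgebra.mem_center_iff]
  refine ⟨fun h k => h _, fun h a => ?_⟩
  rw [← sum_coef a, Finset.sum_mul, Finset.mul_sum]
  refine Finset.sum_congr rfl fun w _ => ?_
  rw [smul_mul_assoc, mul_smul_comm, T_mul_comm_of_commute h]

/-- The relation makes `T w⁻¹` and `T v⁻¹` conjugate under the unit `T c⁻¹`, and the trace of a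
central `z` against conjugate elements is the same. -/
theorem coef_eq_of_T_mul_eq {z : Hecke n} (hz : ∀ k, g k * z = z * g k)
    {w v c : Equiv.Perm (Fin n)} (h : T w * T c = T c * T v) : coef w z = coef v z := by
  obtain ⟨U, h1, h2⟩ := isUnit_iff_exists.1 (isUnit_T c⁻¹)
  have e : T w⁻¹ = U * (T v⁻¹ * T c⁻¹) := by
    rw [← T_inv_mul_T_inv_of_mul h, ← mul_assoc, h2, one_mul]
  rw [coef_eq_coef_one w, coef_eq_coef_one v, e, coef_one_mul_comm, mul_assoc, coef_one_mul_comm,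
    mul_assoc, mul_assoc, ← mul_assoc (T c⁻¹), T_mul_comm_of_commute hz, mul_assoc z, h1, mul_one,
    coef_one_mul_comm]

theorem eval_coef_eq_of_isConj {z : Hecke n} (hz : ∀ k, g k * z = z * g k)
    {w v : Equiv.Perm (Fin n)} (h : IsConj w v) : (coef w z).eval 0 = (coef v z).eval 0 := by
  obtain ⟨c, rfl⟩ := isConj_iff.1 h
  have e := congrArg (fun a => (coef (c * w) a).eval 0) (T_mul_comm_of_commute hz c)
  simpa only [eval_coef_T_mul, eval_coef_mul_T, inv_mul_cancel_left] using e

/-! ### Conjugacy classes -/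

/-- The cycle type of a permutation, as a partition of `n`. -/
def cycleClass (w : Equiv.Perm (Fin n)) : n.Partition where
  parts := w.partition.parts
  parts_pos := w.partition.parts_pos
  parts_sum := by rw [w.partition.parts_sum, Fintype.card_fin]

theorem inClass_iff {ν : n.Partition} {w : Equiv.Perm (Fin n)} :
    InClass ν w ↔ cycleClass w = ν := by
  rw [Nat.Partition.ext_iff]
  rfl

theorem cycleClass_eq_iff {w v : Equiv.Perm (Fin n)} :
    cycleClass w = cycleClass v ↔ IsConj w v := by
  rw [Equiv.Perm.partition_eq_of_isConj, Nat.Partition.ext_iff, Nat.Partition.ext_iff]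
  rfl

/-- The parts at least `2` are realized as a cycle type; all remaining parts equal `1` and are
accounted for by fixed points. -/
theorem cycleClass_surjective : Function.Surjective (cycleClass (n := n)) := by
  intro ν
  have hsum : (ν.parts.filter (2 ≤ ·)).sum + (ν.parts.filter (¬ 2 ≤ ·)).sum = n := by
    rw [← Multiset.sum_add, Multiset.filter_add_not, ν.parts_sum]
  obtain ⟨w, hw⟩ := (Equiv.Perm.exists_with_cycleType_iff (Fin n)).2
    (⟨by rw [Fintype.card_fin]; omega, fun a ha => (Multiset.mem_filter.1 ha).2⟩ :
      (ν.parts.filter (2 ≤ ·)).sum ≤ _ ∧ _)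
  have hone : ν.parts.filter (¬ 2 ≤ ·) =
      Multiset.replicate (ν.parts.filter (¬ 2 ≤ ·)).card 1 := by
    refine Multiset.eq_replicate_card.2 fun a ha => ?_
    have h1 := (Multiset.mem_filter.1 ha).2
    have h2 := ν.parts_pos (Multiset.mem_filter.1 ha).1
    omega
  have hcard : (ν.parts.filter (¬ 2 ≤ ·)).sum = (ν.parts.filter (¬ 2 ≤ ·)).card := by
    conv_lhs => rw [hone]
    simp
  refine ⟨w, Nat.Partition.ext ?_⟩
  change w.partition.parts = ν.parts
  rw [Equiv.Perm.parts_partition, ← Equiv.Perm.sum_cycleType, hw, Fintype.card_fin,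
    show n - (ν.parts.filter (2 ≤ ·)).sum = (ν.parts.filter (¬ 2 ≤ ·)).card by omega, ← hone,
    Multiset.filter_add_not]

/-- A shortest element is never the result of the length-raising step, so its reduction to a Coxeter
element uses only length-preserving cyclic shifts, along which coefficients of central elements are
constant. -/
theorem exists_isConj_coxPerm (w : Equiv.Perm (Fin n)) : ∃ c : Composition n,
    IsConj w (coxPerm (inner c.blocks) n) ∧
      (IsShortest w → ∀ z : Hecke n, (∀ k, g k * z = z * g k) →
        coef w z = coef (coxPerm (inner c.blocks) n) z) := by
  refine cyclicShift_induction (K := Set.univ) (Q := fun w => ∃ c : Composition n,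
    IsConj w (coxPerm (inner c.blocks) n) ∧
      (IsShortest w → ∀ z : Hecke n, (∀ k, g k * z = z * g k) →
        coef w z = coef (coxPerm (inner c.blocks) n) z)) ?_ ?_ ?_ (by rw [para_univ]; trivial)
  · intro J _ hJ
    obtain ⟨c, rfl⟩ := exists_inner_eq hJ
    exact ⟨c, IsConj.refl _, fun _ _ _ => rfl⟩
  · rintro u i - - h1 h2 ⟨c, hc, -⟩ -
    have hconj : IsConj u (sw i * u * sw i) := isConj_iff.2 ⟨sw i, by rw [sw_inv]⟩
    refine ⟨c, hconj.symm.trans hc, fun hs => ?_⟩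
    have := hs u hconj
    rw [h2.len_mul_sw, h1.len_sw_mul] at this
    omega
  · rintro v i - - h1 h2 ⟨c, hc, hs⟩
    have hconj : IsConj (v * sw i) (sw i * v) :=
      isConj_iff.2 ⟨sw i, by rw [sw_inv, ← mul_assoc, mul_sw_mul_sw]⟩
    refine ⟨c, hconj.trans hc, fun hsh z hz => ?_⟩
    rw [coef_mul_sw_of_commute (hz i) h1 h2]
    refine hs (fun x hx => ?_) z hz
    rw [h2.len_sw_mul, ← h1.len_mul_sw]
    exact hsh x (hx.trans hconj.symm)

theorem coxPerm_of_perm {c c' : Composition n} (h : c.blocks.Perm c'.blocks) :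
    IsConj (coxPerm (inner c.blocks) n : Equiv.Perm (Fin n)) (coxPerm (inner c'.blocks) n) ∧
      ∀ z : Hecke n, (∀ k, g k * z = z * g k) →
        coef (coxPerm (inner c.blocks) n) z = coef (coxPerm (inner c'.blocks) n) z :=
  rel_inner_of_perm (n := n) (R := fun J J' =>
      IsConj (coxPerm J n : Equiv.Perm (Fin n)) (coxPerm J' n) ∧
      ∀ z : Hecke n, (∀ k, g k * z = z * g k) → coef (coxPerm J n) z = coef (coxPerm J' n) z)
    (fun _ => ⟨IsConj.refl _, fun _ _ => rfl⟩)
    (fun _ _ _ h h' => ⟨h.1.trans h'.1, fun z hz => (h.2 z hz).trans (h'.2 z hz)⟩)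
    (fun _ _ _ _ _ h => ⟨h.isConj, fun _ hz => coef_eq_of_T_mul_eq hz h.T_coxPerm_mul⟩)
    h (fun _ hx => c.blocks_pos hx) [] (by simp)

/-- No cycle type is computed. Sending a partition to the class of its Coxeter element is well
defined, and it is surjective by the cyclic-shift reduction; a surjection of a finite set onto
itself is injective. -/
theorem blocks_perm_of_isConj {c c' : Composition n}
    (h : IsConj (coxPerm (inner c.blocks) n : Equiv.Perm (Fin n)) (coxPerm (inner c'.blocks) n)) :
    c.blocks.Perm c'.blocks := by
  choose comp hcomp using Nat.Partition.ofComposition_surj (n := n)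
  let φ : n.Partition → n.Partition := fun ν => cycleClass (coxPerm (inner (comp ν).blocks) n)
  have hφ : ∀ c : Composition n, φ (Nat.Partition.ofComposition n c) =
      cycleClass (coxPerm (inner c.blocks) n) := fun c =>
    cycleClass_eq_iff.2 (coxPerm_of_perm (Multiset.coe_eq_coe.1
      (congrArg Nat.Partition.parts (hcomp (Nat.Partition.ofComposition n c))))).1
  have hsurj : Function.Surjective φ := by
    intro ν
    obtain ⟨w, rfl⟩ := cycleClass_surjective ν
    obtain ⟨c, hc, -⟩ := exists_isConj_coxPerm w
    exact ⟨Nat.Partition.ofComposition n c, (hφ c).trans (cycleClass_eq_iff.2 hc.symm)⟩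
  have hinj := Finite.injective_iff_surjective.2 hsurj
  refine Multiset.coe_eq_coe.1 (congrArg Nat.Partition.parts
    (hinj (a₁ := Nat.Partition.ofComposition n c) (a₂ := Nat.Partition.ofComposition n c') ?_))
  rw [hφ, hφ, cycleClass_eq_iff.2 h]

theorem coef_coxPerm_eq_of_isConj {c c' : Composition n}
    (h : IsConj (coxPerm (inner c.blocks) n : Equiv.Perm (Fin n)) (coxPerm (inner c'.blocks) n))
    {z : Hecke n} (hz : ∀ k, g k * z = z * g k) :
    coef (coxPerm (inner c.blocks) n) z = coef (coxPerm (inner c'.blocks) n) z :=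
  (coxPerm_of_perm (blocks_perm_of_isConj h)).2 z hz

theorem exists_cycleClass_coxPerm (ν : n.Partition) :
    ∃ c : Composition n, cycleClass (coxPerm (inner c.blocks) n) = ν := by
  obtain ⟨w, rfl⟩ := cycleClass_surjective ν
  obtain ⟨c, hc, -⟩ := exists_isConj_coxPerm w
  exact ⟨c, cycleClass_eq_iff.2 hc.symm⟩

/-- A composition whose Coxeter element has cycle type `ν`. -/
noncomputable def classComp (ν : n.Partition) : Composition n :=
  (exists_cycleClass_coxPerm ν).choose

/-- A Coxeter element of a parabolic subgroup, of cycle type `ν`. -/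
noncomputable def classRep (ν : n.Partition) : Equiv.Perm (Fin n) :=
  coxPerm (inner (classComp ν).blocks) n

@[simp] theorem cycleClass_classRep (ν : n.Partition) : cycleClass (classRep ν) = ν :=
  (exists_cycleClass_coxPerm ν).choose_spec

theorem coef_coxPerm_eq_coef_classRep {J : Set ℕ} (hJ : ∀ i ∈ J, i + 1 < n) {z : Hecke n}
    (hz : ∀ k, g k * z = z * g k) :
    coef (coxPerm J n) z = coef (classRep (cycleClass (coxPerm J n))) z := by
  obtain ⟨c, rfl⟩ := exists_inner_eq hJ
  exact coef_coxPerm_eq_of_isConj (cycleClass_eq_iff.1 (cycleClass_classRep _).symm) hz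

theorem coef_eq_coef_classRep_of_isShortest {w : Equiv.Perm (Fin n)} (hw : IsShortest w)
    {z : Hecke n} (hz : ∀ k, g k * z = z * g k) : coef w z = coef (classRep (cycleClass w)) z := by
  obtain ⟨c, hc, h⟩ := exists_isConj_coxPerm w
  rw [h hw z hz, coef_coxPerm_eq_coef_classRep (lt_of_mem_inner c) hz, cycleClass_eq_iff.2 hc]

theorem exists_isShortest (ν : n.Partition) :
    ∃ w : Equiv.Perm (Fin n), IsShortest w ∧ cycleClass w = ν := by
  obtain ⟨w, hw, hmin⟩ := Set.exists_min_image {w : Equiv.Perm (Fin n) | cycleClass w = ν} len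
    (Set.toFinite _) (cycleClass_surjective ν)
  have hw' : cycleClass w = ν := hw
  exact ⟨w, fun v hv => hmin v ((cycleClass_eq_iff.2 hv).trans hw'), hw'⟩

/-- The recursions along cyclic shifts express each coefficient of a central element through those
at the class representatives, by polynomials that do not depend on the central element. -/
theorem exists_classPolynomials (w : Equiv.Perm (Fin n)) : ∃ p : n.Partition → ℤ[X],
    ∀ z : Hecke n, (∀ k, g k * z = z * g k) → coef w z = ∑ ν, p ν * coef (classRep ν) z := by
  classical
  refine cyclicShift_induction (K := Set.univ) (Q := fun w => ∃ p : n.Partition → ℤ[X],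
    ∀ z : Hecke n, (∀ k, g k * z = z * g k) → coef w z = ∑ ν, p ν * coef (classRep ν) z)
    ?_ ?_ ?_ (by rw [para_univ]; trivial)
  · intro J _ hJ
    refine ⟨Pi.single (cycleClass (coxPerm J n)) 1, fun z hz => ?_⟩
    rw [coef_coxPerm_eq_coef_classRep hJ hz]
    simp [Pi.single_apply]
  · rintro u i - - h1 h2 ⟨p, hp⟩ ⟨q, hq⟩
    refine ⟨p + (X : ℤ[X]) • q, fun z hz => ?_⟩
    rw [coef_sw_mul_sw_of_commute (hz i) h1 h2, hp z hz, hq z hz, Finset.mul_sum,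
      ← Finset.sum_add_distrib]
    refine Finset.sum_congr rfl fun ν _ => ?_
    rw [Pi.add_apply, Pi.smul_apply, smul_eq_mul, add_mul, mul_assoc]
  · rintro v i - - h1 h2 ⟨p, hp⟩
    exact ⟨p, fun z hz => by rw [coef_mul_sw_of_commute (hz i) h1 h2, hp z hz]⟩

theorem eq_zero_of_coef_classRep {z : Hecke n} (hz : ∀ k, g k * z = z * g k)
    (h : ∀ ν, coef (classRep ν) z = 0) : z = 0 := by
  rw [← sum_coef z]
  refine Finset.sum_eq_zero fun w _ => ?_
  obtain ⟨p, hp⟩ := exists_classPolynomials w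
  rw [hp z hz, Finset.sum_eq_zero (fun ν _ => by rw [h, mul_zero]), zero_smul]

theorem eq_of_coef_classRep {y z : Hecke n} (hy : ∀ k, g k * y = y * g k)
    (hz : ∀ k, g k * z = z * g k) (h : ∀ ν, coef (classRep ν) y = coef (classRep ν) z) :
    y = z := by
  refine sub_eq_zero.1 (eq_zero_of_coef_classRep (fun k => ?_) fun ν => ?_)
  · rw [mul_sub, sub_mul, hy, hz]
  · rw [map_sub, h, sub_self]

/-! ### The class elements -/

/-- At `ξ = 0` the matrix becomes diagonal, since each norm is then supported on a single class, and
its diagonal entries are positive. So its determinant is a nonzero polynomial. -/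
theorem eq_zero_of_sum_mul_coef_normMurphy {x : n.Partition → ℤ[X]}
    (hx : ∀ μ : n.Partition, ∑ ν, x ν * coef (classRep ν) (normMurphy n (inner (classComp μ).blocks)) = 0) :
    x = 0 := by
  classical
  let A : Matrix n.Partition n.Partition ℤ[X] := fun ν μ =>
    coef (classRep ν) (normMurphy n (inner (classComp μ).blocks))
  refine Matrix.eq_zero_of_vecMul_eq_zero (M := A) (fun hdet => ?_) (funext hx)
  have hA : (evalRingHom (0 : ℤ)).mapMatrix A = Matrix.diagonal fun ν => (A ν ν).eval 0 := by
    ext ν μ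
    rcases eq_or_ne ν μ with rfl | h
    · simp
    · rw [Matrix.diagonal_apply_ne _ h]
      refine eval_coef_normMurphy_eq_zero (lt_of_mem_inner _) fun hc => h ?_
      rw [← cycleClass_classRep ν, ← cycleClass_classRep μ]
      exact cycleClass_eq_iff.2 hc
  have h0 := congrArg (evalRingHom (0 : ℤ)) hdet
  rw [RingHom.map_det, hA, Matrix.det_diagonal, map_zero, Finset.prod_eq_zero_iff] at h0
  obtain ⟨ν, -, hν⟩ := h0
  exact (eval_coef_normMurphy_pos (lt_of_mem_inner (classComp ν))).ne' hν

/-- The element is `∑ p_{w,ν} T_w`, built from class polynomials. Everything required of it is a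
linear relation among these polynomials, which by the nonsingular matrix above need only be tested
on the central elements `normMurphy`. -/
theorem exists_commute_coef_classRep (ν : n.Partition) : ∃ z : Hecke n,
    (∀ k, g k * z = z * g k) ∧ coef (classRep ν) z = 1 ∧
      ∀ μ, μ ≠ ν → coef (classRep μ) z = 0 := by
  classical
  choose p hp using exists_classPolynomials (n := n)
  have hz : ∀ μ k, g k * normMurphy n (inner (classComp μ).blocks) =
      normMurphy n (inner (classComp μ).blocks) * g k := fun μ =>
    g_mul_normMurphy (lt_of_mem_inner _)
  have hrep : ∀ μ, p (classRep μ) = Pi.single μ 1 := by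
    intro μ
    refine sub_eq_zero.1 (eq_zero_of_sum_mul_coef_normMurphy fun lam => ?_)
    simp only [Pi.sub_apply, sub_mul, Finset.sum_sub_distrib]
    rw [← hp _ _ (hz lam)]
    simp [Pi.single_apply]
  have hcoef : ∀ ν w, coef w (∑ v, p v ν • T v) = p w ν := by
    intro ν w
    simp [map_sum, coef_T]
  refine ⟨∑ w, p w ν • T w, fun k => ?_, ?_, fun μ h => ?_⟩
  · let D : Hecke n →ₗ[ℤ[X]] Hecke n :=
      LinearMap.mulLeft ℤ[X] (g k) - LinearMap.mulRight ℤ[X] (g k)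
    have hD : ∀ a, D a = g k * a - a * g k := fun _ => rfl
    refine sub_eq_zero.1 (ext_coef fun w => ?_)
    rw [← hD, map_zero]
    -- The known central elements are combinations of the candidates. Pairing the coefficients of
    -- the candidates' commutators with `g k` against them therefore gives zero, and nonsingularity
    -- kills each commutator separately.
    refine congrFun (eq_zero_of_sum_mul_coef_normMurphy
      (x := fun ν => coef w (D (∑ v, p v ν • T v))) fun lam => ?_) ν
    have key : ∑ ν, coef (classRep ν) (normMurphy n (inner (classComp lam).blocks)) •
        (∑ v, p v ν • T v : Hecke n) = normMurphy n (inner (classComp lam).blocks) := by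
      refine ext_coef fun w => ?_
      simp only [map_sum, map_smul, hcoef]
      rw [hp w _ (hz lam)]
      exact Finset.sum_congr rfl fun ν _ => mul_comm _ _
    have e := congrArg (fun a => coef w (D a)) key
    simp only [map_sum D, map_sum (coef w), map_smul, smul_eq_mul] at e
    rw [hD, hz, sub_self, map_zero] at e
    rw [← e]
    simp only [map_sum D, map_sum (coef w), map_smul, smul_eq_mul, mul_comm]
  · rw [hcoef, hrep, Pi.single_eq_same]
  · rw [hcoef, hrep, Pi.single_eq_of_ne h.symm]

theorem IsClassElements.commute {Γ : n.Partition → Hecke n} (h : IsClassElements Γ)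
    (ν : n.Partition) : ∀ k, g k * Γ ν = Γ ν * g k :=
  mem_center_iff.1 (h ν).1

theorem coef_sum_smul_T (f : Equiv.Perm (Fin n) → ℤ[X]) (v : Equiv.Perm (Fin n)) :
    coef v (∑ w, f w • T w) = f v := by
  classical
  simp [map_sum, coef_T]

-- Centrality makes coefficients at shortest elements, and all coefficients at `ξ = 0`, depend only
-- on the class. Hence the defining conditions collapse to duality with the coefficients at
-- `classRep`.
open Classical in
theorem isClassElements_iff {Γ : n.Partition → Hecke n} : IsClassElements Γ ↔
    ∀ ν, (∀ k, g k * Γ ν = Γ ν * g k) ∧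
      ∀ μ, coef (classRep μ) (Γ ν) = if μ = ν then 1 else 0 := by
  constructor
  · intro h ν
    refine ⟨h.commute ν, fun μ => ?_⟩
    obtain ⟨w, hw, rfl⟩ := exists_isShortest μ
    obtain ⟨-, f, hf, -, -, h1, h2⟩ := h ν
    rw [← coef_eq_coef_classRep_of_isShortest hw (h.commute ν), hf, coef_sum_smul_T]
    split_ifs with hc
    · exact h1 w hw (inClass_iff.2 hc)
    · exact h2 w hw fun h' => hc (inClass_iff.1 h')
  · intro h ν
    obtain ⟨hz, hc⟩ := h ν
    have heval : ∀ w, (coef w (Γ ν)).eval 0 = if cycleClass w = ν then 1 else 0 := by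
      intro w
      rw [eval_coef_eq_of_isConj hz (cycleClass_eq_iff.1 (cycleClass_classRep _).symm), hc]
      split_ifs <;> simp
    refine ⟨mem_center_iff.2 hz, fun w => coef w (Γ ν), (sum_coef _).symm, fun w hw => ?_,
      fun w hw => ?_, fun w hs hw => ?_, fun w hs hw => ?_⟩
    · rw [heval, if_pos (inClass_iff.1 hw)]
    · rw [heval, if_neg fun h' => hw (inClass_iff.2 h')]
    · exact (coef_eq_coef_classRep_of_isShortest hs hz).trans
        ((hc _).trans (if_pos (inClass_iff.1 hw)))
    · exact (coef_eq_coef_classRep_of_isShortest hs hz).trans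
        ((hc _).trans (if_neg fun h' => hw (inClass_iff.2 h')))

theorem existsUnique_isClassElements : ∃! Γ : n.Partition → Hecke n, IsClassElements Γ := by
  classical
  choose Γ hΓ using exists_commute_coef_classRep (n := n)
  have h : IsClassElements Γ := isClassElements_iff.2 fun ν => ⟨(hΓ ν).1, fun μ => by
    split_ifs with hc
    · rw [hc, (hΓ ν).2.1]
    · exact (hΓ ν).2.2 μ hc⟩
  refine ⟨Γ, h, fun Γ' h' => funext fun ν => ?_⟩
  refine eq_of_coef_classRep (h'.commute ν) (h.commute ν) fun μ => ?_
  rw [(isClassElements_iff.1 h ν).2, (isClassElements_iff.1 h' ν).2]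

/-- The class elements are dual to the coefficients at `classRep`. So the expansion coefficients are
themselves coefficients of `z`, which reduces the corollary to the theorem. -/
theorem eq_sum_smul_iff {Γ : n.Partition → Hecke n} (h : IsClassElements Γ) {z : Hecke n}
    (hz : ∀ k, g k * z = z * g k) (c : n.Partition → ℤ[X]) :
    z = ∑ ν, c ν • Γ ν ↔ c = fun ν => coef (classRep ν) z := by
  classical
  have key : ∀ (c : n.Partition → ℤ[X]) μ, coef (classRep μ) (∑ ν, c ν • Γ ν) = c μ := by
    intro c μ
    simp [map_sum, (isClassElements_iff.1 h _).2]
  constructor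
  · rintro rfl
    exact funext fun μ => (key c μ).symm
  · rintro rfl
    refine eq_of_coef_classRep hz (fun k => ?_) fun μ => (key (fun ν => coef (classRep ν) z) μ).symm
    simp only [Finset.mul_sum, Finset.sum_mul, mul_smul_comm, smul_mul_assoc, h.commute _ k]

/-! ### Comparison of norms -/

theorem StrictRefines.exists_normElt_eq {lam mu : Composition n} (h : StrictRefines lam mu) :
    ∃ a ∈ posSemiring n,
      normElt lam = (X : ℤ[X]) ^ (minLen mu - minLen lam) • normElt mu + a := by
  rw [normElt_eq, normElt_eq, minLen_eq, minLen_eq,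
    ← Set.ncard_sdiff h.1.inner_subset (finite_inner lam)]
  exact normMurphy_of_subset (lt_of_mem_inner mu) h.1.inner_subset

theorem StrictRefines.minLen_lt {lam mu : Composition n} (h : StrictRefines lam mu) :
    minLen lam < minLen mu := by
  rw [minLen_eq, minLen_eq]
  exact Set.ncard_lt_ncard (h.1.inner_subset.ssubset_of_ne fun e => h.2 (inner_injective e))
    (finite_inner mu)

theorem normElt_mem_posSemiring (ν : Composition n) : normElt ν ∈ posSemiring n := by
  rw [normElt_eq]
  exact normMurphy_mem_posSemiring (lt_of_mem_inner ν)

theorem g_mul_normElt (ν : Composition n) (k : ℕ) : g k * normElt ν = normElt ν * g k := by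
  rw [normElt_eq]
  exact g_mul_normMurphy (lt_of_mem_inner ν) k

theorem X_pow_mem_polyPos (k : ℕ) : (X : ℤ[X]) ^ k ∈ polyPos := pow_mem X_mem_polyPos k

theorem StrictRefines.heckeLT {lam mu : Composition n} (h : StrictRefines lam mu) :
    HeckeLT ((X : ℤ[X]) ^ (minLen mu - minLen lam) • normElt mu) (normElt lam) := by
  obtain ⟨a, ha, e⟩ := h.exists_normElt_eq
  have e' : normElt lam - (X : ℤ[X]) ^ (minLen mu - minLen lam) • normElt mu = a := by
    rw [e]
    exact add_sub_cancel_left _ _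
  refine ⟨mem_posCone_iff.2 (smul_mem_posSemiring (X_pow_mem_polyPos _)
    (normElt_mem_posSemiring mu)), mem_posCone_iff.2 (normElt_mem_posSemiring lam), ?_, ?_⟩
  · rw [e']
    exact mem_posCone_iff.2 ha
  · rw [e']
    rintro rfl
    -- If the difference were zero, `b_λ` would be divisible by `ξ`, the exponent being positive;
    -- but its coefficient at `w_λ` does not vanish at `ξ = 0`.
    have hpos := eval_coef_normMurphy_pos (lt_of_mem_inner lam)
    have hlt := h.minLen_lt
    rw [← normElt_eq, e, add_zero, map_smul, smul_eq_mul, eval_mul, eval_pow, eval_X,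
      zero_pow (by omega), zero_mul] at hpos
    exact lt_irrefl _ hpos

theorem StrictRefines.polyLE_coef {lam mu : Composition n} (h : StrictRefines lam mu)
    (w : Equiv.Perm (Fin n)) :
    PolyLE (X ^ (minLen mu - minLen lam) * coef w (normElt mu)) (coef w (normElt lam)) := by
  obtain ⟨a, ha, e⟩ := h.exists_normElt_eq
  refine ⟨polyPos.mul_mem (X_pow_mem_polyPos _) (normElt_mem_posSemiring mu w),
    normElt_mem_posSemiring lam w, ?_⟩
  rw [e, map_add, map_smul, smul_eq_mul, add_sub_cancel_left]
  exact ha w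

end HeckeNorm

theorem mainTheorem5 (n : ℕ) :
    (∀ lam mu : Composition n, HeckeNorm.StrictRefines lam mu →
      HeckeNorm.HeckeLT
        ((Polynomial.X : Polynomial ℤ) ^ (HeckeNorm.minLen mu - HeckeNorm.minLen lam) •
          HeckeNorm.normElt mu)
        (HeckeNorm.normElt lam)) ∧
    (∃! Γ : n.Partition → HeckeNorm.Hecke n, HeckeNorm.IsClassElements Γ) ∧
    (∀ Γ : n.Partition → HeckeNorm.Hecke n, HeckeNorm.IsClassElements Γ →
      ∃ r : Composition n → n.Partition → Polynomial ℤ,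
        (∀ (α : Composition n) (c : n.Partition → Polynomial ℤ),
          HeckeNorm.normElt α = ∑ ν, c ν • Γ ν ↔ c = r α) ∧
        (∀ α β : Composition n, HeckeNorm.StrictRefines α β → ∀ ν : n.Partition,
          HeckeNorm.PolyLE
            (Polynomial.X ^ (HeckeNorm.minLen β - HeckeNorm.minLen α) * r β ν) (r α ν))) := by
  refine ⟨fun lam mu h => h.heckeLT, HeckeNorm.existsUnique_isClassElements, fun Γ hΓ =>
    ⟨fun α ν => HeckeNorm.coef (HeckeNorm.classRep ν) (HeckeNorm.normElt α), fun α c =>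
      HeckeNorm.eq_sum_smul_iff hΓ (HeckeNorm.g_mul_normElt α) c, fun α β h ν => h.polyLE_coef _⟩⟩
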